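/- Let $1<\alpha\le 2$, $0<\beta<\alpha-1$, $\beta\neq(\alpha-1)/2$, $\phi_1>0$, and let $\phi$ be a bounded probability density on $[0,1)$ with $\phi(a)\sim\phi_1(1-a)^\beta$ as $a\nearrow 1$. Let $p_k(t,s)$ be the $k$-step transition probabilities from $(0,0)$ of the random walk on $\mathbb Z^2$ with steps $(1,0),(0,1),(0,-1)$, each of probability $1/3$, and let $g_3(t,s,a)=\sum_{k\ge0}a^kp_k(t,s)$, $0\le a<1$. A symmetric $\alpha$-stable random measure with control measure $\mu$ is an independently scattered, $\sigma$-additive random measure $M$ with $\mathrm E e^{\mathrm i\theta M(B)}=e^{-|\theta|^\alpha\mu(B)}$ for all measurable $B$ with $\mu(B)<\infty$. Let $M_{u,v}(da)$, $(u,v)\in\mathbb Z^2$, be i.i.d. symmetric $\alpha$-stable random measures on $[0,1)$ with control measure $\phi(a)\,da$ (equivalently, a symmetric $\alpha$-stable random measure on $\mathbb Z^2\times[0,1)$ whose control measure is the product of counting measure and $\phi(a)\,da$), and let $$\mathfrak X_3(t,s)=\sum_{(u,v)\in\mathbb Z^2}\int_{[0,1)}g_3(t-u,s-v,a)\,M_{u,v}(da),\qquad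 (t,s)\in\mathbb Z^2,$$ be the aggregated 3N field. Let $h_3(t,s,z)=\frac{3}{2\sqrt{\pi t}}e^{-3zt-s^2/(4t)}\mathbf 1(t>0,z>0)$, let $\mathcal M$ be a symmetric $\alpha$-stable random measure on $\mathbb R^2\times(0,\infty)$ with control measure $\mu(du,dv,dz)=\phi_1z^\beta\,du\,dv\,dz$, and for $\gamma>0$, $x,y\ge0$ let $V_{3\gamma}(x,y)=\int F_{3\gamma}(x,y;u,v,z)\,\mathcal M(du,dv,dz)$, where $$F_{3\gamma}(x,y;u,v,z)=\begin{cases}\int_0^x\int_0^yh_3(t-u,s-v,z)\,ds\,dt,&\gamma=\tfrac12,\\ \mathbf 1(0<v<y)\int_0^x\int_{\mathbb R}h_3(t-u,w,z)\,dw\,dt,&\gamma>\tfrac12,\\ \mathbf 1(0<u<x)\int_0^y\int_{\mathbb R}h_3(w,v-s,z)\,dw\,ds,&\gamma<\tfrac12,\ \beta>\tfrac{\alpha-1}2,\\ y\int_0^xh_3(t-u,v,z)\,dt,&\gamma<\tfrac12,\ \beta<\tfrac{\alpha-1}2,\end{cases}$$ and $$H(\gamma)=\begin{cases}\frac{\gamma+\alpha-\beta}{\alpha},&\gamma\ge\frac12,\\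 \frac{1-\gamma+2\gamma(\alpha-\beta)}{\alpha},&\gamma<\frac12,\ \beta>\frac{\alpha-1}2,\\ \frac{\alpha\gamma+(\alpha+1)/2-\beta}{\alpha},&\gamma<\frac12,\ \beta<\frac{\alpha-1}2.\end{cases}$$ Then these stochastic integrals exist (the integrands are in $L^\alpha$ of the control measures), and for every $\gamma>0$ the field $V_{3\gamma}$ is operator scaling, i.e. $\{V_{3\gamma}(\lambda x,\lambda^\gamma y)\}_{x,y\ge0}$ and $\{\lambda^{H(\gamma)}V_{3\gamma}(x,y)\}_{x,y\ge0}$ have the same finite-dimensional distributions for each $\lambda>0$, and, as $n\to\infty$, $$n^{-H(\gamma)}\sum_{1\le t\le nx}\ \sum_{1\le s\le n^\gamma y}\mathfrak X_3(t,s)\ \longrightarrow\ V_{3\gamma}(x,y),\qquad x,y>0,$$ in the sense of weak convergence of finite-dimensional distributions. Moreover, $\mathfrak X_3$ has Type I anisotropic distributional long-range dependence with $\gamma_0=1/2$. The last notion is defined as follows. For a random field $V$ on $[0,\infty)^2$ and a nonempty rectangle $K=(u,x]\times(v,y]\subset(0,\infty)^2$ put $V(K)=V(x,y)-V(u,y)-V(x,v)+V(u,v)$.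 $V$ has stationary rectangular increments if for all $u,v>0$ the families $\{V((u,x]\times(v,y])\}$ and $\{V((0,x-u]\times(0,y-v])\}$, $x\ge u$, $y\ge v$, have the same finite-dimensional distributions. For a line $\ell\ni(0,0)$, $V$ has independent rectangular increments in direction $\ell$ if $V(K),V(K')$ are independent whenever $K,K'$ lie on different sides of (are separated by) a line orthogonal to $\ell$ (they may touch it); invariant rectangular increments in direction $\ell$ if $V(K)=V(K')$ a.s. whenever $K'$ is a translate of $K$ by a vector in $\ell$; dependent rectangular increments in direction $\ell$ if neither holds. $V$ has dependent rectangular increments if this is so in every direction, and semi-dependent rectangular increments if they are dependent in some direction and independent or invariant in some direction. A stationary field $Y$ on $\mathbb Z^2$ has Type I distributional long-range dependence with $\gamma_0>0$ if for each $\gamma>0$ there are $H(\gamma)>0$ and a field $V_\gamma$ on $[0,\infty)^2$ with stationary rectangular increments and $V_\gamma(x,0)=V_\gamma(0,y)=0$ a.s., such that $n^{-H(\gamma)}\sum_{1\le t\le nx,\,1\le s\le n^\gamma y}Y(t,s)\to V_\gamma(x,y)$, $x,y>0$, in finite-dimensional distributions, where $V_{\gamma_0}$ has dependent and $V_\gamma$,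 $\gamma\ne\gamma_0$, semi-dependent rectangular increments. It is anisotropic if $\gamma_0\ne1$. -/

import Mathlib

open MeasureTheory ProbabilityTheory Filter Topology Set
open scoped ENNReal

universe u v

noncomputable section

namespace StableLRD

/-! ### Symmetric `α`-stable random measures and stochastic integrals -/

section Stable

variable {E : Type*} [MeasurableSpace E] {Ω : Type*} [MeasurableSpace Ω]

/-- `M` is an (independently scattered, `σ`-additive) symmetric `α`-stable random measure on `E`
with control measure `μ`, defined on the measurable sets of finite `μ`-measure:
`𝔼 exp (i θ M(A)) = exp (-|θ|^α μ(A))`. The values of `M` on other sets are irrelevant. -/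
structure IsStableRandomMeasure (α : ℝ) (μ : Measure E) (P : Measure Ω)
    (M : Set E → Ω → ℝ) : Prop where
  measurable : ∀ A, MeasurableSet A → μ A < ∞ → Measurable (M A)
  indep : ∀ (k : ℕ) (A : Fin k → Set E), (∀ i, MeasurableSet (A i)) → (∀ i, μ (A i) < ∞) →
    Pairwise (fun i j => Disjoint (A i) (A j)) → iIndepFun (fun i => M (A i)) P
  sigma_additive : ∀ A : ℕ → Set E, (∀ i, MeasurableSet (A i)) →
    Pairwise (fun i j => Disjoint (A i) (A j)) → μ (⋃ i, A i) < ∞ →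
    ∀ᵐ ω ∂P, Tendsto (fun n => ∑ i ∈ Finset.range n, M (A i) ω) atTop (𝓝 (M (⋃ i, A i) ω))
  charFun_eq : ∀ A, MeasurableSet A → μ A < ∞ → ∀ θ : ℝ,
    charFun (P.map (M A)) θ = ((Real.exp (-(|θ| ^ α * (μ A).toReal)) : ℝ) : ℂ)

/-- The integral `∑ c, c * M {f = c}` of a simple function. -/
def simpleIntegral (M : Set E → Ω → ℝ) (f : SimpleFunc E ℝ) (ω : Ω) : ℝ :=
  ∑ c ∈ f.range, c * M (f ⁻¹' {c}) ω

/-- `I` is (a version of) the stochastic integral `∫ f dM`, for `f ∈ L^α(μ)`: it is the limit in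
probability of the integrals of simple functions that converge to `f` in `L^α(μ)`. -/
def IsStableIntegral (α : ℝ) (μ : Measure E) (P : Measure Ω) (M : Set E → Ω → ℝ)
    (f : E → ℝ) (I : Ω → ℝ) : Prop :=
  MemLp f (ENNReal.ofReal α) μ ∧ Measurable I ∧
  ∃ fn : ℕ → SimpleFunc E ℝ,
    (∀ n, MemLp (fn n) (ENNReal.ofReal α) μ) ∧
    Tendsto (fun n => eLpNorm (fun e => f e - fn n e) (ENNReal.ofReal α) μ) atTop (𝓝 0) ∧
    TendstoInMeasure P (fun n => simpleIntegral M (fn n)) atTop I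

open Classical in
/-- The stochastic integral `∫ f dM` (zero if it does not exist). -/
def stableIntegral (α : ℝ) (μ : Measure E) (P : Measure Ω) (M : Set E → Ω → ℝ)
    (f : E → ℝ) : Ω → ℝ :=
  if h : ∃ I, IsStableIntegral α μ P M f I then h.choose else 0

end Stable

/-! ### Random fields, finite-dimensional distributions -/

section Fields

variable {Ω : Type*} [MeasurableSpace Ω] {Ω' : Type*} [MeasurableSpace Ω']

/-- Equality of the finite-dimensional distributions of two fields, over the index set `T`. -/
def FddEq {ι : Type*} (P : Measure Ω) (P' : Measure Ω') (T : Set ι)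
    (X : ι → Ω → ℝ) (Y : ι → Ω' → ℝ) : Prop :=
  ∀ (k : ℕ) (p : Fin k → ι), (∀ i, p i ∈ T) →
    IdentDistrib (fun ω i => X (p i) ω) (fun ω i => Y (p i) ω) P P'

/-- Weak convergence of the finite-dimensional distributions, over the index set `T`. -/
def FddTendsto {ι : Type*} (P : Measure Ω) [IsProbabilityMeasure P]
    (P' : Measure Ω') [IsProbabilityMeasure P'] (T : Set ι)
    (S : ℕ → ι → Ω → ℝ) (V : ι → Ω' → ℝ) : Prop :=
  ∀ (k : ℕ) (p : Fin k → ι), (∀ i, p i ∈ T) →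
    TendstoInDistribution (fun n ω (i : Fin k) => S n (p i) ω) atTop
      (fun ω (i : Fin k) => V (p i) ω) (fun _ => P) P'

/-- The open quadrant `{(x, y) : x > 0, y > 0}`. -/
def openQuadrant : Set (ℝ × ℝ) := {p | 0 < p.1 ∧ 0 < p.2}

/-- The closed quadrant `{(x, y) : x ≥ 0, y ≥ 0}`. -/
def closedQuadrant : Set (ℝ × ℝ) := {p | 0 ≤ p.1 ∧ 0 ≤ p.2}

/-- Stationarity of a random field on `ℤ²`. -/
def IsStationaryField (P : Measure Ω) (Y : ℤ × ℤ → Ω → ℝ) : Prop :=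
  ∀ h : ℤ × ℤ, FddEq P P Set.univ (fun p => Y (p + h)) Y

/-- `n^{-H} ∑_{1 ≤ t ≤ n x} ∑_{1 ≤ s ≤ n^γ y} Y(t,s)`. -/
def normalizedSum (Y : ℤ × ℤ → Ω → ℝ) (H γ : ℝ) (n : ℕ) (p : ℝ × ℝ) (ω : Ω) : ℝ :=
  (n : ℝ) ^ (-H) *
    ∑ t ∈ Finset.Icc (1 : ℤ) ⌊(n : ℝ) * p.1⌋,
      ∑ s ∈ Finset.Icc (1 : ℤ) ⌊(n : ℝ) ^ γ * p.2⌋, Y (t, s) ω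

/-- Operator scaling with matrix `diag(1, γ)` and exponent `H`:
`{V(λ x, λ^γ y)}` and `{λ^H V(x, y)}` have the same finite-dimensional distributions. -/
def IsOperatorScaling (P : Measure Ω) (V : ℝ × ℝ → Ω → ℝ) (H γ : ℝ) : Prop :=
  ∀ c : ℝ, 0 < c →
    FddEq P P closedQuadrant (fun p => V (c * p.1, c ^ γ * p.2)) (fun p ω => c ^ H * V p ω)

/-! ### Rectangular increments -/

/-- The increment `V(x,y) - V(u,y) - V(x,v) + V(u,v)` over the rectangle with corners
`p = (u,v)` and `q = (x,y)`. -/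
def rectIncrement (V : ℝ × ℝ → Ω → ℝ) (p q : ℝ × ℝ) (ω : Ω) : ℝ :=
  V (q.1, q.2) ω - V (p.1, q.2) ω - V (q.1, p.2) ω + V (p.1, p.2) ω

/-- Stationary rectangular increments of a field on the closed quadrant. -/
def HasStationaryRectIncrements (P : Measure Ω) (V : ℝ × ℝ → Ω → ℝ) : Prop :=
  ∀ p ∈ openQuadrant, FddEq P P {q : ℝ × ℝ | p.1 ≤ q.1 ∧ p.2 ≤ q.2}
    (fun q => rectIncrement V p q) (fun q => rectIncrement V (0, 0) (q - p))

/-- `V(x,0) = V(0,y) = 0` almost surely, for all `x, y ≥ 0`. -/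
def VanishesOnAxes (P : Measure Ω) (V : ℝ × ℝ → Ω → ℝ) : Prop :=
  (∀ x : ℝ, 0 ≤ x → V (x, 0) =ᵐ[P] 0) ∧ (∀ y : ℝ, 0 ≤ y → V (0, y) =ᵐ[P] 0)

/-- A (nonempty) rectangle `(u,x] × (v,y]`, given by its corners `lo = (u,v)`, `hi = (x,y)`. -/
structure PlaneRect where
  lo : ℝ × ℝ
  hi : ℝ × ℝ
  lt_fst : lo.1 < hi.1
  lt_snd : lo.2 < hi.2

/-- The set `(u,x] × (v,y]`. -/
def PlaneRect.toSet (K : PlaneRect) : Set (ℝ × ℝ) :=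
  {p | K.lo.1 < p.1 ∧ p.1 ≤ K.hi.1 ∧ K.lo.2 < p.2 ∧ p.2 ≤ K.hi.2}

/-- The increment `V(K)`. -/
def PlaneRect.increment (K : PlaneRect) (V : ℝ × ℝ → Ω → ℝ) : Ω → ℝ :=
  rectIncrement V K.lo K.hi

/-- The line `a x + b y = c`, `(a,b) ≠ (0,0)`. -/
structure PlaneLine where
  a : ℝ
  b : ℝ
  c : ℝ
  ne_zero : a ≠ 0 ∨ b ≠ 0

/-- The points of a line. -/
def PlaneLine.toSet (l : PlaneLine) : Set (ℝ × ℝ) := {p | l.a * p.1 + l.b * p.2 = l.c}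

/-- Perpendicular lines. -/
def PlaneLine.Perp (l l' : PlaneLine) : Prop := l.a * l'.a + l.b * l'.b = 0

/-- The set `K` lies on the side `a x + b y ≤ c` of the line and `K'` on the side
`a x + b y ≥ c`, or the other way round. -/
def PlaneLine.Separates (l : PlaneLine) (K K' : Set (ℝ × ℝ)) : Prop :=
  ((∀ p ∈ K, l.a * p.1 + l.b * p.2 ≤ l.c) ∧ (∀ p ∈ K', l.c ≤ l.a * p.1 + l.b * p.2)) ∨
  ((∀ p ∈ K', l.a * p.1 + l.b * p.2 ≤ l.c) ∧ (∀ p ∈ K, l.c ≤ l.a * p.1 + l.b * p.2))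

/-- Independent rectangular increments in direction `l`. -/
def IndepIncrementsDir (P : Measure Ω) (V : ℝ × ℝ → Ω → ℝ) (l : PlaneLine) : Prop :=
  ∀ l' : PlaneLine, l'.Perp l → ∀ K K' : PlaneRect,
    K.toSet ⊆ openQuadrant → K'.toSet ⊆ openQuadrant → l'.Separates K.toSet K'.toSet →
    IndepFun (K.increment V) (K'.increment V) P

/-- Invariant rectangular increments in direction `l`. -/
def InvariantIncrementsDir (P : Measure Ω) (V : ℝ × ℝ → Ω → ℝ) (l : PlaneLine) : Prop :=
  ∀ K K' : PlaneRect, K.toSet ⊆ openQuadrant → K'.toSet ⊆ openQuadrant →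
    (∃ w ∈ l.toSet, K'.lo = w + K.lo ∧ K'.hi = w + K.hi) →
    K.increment V =ᵐ[P] K'.increment V

/-- Dependent rectangular increments in direction `l`. -/
def DependentIncrementsDir (P : Measure Ω) (V : ℝ × ℝ → Ω → ℝ) (l : PlaneLine) : Prop :=
  ¬ IndepIncrementsDir P V l ∧ ¬ InvariantIncrementsDir P V l

/-- Dependent rectangular increments: dependent in the direction of every line through `0`. -/
def DependentIncrements (P : Measure Ω) (V : ℝ × ℝ → Ω → ℝ) : Prop :=
  ∀ l : PlaneLine, (0, 0) ∈ l.toSet → DependentIncrementsDir P V l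

/-- Semi-dependent rectangular increments. -/
def SemiDependentIncrements (P : Measure Ω) (V : ℝ × ℝ → Ω → ℝ) : Prop :=
  ∃ l₁ l₂ : PlaneLine, (0, 0) ∈ l₁.toSet ∧ (0, 0) ∈ l₂.toSet ∧
    DependentIncrementsDir P V l₁ ∧
    (IndepIncrementsDir P V l₂ ∨ InvariantIncrementsDir P V l₂)

end Fields

/-! ### Type I distributional long-range dependence -/

/-- The field `Y` on `ℤ²` is stationary, for every `γ > 0` its normalized partial sums have a
scaling limit `V_γ` (with some exponent `H(γ) > 0`), which has stationary rectangular increments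
and vanishes on the axes, `V_{γ₀}` has dependent rectangular increments, and `V_γ`, `γ ≠ γ₀`, has
semi-dependent rectangular increments. -/
def HasTypeILRD {Ω : Type u} [MeasurableSpace Ω] (P : Measure Ω) [IsProbabilityMeasure P]
    (Y : ℤ × ℤ → Ω → ℝ) (γ₀ : ℝ) : Prop :=
  IsStationaryField P Y ∧ 0 < γ₀ ∧
  ∀ γ : ℝ, 0 < γ → ∃ H : ℝ, 0 < H ∧
    ∃ (Ω' : Type v) (_ : MeasurableSpace Ω') (P' : Measure Ω') (_ : IsProbabilityMeasure P')
      (V : ℝ × ℝ → Ω' → ℝ),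
      FddTendsto P P' openQuadrant (normalizedSum Y H γ) V ∧
      HasStationaryRectIncrements P' V ∧ VanishesOnAxes P' V ∧
      (γ = γ₀ → DependentIncrements P' V) ∧
      (γ ≠ γ₀ → SemiDependentIncrements P' V)

/-- Type I anisotropic distributional long-range dependence, with the given `γ₀ ≠ 1`. -/
def HasTypeIAnisotropicLRD {Ω : Type u} [MeasurableSpace Ω] (P : Measure Ω)
    [IsProbabilityMeasure P] (Y : ℤ × ℤ → Ω → ℝ) (γ₀ : ℝ) : Prop :=
  HasTypeILRD.{u, v} P Y γ₀ ∧ γ₀ ≠ 1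

/-! ### The aggregated 3N model -/

/-- The `k`-step transition probabilities `p_k(t,s) = P(W_k = (t,s) | W_0 = (0,0))` of the random
walk on `ℤ²` whose steps are `(1,0)`, `(0,1)`, `(0,-1)`, each with probability `1/3`. -/
def walkProb : ℕ → ℤ → ℤ → ℝ
  | 0, t, s => if t = 0 ∧ s = 0 then 1 else 0
  | k + 1, t, s => (walkProb k (t - 1) s + walkProb k t (s - 1) + walkProb k t (s + 1)) / 3

/-- The lattice Green function `g₃(t,s,a) = ∑ₖ aᵏ p_k(t,s)`, `0 ≤ a < 1`. -/
def green3 (t s : ℤ) (a : ℝ) : ℝ := ∑' k : ℕ, a ^ k * walkProb k t s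

/-- The mixing distribution `φ(a) da` on `[0,1)`. -/
def mixingMeasure (φ : ℝ → ℝ) : Measure ℝ :=
  (volume.restrict (Ico (0 : ℝ) 1)).withDensity (fun a => ENNReal.ofReal (φ a))

/-- The measure `∑_{(u,v) ∈ ℤ²} δ_{(u,v)} ⊗ φ(a) da` on `ℤ² × [0,1)`. A stable random measure `M`
with this control measure amounts to a family `M_{u,v}(B) = M({(u,v)} × B)`, `(u,v) ∈ ℤ²`, of
i.i.d. stable random measures on `[0,1)` with control measure `φ(a) da`. -/
def latticeControl (φ : ℝ → ℝ) : Measure ((ℤ × ℤ) × ℝ) :=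
  (Measure.count : Measure (ℤ × ℤ)).prod (mixingMeasure φ)

/-- The integrand `((u,v), a) ↦ g₃(t-u, s-v, a)`. -/
def aggregatedKernel (p : ℤ × ℤ) (e : (ℤ × ℤ) × ℝ) : ℝ :=
  green3 (p.1 - e.1.1) (p.2 - e.1.2) e.2

/-- The aggregated 3N field `𝔛₃(t,s) = ∑_{(u,v)} ∫_{[0,1)} g₃(t-u,s-v,a) M_{u,v}(da)`. -/
def aggregated3N {Ω : Type*} [MeasurableSpace Ω] (P : Measure Ω) (α : ℝ) (φ : ℝ → ℝ)
    (M : Set ((ℤ × ℤ) × ℝ) → Ω → ℝ) (p : ℤ × ℤ) : Ω → ℝ :=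
  stableIntegral α (latticeControl φ) P M (aggregatedKernel p)

/-! ### The limit fields -/

/-- The heat kernel `h₃(t,s,z) = 3 / (2 √(π t)) exp(-3 z t - s² / (4 t)) 1(t > 0, z > 0)`. -/
def h3 (t s z : ℝ) : ℝ :=
  if 0 < t ∧ 0 < z then
    3 / (2 * Real.sqrt (Real.pi * t)) * Real.exp (-3 * z * t - s ^ 2 / (4 * t))
  else 0

/-- The integrand `F_{3γ}(x,y;u,v,z)`, with `p = (x,y)` and `e = (u,v,z)`. -/
def limitKernel (α β γ : ℝ) (p : ℝ × ℝ) (e : ℝ × ℝ × ℝ) : ℝ :=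
  if γ = 1 / 2 then
    ∫ t in (0 : ℝ)..p.1, ∫ s in (0 : ℝ)..p.2, h3 (t - e.1) (s - e.2.1) e.2.2
  else if 1 / 2 < γ then
    (if 0 < e.2.1 ∧ e.2.1 < p.2 then 1 else 0) *
      ∫ t in (0 : ℝ)..p.1, ∫ w : ℝ, h3 (t - e.1) w e.2.2
  else if (α - 1) / 2 < β then
    (if 0 < e.1 ∧ e.1 < p.1 then 1 else 0) *
      ∫ s in (0 : ℝ)..p.2, ∫ w : ℝ, h3 w (e.2.1 - s) e.2.2
  else
    p.2 * ∫ t in (0 : ℝ)..p.1, h3 (t - e.1) e.2.1 e.2.2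

/-- The measure `φ₁ z^β du dv dz` on `ℝ² × (0,∞)`. -/
def limitControl (β φ₁ : ℝ) : Measure (ℝ × ℝ × ℝ) :=
  (volume.restrict {e : ℝ × ℝ × ℝ | 0 < e.2.2}).withDensity
    (fun e => ENNReal.ofReal (φ₁ * e.2.2 ^ β))

/-- The limit field `V_{3γ}(x,y) = ∫ F_{3γ}(x,y;u,v,z) 𝓜(du,dv,dz)`. -/
def limitField {Ω : Type*} [MeasurableSpace Ω] (P : Measure Ω) (α β φ₁ γ : ℝ)
    (𝓜 : Set (ℝ × ℝ × ℝ) → Ω → ℝ) (p : ℝ × ℝ) : Ω → ℝ :=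
  stableIntegral α (limitControl β φ₁) P 𝓜 (limitKernel α β γ p)

/-- The normalizing exponent `H(γ)`. -/
def scalingExponent (α β γ : ℝ) : ℝ :=
  if 1 / 2 ≤ γ then (γ + α - β) / α
  else if (α - 1) / 2 < β then (1 - γ + 2 * γ * (α - β)) / α
  else (α * γ + (α + 1) / 2 - β) / α

end StableLRD

end

open StableLRD

/-!
The theorem holds because the joint law of stable integrals `∫ f₁ dM, …, ∫ fₘ dM` is determined by
the energies `∫ |∑ᵢ θᵢ fᵢ|^α dμ`: its characteristic function at `θ` is the exponential of minus the
energy (`charFun_map_toLp`). Hence two families of integrals have the same law when their energies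
agree (`identDistrib_of_energy_eq`), and converge in distribution when their energies converge
(`tendstoInDistribution_of_tendsto_energy`). Stationarity, scaling and convergence of the fields are
therefore statements about integrals of deterministic kernels. Similarly, an integral determines its
integrand (`IsStableIntegral.ae_eq_integrand`), integrals with disjointly supported integrands are
independent, and integrals of two nonnegative integrands whose product is not a.e. zero are not
(`IsStableIntegral.not_indepFun`).

*The Green function.* The walk makes a step to the right with probability `1/3` and otherwise moves
along a vertical line, so `s ↦ g₃(t, s, a)` has the explicit Fourier transform
`greenFourier t x a = 3 a^t / (3 - 2 a cos x)^(t + 1)`. This gives the total mass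
`∑ₜ ∑ₛ g₃(t, s, a) = 1 / (1 - a)` (`tsum_tsum_green3`), bounds of `g₃`, and, in the variables
`t ≈ N w`, `s ≈ √N s'`, `a = 1 - z / N`, the local limit theorem `√N g₃ → h₃(w, s', z)`
(`tendsto_sqrt_mul_green3`).

*Convergence of the energies.* The energy of a linear combination of normalised partial sums is
rewritten, with step functions in place of sums, as an integral over `ℝ² × (0, ∞)`
(`ScalingRegime.energy_eq`) of `|∑ᵢ θᵢ Sᵢ|^α` against a density that tends to `φ₁ z^β`, where the
`Sᵢ` are rescaled partial sums of `g₃`. The integrand converges pointwise. No integrable majorant is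
at hand, but `S ≤ K min(z^{-p}, z^{-q})` with `(α - 1) p < β < (α - 1) q`, so that
`S^α ≤ (K min(z^{-p}, z^{-q}))^(α - 1) S`. The right-hand sides converge pointwise, and their
integrals converge because the total mass of `S` at a given `z` is a constant over `z`. Dominated
convergence with convergent majorants (`tendsto_lintegral_of_dominated_tendsto`) then applies.
The exponents `p, q ∈ {0, 1/2, 1}` come from three bounds of `S`: `1` from the total mass of the
Green function, `1/2` from its decay of order `t^{-1/2}` on the vertical line at `t`, and `0` from the
bounded number of vertical lines, in units of `N`, in the sum.

*The regimes.* The unit of time `N` in which the walk is observed is the horizontal scale `n`, except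
for `γ < 1/2`, `β > (α - 1)/2`, where it is the square `n^{2γ}` of the vertical scale. All limit
kernels are instances of one function `limitRect ρ ρ' ε`, with parameters in `{0, 1}`, and
`exists_scalingRegime` finds the parameters and the scales for each `γ`. The scaling property of the
limit is the uniqueness of the limits along the scales `n` and `k n` (`energy_limitKernel_scaling`).

*Rectangular increments.* The kernel of the increment over `I × J` is `limitRect` with these sets,
which is nonnegative. For `γ = 1/2` it is strictly positive at all points to the left of the
rectangle, so that increments are dependent in every direction (`dependentIncrements_half`). In the
other regimes the kernel is supported over `I` or over `J`, which gives independence along one axis, or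
depends on `J` only through its length, which gives invariance; in the direction of the other axis the
increments are dependent.
-/

noncomputable section

namespace StableLRD

/-! ### Energies -/

section StableIntegral

variable {E : Type*} [MeasurableSpace E] {Ω : Type*} [MeasurableSpace Ω]
  {α : ℝ} {μ : Measure E} {P : Measure Ω} {M : Set E → Ω → ℝ}

/-- The `α`-energy `∫ |f|^α dμ`, that is, the `α`-th power of the `L^α` norm. -/
def energy (α : ℝ) (μ : Measure E) (f : E → ℝ) : ℝ≥0∞ := ∫⁻ e, ‖f e‖ₑ ^ α ∂μ

lemma energy_eq_eLpNorm_rpow (hα : 0 < α) (f : E → ℝ) :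
    energy α μ f = eLpNorm f (ENNReal.ofReal α) μ ^ α := by
  have h := lintegral_rpow_enorm_eq_rpow_eLpNorm' (f := f) (μ := μ) hα
  rw [energy, h, eLpNorm_eq_eLpNorm' (by simpa using hα) ENNReal.ofReal_ne_top,
    ENNReal.toReal_ofReal hα.le]

lemma MemLp.energy_ne_top (hα : 0 < α) {f : E → ℝ} (hf : MemLp f (ENNReal.ofReal α) μ) :
    energy α μ f ≠ ∞ := by
  rw [energy_eq_eLpNorm_rpow hα]
  exact ENNReal.rpow_ne_top_of_nonneg hα.le hf.2.ne

lemma memLp_of_energy_ne_top (hα : 0 < α) {f : E → ℝ} (hf : AEStronglyMeasurable f μ)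
    (h : energy α μ f ≠ ∞) : MemLp f (ENNReal.ofReal α) μ := by
  refine ⟨hf, ?_⟩
  rw [eLpNorm_lt_top_iff_lintegral_rpow_enorm_lt_top (by simpa using hα) ENNReal.ofReal_ne_top,
    ENNReal.toReal_ofReal hα.le]
  exact h.lt_top

/-! ### Additivity of a stable random measure -/

lemma IsStableRandomMeasure.empty [IsProbabilityMeasure P] (hM : IsStableRandomMeasure α μ P M) :
    M ∅ =ᵐ[P] 0 := by
  have hs := hM.sigma_additive (fun _ => ∅) (fun _ => .empty) (fun _ _ _ => by simp) (by simp)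
  filter_upwards [hs] with ω hω
  simp only [Finset.sum_const, Finset.card_range, nsmul_eq_mul, iUnion_empty] at hω
  -- The sequence `n * M ∅` converges, so its increments `M ∅` tend to `0`.
  have h1 := hω.comp (tendsto_add_atTop_nat 1)
  have h2 := h1.sub hω
  simp only [Function.comp_def, sub_self] at h2
  have h3 : (fun n : ℕ => ((n + 1 : ℕ) : ℝ) * M ∅ ω - (n : ℝ) * M ∅ ω) = fun _ => M ∅ ω := by
    ext n; push_cast; ring
  rw [h3] at h2
  exact tendsto_nhds_unique tendsto_const_nhds h2

lemma IsStableRandomMeasure.union [IsProbabilityMeasure P] (hM : IsStableRandomMeasure α μ P M)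
    {A B : Set E} (hA : MeasurableSet A) (hB : MeasurableSet B) (hAB : Disjoint A B)
    (hμA : μ A < ∞) (hμB : μ B < ∞) :
    M (A ∪ B) =ᵐ[P] M A + M B := by
  let S : ℕ → Set E := fun n => if n = 0 then A else if n = 1 then B else ∅
  have hU : ⋃ i, S i = A ∪ B := by
    ext x
    simp only [mem_iUnion, mem_union, S]
    constructor
    · rintro ⟨i, hi⟩
      split_ifs at hi with h0 h1
      · exact Or.inl hi
      · exact Or.inr hi
      · exact absurd hi (notMem_empty x)
    · rintro (h | h)
      · exact ⟨0, by simpa using h⟩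
      · exact ⟨1, by simpa using h⟩
  have hs := hM.sigma_additive S
    (fun i => by simp only [S]; split_ifs <;> simp [hA, hB])
    (fun i j hij => by
      simp only [S]
      split_ifs <;> simp_all [hAB.symm])
    (by rw [hU]; exact (measure_union_le A B).trans_lt (ENNReal.add_lt_top.2 ⟨hμA, hμB⟩))
  filter_upwards [hs, hM.empty] with ω hω h0
  rw [hU] at hω
  have h1 : ∀ n, ∑ i ∈ Finset.range (n + 2), M (S i) ω = M A ω + M B ω := by
    intro n
    rw [Finset.sum_range_succ', Finset.sum_range_succ']
    have : ∀ i ∈ Finset.range n, M (S (i + 1 + 1)) ω = 0 := by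
      intro i _
      simpa [S] using h0
    rw [Finset.sum_eq_zero this]
    simp [S, add_comm]
  have h2 := hω.comp (tendsto_add_atTop_nat 2)
  simp only [Function.comp_def, h1] at h2
  exact tendsto_nhds_unique h2 tendsto_const_nhds

lemma IsStableRandomMeasure.biUnion_finset [IsProbabilityMeasure P]
    (hM : IsStableRandomMeasure α μ P M) {ι : Type*} (s : Finset ι) (A : ι → Set E)
    (hA : ∀ i ∈ s, MeasurableSet (A i)) (hμ : ∀ i ∈ s, μ (A i) < ∞)
    (hd : (s : Set ι).PairwiseDisjoint A) :
    M (⋃ i ∈ s, A i) =ᵐ[P] fun ω => ∑ i ∈ s, M (A i) ω := by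
  classical
  induction s using Finset.induction_on with
  | empty => simpa using! hM.empty
  | insert i s hi ih =>
    have h1 := ih (fun j hj => hA j (Finset.mem_insert_of_mem hj))
      (fun j hj => hμ j (Finset.mem_insert_of_mem hj))
      (hd.subset (by simp))
    have h2 := hM.union (hA i (Finset.mem_insert_self i s))
      (Finset.measurableSet_biUnion s fun j hj => hA j (Finset.mem_insert_of_mem hj))
      (by
        rw [Set.disjoint_iUnion₂_right]
        intro j hj
        exact hd (by simp) (by simp [hj]) (fun h => hi (h ▸ hj)))
      (hμ i (Finset.mem_insert_self i s))
      ((measure_biUnion_finset_le s A).trans_lt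
        (ENNReal.sum_lt_top.2 fun j hj => hμ j (Finset.mem_insert_of_mem hj)))
    rw [Finset.set_biUnion_insert]
    filter_upwards [h1, h2] with ω h1 h2
    rw [Finset.sum_insert hi, h2, Pi.add_apply, h1]

/-! ### The integral of simple functions -/

/-- The integral of `φ ∘ g` may be computed on the level sets of `g`, although `φ` need not be
injective. -/
lemma IsStableRandomMeasure.simpleIntegral_map [IsProbabilityMeasure P]
    (hM : IsStableRandomMeasure α μ P M) {γ : Type*} (g : SimpleFunc E γ) (φ : γ → ℝ)
    (hg : ∀ c, φ c ≠ 0 → μ (g ⁻¹' {c}) < ∞) :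
    simpleIntegral M (g.map φ) =ᵐ[P] fun ω => ∑ c ∈ g.range, φ c * M (g ⁻¹' {c}) ω := by
  classical
  have key : ∀ r ∈ (g.map φ).range, ∀ᵐ ω ∂P, r * M (g.map φ ⁻¹' {r}) ω =
      ∑ c ∈ g.range with φ c = r, φ c * M (g ⁻¹' {c}) ω := by
    intro r _
    by_cases hr : r = 0
    · refine Eventually.of_forall fun ω => ?_
      rw [hr, zero_mul, Finset.sum_eq_zero]
      intro c hc
      rw [(Finset.mem_filter.1 hc).2, zero_mul]
    · have hU : (g.map φ) ⁻¹' {r} = ⋃ c ∈ g.range.filter (fun c => φ c = r), g ⁻¹' {c} := by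
        rw [SimpleFunc.map_preimage_singleton]
        ext x; simp
      rw [hU]
      have := hM.biUnion_finset (g.range.filter (fun c => φ c = r)) (fun c => g ⁻¹' {c})
        (fun c _ => g.measurableSet_preimage {c})
        (fun c hc => hg c (by rw [(Finset.mem_filter.1 hc).2]; exact hr))
        (fun a _ b _ hab => Disjoint.preimage g (by simpa using hab))
      filter_upwards [this] with ω hω
      rw [hω, Finset.mul_sum]
      exact Finset.sum_congr rfl fun c hc => by rw [(Finset.mem_filter.1 hc).2]
  have := (ae_ball_iff (Finset.countable_toSet _)).2 key
  filter_upwards [this] with ω hω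
  unfold simpleIntegral
  rw [Finset.sum_congr rfl fun r hr => hω r hr]
  refine Finset.sum_fiberwise_of_maps_to (fun c hc => ?_) _
  rw [SimpleFunc.range_map]
  exact Finset.mem_image_of_mem φ hc

variable {f g : SimpleFunc E ℝ}

lemma measure_preimage_lt_top (hα : 0 < α) (hf : MemLp f (ENNReal.ofReal α) μ) {c : ℝ}
    (hc : c ≠ 0) : μ (f ⁻¹' {c}) < ∞ :=
  SimpleFunc.measure_preimage_lt_top_of_memLp (by simpa using hα) ENNReal.ofReal_ne_top f hf c hc

lemma IsStableRandomMeasure.measurable_simpleIntegral (hM : IsStableRandomMeasure α μ P M)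
    (hα : 0 < α) (hf : MemLp f (ENNReal.ofReal α) μ) : Measurable (simpleIntegral M f) := by
  unfold simpleIntegral
  refine Finset.measurable_sum _ fun c _ => ?_
  by_cases hc : c = 0
  · simp [hc]
  · exact (hM.measurable _ (f.measurableSet_preimage _)
      (measure_preimage_lt_top hα hf hc)).const_mul c

lemma IsStableRandomMeasure.simpleIntegral_add [IsProbabilityMeasure P]
    (hM : IsStableRandomMeasure α μ P M) (hα : 0 < α) (hf : MemLp f (ENNReal.ofReal α) μ)
    (hg : MemLp g (ENNReal.ofReal α) μ) :
    simpleIntegral M (f + g) =ᵐ[P] simpleIntegral M f + simpleIntegral M g := by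
  have hpair : ∀ c : ℝ × ℝ, c.1 ≠ 0 ∨ c.2 ≠ 0 → μ (f.pair g ⁻¹' {c}) < ∞ := by
    rintro ⟨a, b⟩ h
    rw [SimpleFunc.pair_preimage_singleton]
    rcases h with h | h
    · exact (measure_mono inter_subset_left).trans_lt (measure_preimage_lt_top hα hf h)
    · exact (measure_mono inter_subset_right).trans_lt (measure_preimage_lt_top hα hg h)
  have h1 := hM.simpleIntegral_map (f.pair g) (fun c => c.1 + c.2) (fun c hc => hpair c (by
    by_contra! h; exact hc (by simp [h.1, h.2])))
  have h2 := hM.simpleIntegral_map (f.pair g) Prod.fst (fun c hc => hpair c (Or.inl hc))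
  have h3 := hM.simpleIntegral_map (f.pair g) Prod.snd (fun c hc => hpair c (Or.inr hc))
  have e1 : (f.pair g).map (fun c => c.1 + c.2) = f + g := by ext; simp
  have e2 : (f.pair g).map Prod.fst = f := by ext; simp
  have e3 : (f.pair g).map Prod.snd = g := by ext; simp
  rw [e1] at h1; rw [e2] at h2; rw [e3] at h3
  filter_upwards [h1, h2, h3] with ω h1 h2 h3
  rw [Pi.add_apply, h1, h2, h3, ← Finset.sum_add_distrib]
  exact Finset.sum_congr rfl fun c _ => by ring

lemma IsStableRandomMeasure.simpleIntegral_const_mul [IsProbabilityMeasure P]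
    (hM : IsStableRandomMeasure α μ P M) (hα : 0 < α) (hf : MemLp f (ENNReal.ofReal α) μ)
    (a : ℝ) :
    simpleIntegral M (f.map (a * ·)) =ᵐ[P] fun ω => a * simpleIntegral M f ω := by
  have h1 := hM.simpleIntegral_map f (a * ·) (fun c hc => measure_preimage_lt_top hα hf
    (by rintro rfl; simp at hc))
  filter_upwards [h1] with ω h1
  rw [h1, simpleIntegral, Finset.mul_sum]
  exact Finset.sum_congr rfl fun c _ => by ring

lemma SimpleFunc.energy_eq_sum (hα : 0 < α) (f : SimpleFunc E ℝ) :
    energy α μ f = ∑ c ∈ f.range with c ≠ 0, ENNReal.ofReal (|c| ^ α) * μ (f ⁻¹' {c}) := by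
  have h1 : energy α μ f = (f.map fun c => ENNReal.ofReal (|c| ^ α)).lintegral μ := by
    rw [← SimpleFunc.lintegral_eq_lintegral]
    refine lintegral_congr fun e => ?_
    rw [SimpleFunc.map_apply, Real.enorm_eq_ofReal_abs,
      ENNReal.ofReal_rpow_of_nonneg (abs_nonneg _) hα.le]
  rw [h1, SimpleFunc.map_lintegral, Finset.sum_filter]
  refine Finset.sum_congr rfl fun c _ => ?_
  by_cases hc : c = 0
  · simp [hc, Real.zero_rpow hα.ne']
  · simp [hc]

lemma IsStableRandomMeasure.charFun_simpleIntegral [IsProbabilityMeasure P]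
    (hM : IsStableRandomMeasure α μ P M) (hα : 0 < α) (hf : MemLp f (ENNReal.ofReal α) μ)
    (θ : ℝ) :
    charFun (P.map (simpleIntegral M f)) θ =
      ((Real.exp (-(|θ| ^ α * (energy α μ f).toReal)) : ℝ) : ℂ) := by
  classical
  set s := f.range.filter (fun c => c ≠ 0) with hs
  have hfin : ∀ c ∈ s, μ (f ⁻¹' {c}) < ∞ := fun c hc =>
    measure_preimage_lt_top hα hf (Finset.mem_filter.1 hc).2
  have hms : ∀ c ∈ s, Measurable (M (f ⁻¹' {c})) := fun c hc =>
    hM.measurable _ (f.measurableSet_preimage _) (hfin c hc)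
  -- the values on the level sets `{f = c}`, `c ≠ 0`, are independent
  have hind : iIndepFun (fun c : s => fun ω => (c : ℝ) * M (f ⁻¹' {(c : ℝ)}) ω) P := by
    let e := s.equivFin
    have h := hM.indep s.card (fun i => f ⁻¹' {((e.symm i : s) : ℝ)})
      (fun i => f.measurableSet_preimage _) (fun i => hfin _ (e.symm i).2)
      (fun i j hij => Disjoint.preimage f (by
        simpa [Subtype.ext_iff] using fun h => hij (e.symm.injective (Subtype.ext h))))
    have h2 := h.precomp (g := e) e.injective
    simp only [Equiv.symm_apply_apply] at h2
    exact h2.comp (fun c x => (c : ℝ) * x) (fun c => measurable_const_mul _)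
  have hsum : simpleIntegral M f = fun ω => ∑ c : s, (c : ℝ) * M (f ⁻¹' {(c : ℝ)}) ω := by
    ext ω
    rw [Finset.sum_coe_sort s (fun c => c * M (f ⁻¹' {c}) ω), hs, Finset.sum_filter]
    exact Finset.sum_congr rfl fun c _ => by by_cases h : c = 0 <;> simp [h]
  have hmeas : ∀ c : s, AEMeasurable (fun ω => (c : ℝ) * M (f ⁻¹' {(c : ℝ)}) ω) P := fun c =>
    ((hms c c.2).const_mul _).aemeasurable
  rw [hsum, hind.charFun_map_fun_sum_eq_prod hmeas, Finset.prod_apply]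
  have h1 : ∀ c : s, charFun (P.map fun ω => (c : ℝ) * M (f ⁻¹' {(c : ℝ)}) ω) θ =
      ((Real.exp (-(|θ| ^ α * (|(c : ℝ)| ^ α * (μ (f ⁻¹' {(c : ℝ)})).toReal))) : ℝ) : ℂ) := by
    intro c
    have h2 := hM.charFun_eq _ (f.measurableSet_preimage {(c : ℝ)}) (hfin c c.2) (c * θ)
    rw [abs_mul, Real.mul_rpow (abs_nonneg _) (abs_nonneg _)] at h2
    have h3 := charFun_map_mul (μ := P.map (M (f ⁻¹' {(c : ℝ)}))) (c : ℝ) θ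
    rw [Measure.map_map (measurable_const_mul _) (hms c c.2), h2] at h3
    simp only [Function.comp_def] at h3
    rw [h3]
    congr 3
    ring
  rw [Finset.prod_congr rfl fun c _ => h1 c,
    Finset.prod_coe_sort s (fun c => ((Real.exp (-(|θ| ^ α * (|c| ^ α *
      (μ (f ⁻¹' {c})).toReal))) : ℝ) : ℂ)), ← Complex.ofReal_prod, ← Real.exp_sum,
      Finset.sum_neg_distrib, ← Finset.mul_sum, SimpleFunc.energy_eq_sum hα,
      ENNReal.toReal_sum]
  · simp only [ENNReal.toReal_mul, ENNReal.toReal_ofReal (Real.rpow_nonneg (abs_nonneg _) _)]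
    rfl
  · intro c hc
    exact ENNReal.mul_ne_top ENNReal.ofReal_ne_top (hfin c hc).ne

end StableIntegral

section StableIntegral

variable {E : Type*} [MeasurableSpace E] {Ω : Type*} [MeasurableSpace Ω]
  {α : ℝ} {μ : Measure E} {P : Measure Ω} {M : Set E → Ω → ℝ}

/-! ### Existence and linearity of the stochastic integral -/

lemma tendstoInMeasure_add {X Y : ℕ → Ω → ℝ} {X₀ Y₀ : Ω → ℝ}
    (hX : TendstoInMeasure P X atTop X₀) (hY : TendstoInMeasure P Y atTop Y₀) :
    TendstoInMeasure P (fun n => X n + Y n) atTop (X₀ + Y₀) := by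
  rw [tendstoInMeasure_iff_norm] at *
  intro ε hε
  have h := (hX (ε / 2) (half_pos hε)).add (hY (ε / 2) (half_pos hε))
  rw [add_zero] at h
  refine tendsto_of_tendsto_of_tendsto_of_le_of_le tendsto_const_nhds h (fun _ => zero_le) ?_
  intro n
  refine (measure_mono ?_).trans (measure_union_le _ _)
  intro ω hω
  by_contra hcon
  simp only [mem_union, mem_ofPred_eq, not_or, not_le, Pi.add_apply] at hcon hω
  have : ‖X n ω + Y n ω - (X₀ ω + Y₀ ω)‖ ≤ ‖X n ω - X₀ ω‖ + ‖Y n ω - Y₀ ω‖ := by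
    rw [add_sub_add_comm]; exact norm_add_le _ _
  linarith [hcon.1, hcon.2]

lemma tendstoInMeasure_const_mul {X : ℕ → Ω → ℝ} {X₀ : Ω → ℝ} (c : ℝ)
    (hX : TendstoInMeasure P X atTop X₀) :
    TendstoInMeasure P (fun n ω => c * X n ω) atTop (fun ω => c * X₀ ω) := by
  rw [tendstoInMeasure_iff_norm] at *
  intro ε hε
  have hc : 0 < |c| + 1 := by positivity
  refine tendsto_of_tendsto_of_tendsto_of_le_of_le tendsto_const_nhds
    (hX (ε / (|c| + 1)) (div_pos hε hc)) (fun _ => zero_le) fun n => measure_mono fun ω hω => ?_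
  simp only [mem_ofPred_eq] at hω ⊢
  rw [← mul_sub, norm_mul, Real.norm_eq_abs c] at hω
  rw [div_le_iff₀ hc]
  nlinarith [norm_nonneg (X n ω - X₀ ω)]

lemma one_le_ofReal (hα : 1 ≤ α) : 1 ≤ ENNReal.ofReal α := by
  simpa using ENNReal.ofReal_le_ofReal hα

lemma tendsto_energy_of_tendsto_eLpNorm (hα : 1 ≤ α) {f : E → ℝ} {g : ℕ → E → ℝ}
    (hf : MemLp f (ENNReal.ofReal α) μ) (hg : ∀ n, MemLp (g n) (ENNReal.ofReal α) μ)
    (h : Tendsto (fun n => eLpNorm (fun e => f e - g n e) (ENNReal.ofReal α) μ) atTop (𝓝 0)) :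
    Tendsto (fun n => energy α μ (g n)) atTop (𝓝 (energy α μ f)) := by
  have hα0 : 0 < α := by linarith
  simp only [energy_eq_eLpNorm_rpow hα0]
  refine Tendsto.ennrpow_const α ?_
  have h1 := one_le_ofReal hα
  have hlow : Tendsto (fun n => eLpNorm f (ENNReal.ofReal α) μ -
      eLpNorm (fun e => f e - g n e) (ENNReal.ofReal α) μ) atTop
      (𝓝 (eLpNorm f (ENNReal.ofReal α) μ)) := by
    simpa using ENNReal.Tendsto.sub tendsto_const_nhds h (Or.inl hf.2.ne)
  have hup : Tendsto (fun n => eLpNorm f (ENNReal.ofReal α) μ +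
      eLpNorm (fun e => f e - g n e) (ENNReal.ofReal α) μ) atTop
      (𝓝 (eLpNorm f (ENNReal.ofReal α) μ)) := by
    simpa using tendsto_const_nhds.add h
  refine tendsto_of_tendsto_of_tendsto_of_le_of_le hlow hup (fun n => ?_) (fun n => ?_)
  · rw [tsub_le_iff_right]
    have := eLpNorm_add_le (hg n).1 (hf.sub (hg n)).1 h1
    simpa using! this
  · have := eLpNorm_sub_le hf.1 (hf.sub (hg n)).1 h1
    simpa using! this

lemma IsStableIntegral.congr_ae {f g : E → ℝ} {I : Ω → ℝ}
    (hI : IsStableIntegral α μ P M f I) (hfg : f =ᵐ[μ] g) : IsStableIntegral α μ P M g I := by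
  obtain ⟨hf, hIm, s, hs, hsf, hsI⟩ := hI
  refine ⟨(memLp_congr_ae hfg).1 hf, hIm, s, hs, ?_, hsI⟩
  refine hsf.congr fun n => eLpNorm_congr_ae ?_
  filter_upwards [hfg] with e he
  rw [he]

variable [IsProbabilityMeasure P]

lemma IsStableIntegral.charFun (hM : IsStableRandomMeasure α μ P M) (hα : 1 ≤ α) {f : E → ℝ}
    {I : Ω → ℝ} (h : IsStableIntegral α μ P M f I) (θ : ℝ) :
    charFun (P.map I) θ = ((Real.exp (-(|θ| ^ α * (energy α μ f).toReal)) : ℝ) : ℂ) := by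
  have hα0 : 0 < α := by linarith
  obtain ⟨hf, hI, s, hs, hsf, hsI⟩ := h
  have hsm := fun n => hM.measurable_simpleIntegral hα0 (hs n)
  have h1 := (TendstoInMeasure.tendstoInDistribution_of_aemeasurable hsI
    (fun n => (hsm n).aemeasurable) hI.aemeasurable).tendsto
  have h2 := (ProbabilityMeasure.tendsto_iff_tendsto_charFun.1 h1) θ
  simp only [ProbabilityMeasure.coe_mk, hM.charFun_simpleIntegral hα0 (hs _)] at h2
  refine tendsto_nhds_unique h2 ?_
  have h3 := tendsto_energy_of_tendsto_eLpNorm hα hf hs hsf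
  have h4 := (ENNReal.tendsto_toReal (MemLp.energy_ne_top hα0 hf)).comp h3
  exact (Complex.continuous_ofReal.tendsto _).comp
    ((Real.continuous_exp.tendsto _).comp ((h4.const_mul (|θ| ^ α)).neg))

lemma IsStableIntegral.add (hM : IsStableRandomMeasure α μ P M) (hα : 1 ≤ α) {f g : E → ℝ}
    {I J : Ω → ℝ} (hI : IsStableIntegral α μ P M f I) (hJ : IsStableIntegral α μ P M g J) :
    IsStableIntegral α μ P M (fun e => f e + g e) (fun ω => I ω + J ω) := by
  have hα0 : 0 < α := by linarith
  obtain ⟨hf, hIm, s, hs, hsf, hsI⟩ := hI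
  obtain ⟨hg, hJm, t, ht, htg, htJ⟩ := hJ
  refine ⟨hf.add hg, hIm.add hJm, fun n => s n + t n, fun n => (hs n).add (ht n), ?_, ?_⟩
  · have h := hsf.add htg
    rw [add_zero] at h
    refine tendsto_of_tendsto_of_tendsto_of_le_of_le tendsto_const_nhds h (fun _ => zero_le) ?_
    intro n
    refine le_trans (le_of_eq ?_)
      (eLpNorm_add_le (hf.sub (hs n)).1 (hg.sub (ht n)).1 (one_le_ofReal hα))
    refine eLpNorm_congr_ae (Eventually.of_forall fun e => ?_)
    simp only [SimpleFunc.coe_add, Pi.add_apply]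
    ring
  · exact (tendstoInMeasure_add hsI htJ).congr_left fun n =>
      (hM.simpleIntegral_add hα0 (hs n) (ht n)).symm

lemma IsStableIntegral.const_mul (hM : IsStableRandomMeasure α μ P M) (hα : 1 ≤ α) {f : E → ℝ}
    {I : Ω → ℝ} (hI : IsStableIntegral α μ P M f I) (c : ℝ) :
    IsStableIntegral α μ P M (fun e => c * f e) (fun ω => c * I ω) := by
  have hα0 : 0 < α := by linarith
  obtain ⟨hf, hIm, s, hs, hsf, hsI⟩ := hI
  refine ⟨hf.const_mul c, hIm.const_mul c, fun n => (s n).map (c * ·),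
    fun n => (hs n).const_mul c, ?_, ?_⟩
  · have h : ∀ n, eLpNorm (fun e => c * f e - (s n).map (c * ·) e) (ENNReal.ofReal α) μ =
        ‖c‖ₑ * eLpNorm (fun e => f e - s n e) (ENNReal.ofReal α) μ := by
      intro n
      rw [← eLpNorm_const_smul]
      refine eLpNorm_congr_ae (Eventually.of_forall fun e => ?_)
      simp [mul_sub]
    simp only [h]
    simpa using ENNReal.Tendsto.const_mul hsf (Or.inr enorm_ne_top)
  · exact (tendstoInMeasure_const_mul c hsI).congr_left fun n =>
      (hM.simpleIntegral_const_mul hα0 (hs n) c).symm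

lemma isStableIntegral_zero :
    IsStableIntegral α μ P M (fun _ => 0) (fun _ => 0) := by
  refine ⟨MemLp.zero, measurable_const, fun _ => 0, fun _ => MemLp.zero, by simp, ?_⟩
  have h : simpleIntegral M (0 : SimpleFunc E ℝ) = fun _ => 0 := by
    ext ω
    refine Finset.sum_eq_zero fun c hc => ?_
    obtain ⟨e, rfl⟩ := SimpleFunc.mem_range.1 hc
    simp
  simp only [h]
  exact tendstoInMeasure_of_tendsto_ae (fun _ => aestronglyMeasurable_const)
    (Eventually.of_forall fun _ => tendsto_const_nhds)

lemma IsStableIntegral.sum (hM : IsStableRandomMeasure α μ P M) (hα : 1 ≤ α) {ι : Type*}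
    (s : Finset ι) {f : ι → E → ℝ} {I : ι → Ω → ℝ}
    (h : ∀ i ∈ s, IsStableIntegral α μ P M (f i) (I i)) :
    IsStableIntegral α μ P M (fun e => ∑ i ∈ s, f i e) (fun ω => ∑ i ∈ s, I i ω) := by
  classical
  induction s using Finset.induction_on with
  | empty => simpa using isStableIntegral_zero
  | insert i s hi ih =>
    simp only [Finset.sum_insert hi]
    exact (h i (Finset.mem_insert_self i s)).add hM hα
      (ih fun j hj => h j (Finset.mem_insert_of_mem hj))

lemma IsStableIntegral.sub (hM : IsStableRandomMeasure α μ P M) (hα : 1 ≤ α) {f g : E → ℝ}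
    {I J : Ω → ℝ} (hI : IsStableIntegral α μ P M f I) (hJ : IsStableIntegral α μ P M g J) :
    IsStableIntegral α μ P M (fun e => f e - g e) (fun ω => I ω - J ω) := by
  have := hI.add hM hα (hJ.const_mul hM hα (-1))
  simpa only [neg_mul, one_mul, ← sub_eq_add_neg] using this

/-- The law of the integral of a simple function with small energy is concentrated near `0`. -/
lemma IsStableRandomMeasure.measureReal_simpleIntegral_gt_le (hM : IsStableRandomMeasure α μ P M)
    (hα : 0 < α) {f : SimpleFunc E ℝ} (hf : MemLp f (ENNReal.ofReal α) μ) {r : ℝ} (hr : 0 < r) :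
    P.real {ω | r < |simpleIntegral M f ω|} ≤ 2 * ((2 / r) ^ α * (energy α μ f).toReal) := by
  have hm := hM.measurable_simpleIntegral hα hf
  have : IsProbabilityMeasure (P.map (simpleIntegral M f)) :=
    Measure.isProbabilityMeasure_map hm.aemeasurable
  have h1 := measureReal_abs_gt_le_integral_charFun (μ := P.map (simpleIntegral M f)) hr
  rw [map_measureReal_apply hm (measurableSet_lt measurable_const (f := fun _ => r) (g := fun x : ℝ => |x|) (by fun_prop))] at h1
  refine h1.trans ?_
  have h2 : ‖∫ t in (-2 * r⁻¹)..(2 * r⁻¹), 1 - MeasureTheory.charFun (P.map (simpleIntegral M f)) t‖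
      ≤ ((2 / r) ^ α * (energy α μ f).toReal) * |2 * r⁻¹ - -2 * r⁻¹| := by
    refine intervalIntegral.norm_integral_le_of_norm_le_const fun t ht => ?_
    rw [hM.charFun_simpleIntegral hα hf, ← Complex.ofReal_one, ← Complex.ofReal_sub,
      Complex.norm_real, Real.norm_eq_abs]
    have h0 : 0 ≤ |t| ^ α * (energy α μ f).toReal :=
      mul_nonneg (Real.rpow_nonneg (abs_nonneg _) _) ENNReal.toReal_nonneg
    rw [abs_of_nonneg (by
      rw [sub_nonneg]; exact Real.exp_le_one_iff.2 (by linarith))]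
    have h3 : |t| ≤ 2 / r := by
      rw [uIoc_of_le (by
        have : 0 < r⁻¹ := inv_pos.2 hr
        linarith)] at ht
      rw [abs_le, div_eq_mul_inv]
      constructor <;> linarith [ht.1, ht.2]
    calc 1 - Real.exp (-(|t| ^ α * (energy α μ f).toReal))
        ≤ |t| ^ α * (energy α μ f).toReal := by
          linarith [Real.add_one_le_exp (-(|t| ^ α * (energy α μ f).toReal))]
      _ ≤ (2 / r) ^ α * (energy α μ f).toReal := by
          gcongr
  calc 2⁻¹ * r * _ ≤ 2⁻¹ * r * (((2 / r) ^ α * (energy α μ f).toReal) *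
        |2 * r⁻¹ - -2 * r⁻¹|) := by gcongr
    _ = 2 * ((2 / r) ^ α * (energy α μ f).toReal) := by
        rw [abs_of_nonneg (by have : 0 < r⁻¹ := inv_pos.2 hr; linarith)]
        field_simp
        ring

/-- Rapidly converging simple approximations have integrals that converge almost surely, by the
Borel–Cantelli lemma. -/
lemma exists_isStableIntegral (hM : IsStableRandomMeasure α μ P M) (hα : 1 ≤ α) {f : E → ℝ}
    (hf : MemLp f (ENNReal.ofReal α) μ) : ∃ I, IsStableIntegral α μ P M f I := by
  have hα0 : 0 < α := by linarith
  have h1 := one_le_ofReal hα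
  have hε : ∀ n : ℕ, ENNReal.ofReal ((8 : ℝ)⁻¹ ^ n / 4) ≠ 0 := fun n => by
    rw [Ne, ENNReal.ofReal_eq_zero, not_le]; positivity
  choose s hs hsm using fun n => hf.exists_simpleFunc_eLpNorm_sub_lt ENNReal.ofReal_ne_top (hε n)
  let d : ℕ → SimpleFunc E ℝ := fun n => s (n + 1) + (s n).map ((-1 : ℝ) * ·)
  have hneg : ∀ n, MemLp ((s n).map ((-1 : ℝ) * ·)) (ENNReal.ofReal α) μ :=
    fun n => (hsm n).const_mul (-1)
  have hd : ∀ n, MemLp (d n) (ENNReal.ofReal α) μ := fun n => (hsm (n + 1)).add (hneg n)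
  have hdn : ∀ n, eLpNorm (d n) (ENNReal.ofReal α) μ ≤ ENNReal.ofReal ((8 : ℝ)⁻¹ ^ n / 2) := by
    intro n
    have e : (d n : E → ℝ) = (f - s n) - (f - s (n + 1)) := by
      ext e; simp [d]; ring
    rw [e]
    refine (eLpNorm_sub_le (hf.sub (hsm n)).1 (hf.sub (hsm (n + 1))).1 h1).trans ?_
    refine (add_le_add (hs n).le (hs (n + 1)).le).trans ?_
    rw [← ENNReal.ofReal_add (by positivity) (by positivity)]
    refine ENNReal.ofReal_le_ofReal ?_
    rw [pow_succ]
    nlinarith [pow_pos (show (0 : ℝ) < 8⁻¹ by norm_num) n]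
  have hP : ∀ n, P.real {ω | (2 : ℝ)⁻¹ ^ n < |simpleIntegral M (d n) ω|} ≤ 2 * (4 : ℝ)⁻¹ ^ n := by
    intro n
    refine (hM.measureReal_simpleIntegral_gt_le hα0 (hd n) (by positivity)).trans ?_
    have he : (energy α μ (d n)).toReal ≤ ((8 : ℝ)⁻¹ ^ n / 2) ^ α := by
      rw [energy_eq_eLpNorm_rpow hα0, ← ENNReal.toReal_rpow]
      refine Real.rpow_le_rpow ENNReal.toReal_nonneg ?_ hα0.le
      exact ENNReal.toReal_le_of_le_ofReal (by positivity) (hdn n)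
    have h2 : (2 / (2 : ℝ)⁻¹ ^ n) ^ α * ((8 : ℝ)⁻¹ ^ n / 2) ^ α = ((4 : ℝ)⁻¹ ^ n) ^ α := by
      rw [← Real.mul_rpow (by positivity) (by positivity)]
      congr 1
      rw [div_mul_div_comm, mul_comm, mul_div_mul_right _ _ two_ne_zero, ← div_pow]
      norm_num
    calc 2 * ((2 / (2 : ℝ)⁻¹ ^ n) ^ α * (energy α μ (d n)).toReal)
        ≤ 2 * ((2 / (2 : ℝ)⁻¹ ^ n) ^ α * ((8 : ℝ)⁻¹ ^ n / 2) ^ α) := by gcongr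
      _ = 2 * ((4 : ℝ)⁻¹ ^ n) ^ α := by rw [h2]
      _ ≤ 2 * ((4 : ℝ)⁻¹ ^ n) ^ (1 : ℝ) := by
          gcongr 2 * ?_
          exact Real.rpow_le_rpow_of_exponent_ge (by positivity)
            (pow_le_one₀ (by norm_num) (by norm_num)) hα
      _ = 2 * (4 : ℝ)⁻¹ ^ n := by rw [Real.rpow_one]
  have hsum : ∑' n, P {ω | (2 : ℝ)⁻¹ ^ n < |simpleIntegral M (d n) ω|} ≠ ∞ := by
    have hle : ∀ n, P {ω | (2 : ℝ)⁻¹ ^ n < |simpleIntegral M (d n) ω|} ≤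
        ENNReal.ofReal (2 * (4 : ℝ)⁻¹ ^ n) := fun n => by
      rw [← ofReal_measureReal (measure_ne_top _ _)]
      exact ENNReal.ofReal_le_ofReal (hP n)
    refine ne_top_of_le_ne_top ?_ (ENNReal.tsum_le_tsum hle)
    have hsm : Summable fun n : ℕ => 2 * (4 : ℝ)⁻¹ ^ n :=
      (summable_geometric_of_lt_one (by norm_num) (by norm_num)).mul_left 2
    rw [← ENNReal.ofReal_tsum_of_nonneg (fun n => by positivity) hsm]
    exact ENNReal.ofReal_ne_top
  have hae := ae_eventually_notMem hsum
  have hdiff : ∀ᵐ ω ∂P, ∀ n, simpleIntegral M (d n) ω =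
      simpleIntegral M (s (n + 1)) ω - simpleIntegral M (s n) ω := by
    rw [ae_all_iff]
    intro n
    filter_upwards [hM.simpleIntegral_add hα0 (hsm (n + 1)) (hneg n),
      hM.simpleIntegral_const_mul hα0 (hsm n) (-1)] with ω h2 h3
    rw [h2, Pi.add_apply, h3]; ring
  have hconv : ∀ᵐ ω ∂P, ∃ l, Tendsto (fun n => simpleIntegral M (s n) ω) atTop (𝓝 l) := by
    filter_upwards [hae, hdiff] with ω hω hd
    refine cauchySeq_tendsto_of_complete (cauchySeq_of_summable_dist ?_)
    refine Summable.of_norm_bounded_eventually_nat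
      (summable_geometric_of_lt_one (r := (2 : ℝ)⁻¹) (by norm_num) (by norm_num)) ?_
    filter_upwards [hω] with n hn
    rw [not_lt, hd n] at hn
    rw [Real.norm_eq_abs, abs_dist, dist_comm, Real.dist_eq]
    exact hn
  obtain ⟨I, hI, hlim⟩ := measurable_limit_of_tendsto_metrizable_ae
    (fun n => (hM.measurable_simpleIntegral hα0 (hsm n)).aemeasurable) hconv
  refine ⟨I, hf, hI, s, hsm, ?_, tendstoInMeasure_of_tendsto_ae
    (fun n => (hM.measurable_simpleIntegral hα0 (hsm n)).aestronglyMeasurable) hlim⟩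
  have hlim0 : Tendsto (fun n : ℕ => ENNReal.ofReal ((8 : ℝ)⁻¹ ^ n / 4)) atTop (𝓝 0) := by
    have := (tendsto_pow_atTop_nhds_zero_of_lt_one (r := (8 : ℝ)⁻¹) (by norm_num)
      (by norm_num)).div_const 4
    rw [zero_div] at this
    simpa using ENNReal.tendsto_ofReal this
  exact tendsto_of_tendsto_of_tendsto_of_le_of_le tendsto_const_nhds hlim0 (fun _ => zero_le)
    (fun n => (hs n).le)

lemma isStableIntegral_stableIntegral (hM : IsStableRandomMeasure α μ P M) (hα : 1 ≤ α)
    {f : E → ℝ} (hf : MemLp f (ENNReal.ofReal α) μ) :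
    IsStableIntegral α μ P M f (stableIntegral α μ P M f) := by
  have h := exists_isStableIntegral hM hα hf
  rw [stableIntegral, dif_pos h]
  exact h.choose_spec

end StableIntegral

/-! ### Joint laws of stochastic integrals -/

section Laws

variable {E : Type*} [MeasurableSpace E] {Ω : Type*} [MeasurableSpace Ω]
  {α : ℝ} {μ : Measure E} {P : Measure Ω} [IsProbabilityMeasure P] {M : Set E → Ω → ℝ}

lemma IsStableIntegral.linearCombination (hM : IsStableRandomMeasure α μ P M) (hα : 1 ≤ α)
    {ι : Type*} [Fintype ι] {f : ι → E → ℝ} {I : ι → Ω → ℝ}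
    (h : ∀ i, IsStableIntegral α μ P M (f i) (I i)) (θ : ι → ℝ) :
    IsStableIntegral α μ P M (fun e => ∑ i, θ i * f i e) (fun ω => ∑ i, θ i * I i ω) :=
  IsStableIntegral.sum hM hα _ fun i _ => (h i).const_mul hM hα (θ i)

/-- The joint characteristic function of finitely many stochastic integrals. -/
lemma charFun_map_toLp (hM : IsStableRandomMeasure α μ P M) (hα : 1 ≤ α)
    {ι : Type*} [Fintype ι] {f : ι → E → ℝ} {I : ι → Ω → ℝ}
    (h : ∀ i, IsStableIntegral α μ P M (f i) (I i)) (θ : EuclideanSpace ℝ ι) :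
    charFun (P.map fun ω => WithLp.toLp 2 fun i => I i ω) θ =
      ((Real.exp (-(energy α μ fun e => ∑ i, θ i * f i e).toReal) : ℝ) : ℂ) := by
  have h1 := (IsStableIntegral.linearCombination hM hα h θ).charFun hM hα 1
  rw [abs_one, Real.one_rpow, one_mul] at h1
  rw [← h1, charFun_apply, charFun_apply_real]
  have hm : Measurable fun ω => WithLp.toLp 2 fun i => I i ω :=
    (WithLp.measurable_toLp 2 _).comp (measurable_pi_lambda _ fun i => (h i).2.1)
  have hm2 : Measurable fun ω => ∑ i, θ i * I i ω :=
    Finset.measurable_sum _ fun i _ => (h i).2.1.const_mul _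
  rw [integral_map hm.aemeasurable (by fun_prop), integral_map hm2.aemeasurable (by fun_prop)]
  congr 1
  ext ω
  rw [Complex.ofReal_one, one_mul, PiLp.inner_apply]
  simp

variable {E' : Type*} [MeasurableSpace E'] {Ω' : Type*} [MeasurableSpace Ω']
  {μ' : Measure E'} {P' : Measure Ω'} [IsProbabilityMeasure P'] {M' : Set E' → Ω' → ℝ}

lemma identDistrib_of_energy_eq (hM : IsStableRandomMeasure α μ P M)
    (hM' : IsStableRandomMeasure α μ' P' M') (hα : 1 ≤ α) {ι : Type*} [Fintype ι]
    {f : ι → E → ℝ} {I : ι → Ω → ℝ} (h : ∀ i, IsStableIntegral α μ P M (f i) (I i))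
    {f' : ι → E' → ℝ} {I' : ι → Ω' → ℝ} (h' : ∀ i, IsStableIntegral α μ' P' M' (f' i) (I' i))
    (hE : ∀ θ : ι → ℝ, energy α μ (fun e => ∑ i, θ i * f i e) =
      energy α μ' (fun e => ∑ i, θ i * f' i e)) :
    IdentDistrib (fun ω i => I i ω) (fun ω i => I' i ω) P P' := by
  have hI : Measurable fun ω i => I i ω := measurable_pi_lambda _ fun i => (h i).2.1
  have hI' : Measurable fun ω i => I' i ω := measurable_pi_lambda _ fun i => (h' i).2.1
  refine ⟨hI.aemeasurable, hI'.aemeasurable, ?_⟩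
  refine (MeasurableEquiv.toLp 2 (ι → ℝ)).map_measurableEquiv_injective
    <| Measure.ext_of_charFun <| funext fun t => ?_
  rw [MeasurableEquiv.coe_toLp, Measure.map_map (WithLp.measurable_toLp 2 _) hI,
    Measure.map_map (WithLp.measurable_toLp 2 _) hI']
  exact (charFun_map_toLp hM hα h t).trans
    ((congrArg (fun x : ℝ≥0∞ => ((Real.exp (-x.toReal) : ℝ) : ℂ)) (hE t)).trans
      (charFun_map_toLp hM' hα h' t).symm)

/-- By Lévy's theorem, the joint laws of stochastic integrals converge if the energies of all linear
combinations of the integrands converge. -/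
lemma tendstoInDistribution_of_tendsto_energy (hM : IsStableRandomMeasure α μ P M)
    (hM' : IsStableRandomMeasure α μ' P' M') (hα : 1 ≤ α) {ι : Type*} [Fintype ι]
    {f : ℕ → ι → E → ℝ} {I : ℕ → ι → Ω → ℝ}
    (h : ∀ n i, IsStableIntegral α μ P M (f n i) (I n i))
    {f' : ι → E' → ℝ} {I' : ι → Ω' → ℝ} (h' : ∀ i, IsStableIntegral α μ' P' M' (f' i) (I' i))
    (hE : ∀ θ : ι → ℝ, Tendsto (fun n => energy α μ (fun e => ∑ i, θ i * f n i e)) atTop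
      (𝓝 (energy α μ' (fun e => ∑ i, θ i * f' i e)))) :
    TendstoInDistribution (fun n ω i => I n i ω) atTop (fun ω i => I' i ω) (fun _ => P) P' := by
  have hI : ∀ n, Measurable fun ω i => I n i ω :=
    fun n => measurable_pi_lambda _ fun i => (h n i).2.1
  have hI' : Measurable fun ω i => I' i ω := measurable_pi_lambda _ fun i => (h' i).2.1
  have key : TendstoInDistribution (fun n ω => WithLp.toLp 2 fun i => I n i ω) atTop
      (fun ω => WithLp.toLp 2 fun i => I' i ω) (fun _ => P) P' := by
    refine ⟨fun n => ((WithLp.measurable_toLp 2 _).comp (hI n)).aemeasurable,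
      ((WithLp.measurable_toLp 2 _).comp hI').aemeasurable, ?_⟩
    refine ProbabilityMeasure.tendsto_of_tendsto_charFun fun θ => ?_
    simp only [ProbabilityMeasure.coe_mk]
    rw [charFun_map_toLp hM' hα h' θ]
    simp only [charFun_map_toLp hM hα (h _) θ]
    have hfin := MemLp.energy_ne_top (by linarith : 0 < α)
      (IsStableIntegral.linearCombination hM' hα h' θ).1
    exact (Complex.continuous_ofReal.tendsto _).comp ((Real.continuous_exp.tendsto _).comp
      ((ENNReal.tendsto_toReal hfin).comp (hE θ)).neg)
  exact key.continuous_comp (g := fun x : EuclideanSpace ℝ ι => x.ofLp)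
    (PiLp.continuous_ofLp 2 _)

variable {f g : E → ℝ} {I J : Ω → ℝ}

lemma energy_eq_zero_iff (hα : 0 < α) (hf : AEStronglyMeasurable f μ) :
    energy α μ f = 0 ↔ f =ᵐ[μ] 0 := by
  rw [energy, lintegral_eq_zero_iff' (hf.enorm.pow_const α)]
  refine ⟨fun h => h.mono fun e he => ?_, fun h => h.mono fun e he => ?_⟩
  · simpa [hα, hα.not_gt] using he
  · simp [he, hα]

lemma IsStableIntegral.ae_eq_of_ae_eq (hM : IsStableRandomMeasure α μ P M) (hα : 1 ≤ α)
    (hI : IsStableIntegral α μ P M f I) (hJ : IsStableIntegral α μ P M g J) (hfg : f =ᵐ[μ] g) :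
    I =ᵐ[P] J := by
  have hα0 : 0 < α := by linarith
  have h := hI.sub hM hα hJ
  have hz : energy α μ (fun e => f e - g e) = 0 :=
    (energy_eq_zero_iff hα0 h.1.1).2 (hfg.mono fun e he => by simp [he])
  have hc : P.map (fun ω => I ω - J ω) = Measure.dirac 0 := by
    have := Measure.isProbabilityMeasure_map (μ := P) h.2.1.aemeasurable
    refine Measure.ext_of_charFun (funext fun t => ?_)
    rw [h.charFun hM hα, hz]
    simp
  have h0 : ∀ᵐ x ∂(P.map fun ω => I ω - J ω), x = 0 := by
    rw [hc, ae_dirac_eq]; simp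
  exact (ae_of_ae_map h.2.1.aemeasurable h0).mono fun ω hω => sub_eq_zero.1 hω

lemma IsStableIntegral.ae_eq_integrand (hM : IsStableRandomMeasure α μ P M) (hα : 1 ≤ α)
    (hI : IsStableIntegral α μ P M f I) (hJ : IsStableIntegral α μ P M g J) (hIJ : I =ᵐ[P] J) :
    f =ᵐ[μ] g := by
  have hα0 : 0 < α := by linarith
  have h := hI.sub hM hα hJ
  have h0 : (fun ω => I ω - J ω) =ᵐ[P] fun _ => (0 : ℝ) := hIJ.mono fun ω hω => by simp [hω]
  have hc := h.charFun hM hα 1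
  rw [Measure.map_congr h0, Measure.map_const, measure_univ, one_smul, charFun_dirac] at hc
  simp only [inner_zero_left, Complex.ofReal_zero, zero_mul, Complex.exp_zero, abs_one,
    Real.one_rpow, one_mul] at hc
  have hz : energy α μ (fun e => f e - g e) = 0 := by
    have h1 : Real.exp (-(energy α μ fun e => f e - g e).toReal) = 1 := by exact_mod_cast hc.symm
    rw [Real.exp_eq_one_iff, neg_eq_zero, ENNReal.toReal_eq_zero_iff] at h1
    exact h1.resolve_right (MemLp.energy_ne_top hα0 h.1)
  exact ((energy_eq_zero_iff hα0 h.1.1).1 hz).mono fun e he => sub_eq_zero.1 he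

/-- Two stochastic integrals are independent if and only if energies add up. -/
lemma IsStableIntegral.indepFun_iff (hM : IsStableRandomMeasure α μ P M) (hα : 1 ≤ α)
    (hI : IsStableIntegral α μ P M f I) (hJ : IsStableIntegral α μ P M g J) :
    IndepFun I J P ↔ ∀ a b : ℝ, energy α μ (fun e => a * f e + b * g e) =
      energy α μ (fun e => a * f e) + energy α μ (fun e => b * g e) := by
  have hα0 : 0 < α := by linarith
  rw [indepFun_iff_charFun_prod hI.2.1.aemeasurable hJ.2.1.aemeasurable]
  have key : ∀ a b : ℝ, (MeasureTheory.charFun (P.map fun ω => WithLp.toLp 2 (I ω, J ω)) (WithLp.toLp 2 (a, b)) =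
      MeasureTheory.charFun (P.map I) a * MeasureTheory.charFun (P.map J) b) ↔
      energy α μ (fun e => a * f e + b * g e) =
      energy α μ (fun e => a * f e) + energy α μ (fun e => b * g e) := by
    intro a b
    have hab := (hI.const_mul hM hα a).add hM hα (hJ.const_mul hM hα b)
    have e0 : MeasureTheory.charFun (P.map fun ω => WithLp.toLp 2 (I ω, J ω)) (WithLp.toLp 2 (a, b)) =
        MeasureTheory.charFun (P.map fun ω => a * I ω + b * J ω) 1 := by
      have hm : Measurable fun ω => WithLp.toLp 2 (I ω, J ω) :=
        (WithLp.measurable_toLp 2 _).comp (hI.2.1.prodMk hJ.2.1)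
      rw [charFun_apply, charFun_apply_real, integral_map hm.aemeasurable (by fun_prop),
        integral_map hab.2.1.aemeasurable (by fun_prop)]
      congr 1
      ext ω
      rw [Complex.ofReal_one, one_mul, WithLp.prod_inner_apply]
      simp
    have e1 := (hI.const_mul hM hα a).charFun hM hα 1
    have e2 := (hJ.const_mul hM hα b).charFun hM hα 1
    have e3 : ∀ (c : ℝ) (K : Ω → ℝ), Measurable K →
        MeasureTheory.charFun (P.map fun ω => c * K ω) 1 = MeasureTheory.charFun (P.map K) c := by
      intro c K hK
      have := charFun_map_mul (μ := P.map K) c 1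
      rwa [Measure.map_map (measurable_const_mul _) hK, mul_one] at this
    rw [e3 _ _ hI.2.1] at e1
    rw [e3 _ _ hJ.2.1] at e2
    have hfa := MemLp.energy_ne_top hα0 (hI.const_mul hM hα a).1
    have hgb := MemLp.energy_ne_top hα0 (hJ.const_mul hM hα b).1
    rw [e0, hab.charFun hM hα, e1, e2, ← Complex.ofReal_mul, Complex.ofReal_inj, ← Real.exp_add,
      Real.exp_eq_exp, abs_one, Real.one_rpow, one_mul, one_mul, one_mul, ← neg_add, neg_inj,
      ← ENNReal.toReal_add hfa hgb, ENNReal.toReal_eq_toReal_iff'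
      (MemLp.energy_ne_top hα0 hab.1) (ENNReal.add_ne_top.2 ⟨hfa, hgb⟩)]
  exact ⟨fun h a b => (key a b).1 (h _), fun h t => (key t.ofLp.1 t.ofLp.2).2 (h _ _)⟩

lemma IsStableIntegral.indepFun_of_mul_eq_zero (hM : IsStableRandomMeasure α μ P M) (hα : 1 ≤ α)
    (hI : IsStableIntegral α μ P M f I) (hJ : IsStableIntegral α μ P M g J)
    (hfg : ∀ᵐ e ∂μ, f e = 0 ∨ g e = 0) : IndepFun I J P := by
  have hα0 : 0 < α := by linarith
  rw [hI.indepFun_iff hM hα hJ]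
  intro a b
  unfold energy
  rw [← lintegral_add_left' ((hI.const_mul hM hα a).1.1.enorm.pow_const α)]
  refine lintegral_congr_ae (hfg.mono fun e he => ?_)
  rcases he with he | he <;> simp [he, hα0]

/-- Nonnegative integrands whose supports overlap give dependent integrals: as `α > 1`, the energy
of the sum exceeds the sum of the energies. -/
lemma IsStableIntegral.not_indepFun (hM : IsStableRandomMeasure α μ P M) (hα : 1 < α)
    (hI : IsStableIntegral α μ P M f I) (hJ : IsStableIntegral α μ P M g J)
    (hf : ∀ᵐ e ∂μ, 0 ≤ f e) (hg : ∀ᵐ e ∂μ, 0 ≤ g e) {S : Set E} (hS : μ S ≠ 0)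
    (hpos : ∀ e ∈ S, 0 < f e ∧ 0 < g e) : ¬ IndepFun I J P := by
  have hα0 : 0 < α := by linarith
  rw [hI.indepFun_iff hM hα.le hJ]
  intro h
  have h1 := h 1 1
  simp only [one_mul] at h1
  have hfm := hI.1.1.enorm.pow_const α
  have hgm := hJ.1.1.enorm.pow_const α
  unfold energy at h1
  rw [← lintegral_add_left' hfm] at h1
  have hle : (fun e => ‖f e‖ₑ ^ α + ‖g e‖ₑ ^ α) ≤ᵐ[μ] fun e => ‖f e + g e‖ₑ ^ α := by
    filter_upwards [hf, hg] with e h1 h2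
    rw [Real.enorm_of_nonneg h1, Real.enorm_of_nonneg h2, Real.enorm_of_nonneg (add_nonneg h1 h2),
      ENNReal.ofReal_add h1 h2]
    exact ENNReal.add_rpow_le_rpow_add _ _ hα.le
  have hfin : ∫⁻ e, ‖f e‖ₑ ^ α + ‖g e‖ₑ ^ α ∂μ ≠ ∞ := by
    rw [lintegral_add_left' hfm]
    exact ENNReal.add_ne_top.2 ⟨MemLp.energy_ne_top hα0 hI.1, MemLp.energy_ne_top hα0 hJ.1⟩
  have hae := ae_eq_of_ae_le_of_lintegral_le hle hfin
    ((hI.1.1.add hJ.1.1).enorm.pow_const α) h1.le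
  refine hS (measure_mono_null (fun e he => ?_) hae)
  obtain ⟨h1, h2⟩ := hpos e he
  refine fun heq => ?_
  have heq' : ‖f e‖ₑ ^ α + ‖g e‖ₑ ^ α = ‖f e + g e‖ₑ ^ α := heq
  rw [Real.enorm_of_nonneg h1.le, Real.enorm_of_nonneg h2.le,
    Real.enorm_of_nonneg (add_nonneg h1.le h2.le), ENNReal.ofReal_rpow_of_pos h1,
    ENNReal.ofReal_rpow_of_pos h2, ENNReal.ofReal_rpow_of_pos (add_pos h1 h2),
    ← ENNReal.ofReal_add (by positivity) (by positivity),
    ENNReal.ofReal_eq_ofReal_iff (by positivity) (by positivity)] at heq'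
  have ha : ∀ x y : ℝ, 0 < x → 0 < y → x ^ α < x * (x + y) ^ (α - 1) := by
    intro x y hx hy
    have : x ^ α = x * x ^ (α - 1) := by
      rw [← Real.rpow_one_add' hx.le (by linarith)]; congr 1; ring
    rw [this]
    exact mul_lt_mul_of_pos_left (Real.rpow_lt_rpow hx.le (by linarith) (by linarith)) hx
  have hs : (f e + g e) ^ α = f e * (f e + g e) ^ (α - 1) + g e * (g e + f e) ^ (α - 1) := by
    rw [add_comm (g e), ← add_mul, ← Real.rpow_one_add' (by positivity) (by linarith)]
    congr 1; ring
  linarith [ha _ _ h1 h2, ha _ _ h2 h1]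

end Laws

/-! ### The lattice Green function: Fourier representation and total mass -/

section Green

/-- The Fourier transform `x ↦ ∑ₛ p_k(t,s) cos (s x)` of the `k`-step transition probabilities in
the vertical direction. -/
def walkFourier : ℕ → ℤ → ℝ → ℝ
  | 0, t, _ => if t = 0 then 1 else 0
  | k + 1, t, x => (walkFourier k (t - 1) x + 2 * Real.cos x * walkFourier k t x) / 3

/-- The Fourier transform `x ↦ ∑ₛ g₃(t,s,a) cos (s x)` of the lattice Green function, at `t ≥ 0`. -/
def greenFourier (t : ℕ) (x a : ℝ) : ℝ := 3 * a ^ t / (3 - 2 * a * Real.cos x) ^ (t + 1)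

lemma continuous_walkFourier (k : ℕ) (t : ℤ) : Continuous (walkFourier k t) := by
  induction k generalizing t with
  | zero => exact continuous_const
  | succ k ih =>
    have h1 := ih (t - 1)
    have h2 := ih t
    change Continuous fun x => (walkFourier k (t - 1) x + 2 * Real.cos x * walkFourier k t x) / 3
    fun_prop

lemma abs_walkFourier_le (k : ℕ) (t : ℤ) (x : ℝ) : |walkFourier k t x| ≤ 1 := by
  induction k generalizing t with
  | zero => unfold walkFourier; split_ifs <;> simp
  | succ k ih =>
    unfold walkFourier
    have h1 : |2 * Real.cos x * walkFourier k t x| ≤ 2 := by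
      rw [abs_mul, abs_mul, abs_two]
      nlinarith [ih t, Real.abs_cos_le_one x, abs_nonneg (Real.cos x),
        abs_nonneg (walkFourier k t x)]
    rw [abs_div, abs_of_pos (by norm_num : (0 : ℝ) < 3), div_le_one (by norm_num)]
    exact (abs_add_le _ _).trans (by linarith [ih (t - 1)])

lemma walkFourier_of_neg (k : ℕ) {t : ℤ} (ht : t < 0) (x : ℝ) : walkFourier k t x = 0 := by
  induction k generalizing t with
  | zero => simp [walkFourier, ht.ne]
  | succ k ih => simp [walkFourier, ih ht, ih (by omega : t - 1 < 0)]

lemma walkProb_eq_integral (k : ℕ) (t s : ℤ) :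
    walkProb k t s = (2 * Real.pi)⁻¹ *
      ∫ x in (-Real.pi)..Real.pi, Real.cos (s * x) * walkFourier k t x := by
  have hπ := Real.pi_pos
  induction k generalizing t s with
  | zero =>
    unfold walkProb walkFourier
    by_cases ht : t = 0
    · by_cases hs : s = 0
      · simp only [ht, hs, and_self, if_true, Int.cast_zero, zero_mul, Real.cos_zero, mul_one,
          intervalIntegral.integral_const, smul_eq_mul]
        field_simp
        ring
      · have hs' : (s : ℝ) ≠ 0 := by exact_mod_cast hs
        simp [ht, hs, intervalIntegral.integral_comp_mul_left (fun x => Real.cos x) hs',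
          Real.sin_int_mul_pi]
    · simp [ht]
  | succ k ih =>
    unfold walkProb walkFourier
    rw [ih, ih, ih, ← mul_add, ← mul_add, mul_div_assoc]
    congr 1
    have hc : ∀ (r t : ℤ), IntervalIntegrable (fun x : ℝ => Real.cos (r * x) * walkFourier k t x)
        volume (-Real.pi) Real.pi := fun r t => by
      have := continuous_walkFourier k t
      exact (by fun_prop : Continuous fun x : ℝ =>
        Real.cos (r * x) * walkFourier k t x).intervalIntegrable _ _
    rw [← intervalIntegral.integral_add (hc _ _) (hc _ _),
      ← intervalIntegral.integral_add ((hc _ _).add (hc _ _)) (hc _ _),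
      ← intervalIntegral.integral_div]
    refine intervalIntegral.integral_congr fun x _ => ?_
    have h : Real.cos ((s - 1 : ℤ) * x) + Real.cos ((s + 1 : ℤ) * x) =
        2 * Real.cos (s * x) * Real.cos x := by
      push_cast
      rw [sub_mul, add_mul, one_mul, Real.cos_sub, Real.cos_add]; ring
    linear_combination (walkFourier k t x / 3) * h

lemma walkProb_nonneg (k : ℕ) (t s : ℤ) : 0 ≤ walkProb k t s := by
  induction k generalizing t s with
  | zero => unfold walkProb; split_ifs <;> simp
  | succ k ih =>
    unfold walkProb
    have := ih (t - 1) s; have := ih t (s - 1); have := ih t (s + 1)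
    positivity

lemma walkProb_le_one (k : ℕ) (t s : ℤ) : walkProb k t s ≤ 1 := by
  induction k generalizing t s with
  | zero => unfold walkProb; split_ifs <;> simp
  | succ k ih =>
    unfold walkProb
    linarith [ih (t - 1) s, ih t (s - 1), ih t (s + 1)]

lemma walkProb_of_neg (k : ℕ) {t : ℤ} (ht : t < 0) (s : ℤ) : walkProb k t s = 0 := by
  rw [walkProb_eq_integral]; simp [walkFourier_of_neg k ht]

variable {a : ℝ}

lemma green3_nonneg (ha : 0 ≤ a) (t s : ℤ) : 0 ≤ green3 t s a :=
  tsum_nonneg fun k => mul_nonneg (pow_nonneg ha k) (walkProb_nonneg k t s)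

lemma summable_pow_mul {c : ℕ → ℝ} (ha : 0 ≤ a) (ha1 : a < 1) (hc : ∀ k, |c k| ≤ 1) :
    Summable fun k => a ^ k * c k := by
  refine Summable.of_norm_bounded (summable_geometric_of_lt_one ha ha1) fun k => ?_
  rw [norm_mul, Real.norm_of_nonneg (pow_nonneg ha k), Real.norm_eq_abs]
  exact mul_le_of_le_one_right (pow_nonneg ha k) (hc k)

lemma one_le_three_sub (ha : 0 ≤ a) (ha1 : a ≤ 1) (x : ℝ) : 1 ≤ 3 - 2 * a * Real.cos x := by
  nlinarith [Real.cos_le_one x, Real.neg_one_le_cos x]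

lemma tsum_walkFourier (ha : 0 ≤ a) (ha1 : a < 1) (t : ℕ) (x : ℝ) :
    ∑' k, a ^ k * walkFourier k t x = greenFourier t x a := by
  have hs : ∀ t : ℤ, Summable fun k => a ^ k * walkFourier k t x := fun t =>
    summable_pow_mul ha ha1 fun k => abs_walkFourier_le k t x
  have hd := one_le_three_sub ha ha1.le x
  have hd0 : 3 - 2 * a * Real.cos x ≠ 0 := by linarith
  have hrec : ∀ t : ℤ, (∑' k, a ^ k * walkFourier k t x) * (3 - 2 * a * Real.cos x) =
      3 * (if t = 0 then 1 else 0) + a * ∑' k, a ^ k * walkFourier k (t - 1) x := by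
    intro t
    have h1 := (hs t).tsum_eq_zero_add
    have h2 : ∀ k, a ^ (k + 1) * walkFourier (k + 1) t x =
        a / 3 * (a ^ k * walkFourier k (t - 1) x) +
          2 * a * Real.cos x / 3 * (a ^ k * walkFourier k t x) := by
      intro k; rw [walkFourier, pow_succ]; ring
    simp only [h2] at h1
    rw [((hs (t - 1)).mul_left _).tsum_add ((hs t).mul_left _), tsum_mul_left, tsum_mul_left] at h1
    simp only [pow_zero, one_mul, walkFourier] at h1
    linear_combination 3 * h1
  induction t with
  | zero =>
    have h := hrec 0
    rw [if_pos rfl] at h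
    simp only [walkFourier_of_neg _ (by norm_num : (0 : ℤ) - 1 < 0), mul_zero, tsum_zero] at h
    rw [greenFourier, eq_div_iff (by simpa using hd0)]
    simpa using h
  | succ t ih =>
    have h := hrec (t + 1 : ℕ)
    rw [if_neg (by omega), show ((t + 1 : ℕ) : ℤ) - 1 = t by push_cast; ring, ih] at h
    rw [eq_div_of_mul_eq hd0 h, greenFourier, greenFourier, mul_zero, zero_add, ← mul_div_assoc,
      div_div, ← pow_succ, pow_succ a]
    congr 1
    ring

lemma green3_eq_integral (ha : 0 ≤ a) (ha1 : a < 1) (t : ℕ) (s : ℤ) :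
    green3 t s a = (2 * Real.pi)⁻¹ *
      ∫ x in (-Real.pi)..Real.pi, Real.cos (s * x) * greenFourier t x a := by
  have h := intervalIntegral.hasSum_integral_of_dominated_convergence
    (μ := volume) (a := -Real.pi) (b := Real.pi)
    (F := fun k x => a ^ k * (Real.cos (s * x) * walkFourier k t x))
    (f := fun x => Real.cos (s * x) * greenFourier t x a) (fun k _ => a ^ k)
    (fun k => by
      have := continuous_walkFourier k t
      exact (by fun_prop : Continuous _).aestronglyMeasurable)
    (fun k => Eventually.of_forall fun x _ => by
      rw [norm_mul, Real.norm_of_nonneg (pow_nonneg ha k), norm_mul, Real.norm_eq_abs,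
        Real.norm_eq_abs]
      exact mul_le_of_le_one_right (pow_nonneg ha k)
        (mul_le_one₀ (Real.abs_cos_le_one _) (abs_nonneg _) (abs_walkFourier_le k t x)))
    (Eventually.of_forall fun x _ => summable_geometric_of_lt_one ha ha1)
    intervalIntegrable_const
    (Eventually.of_forall fun x _ => by
      have h1 := (summable_pow_mul ha ha1 fun k => abs_walkFourier_le k t x).hasSum
      rw [tsum_walkFourier ha ha1] at h1
      refine (h1.mul_left (Real.cos (s * x))).congr_fun fun k => ?_
      ring)
  rw [← h.tsum_eq, green3, ← tsum_mul_left]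
  refine tsum_congr fun k => ?_
  rw [walkProb_eq_integral, intervalIntegral.integral_const_mul]
  ring

lemma walkFourier_zero_nonneg (k : ℕ) (t : ℤ) : 0 ≤ walkFourier k t 0 := by
  induction k generalizing t with
  | zero => unfold walkFourier; split_ifs <;> simp
  | succ k ih =>
    unfold walkFourier
    have := ih (t - 1); have := ih t
    rw [Real.cos_zero]
    positivity

lemma tsum_walkProb (k : ℕ) (t : ℤ) :
    ∑' s, ENNReal.ofReal (walkProb k t s) = ENNReal.ofReal (walkFourier k t 0) := by
  induction k generalizing t with
  | zero =>
    unfold walkProb walkFourier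
    rw [tsum_eq_single 0 (fun s hs => by simp [hs])]
    simp
  | succ k ih =>
    have h : ∀ s, ENNReal.ofReal (walkProb (k + 1) t s) = ENNReal.ofReal 3⁻¹ *
        (ENNReal.ofReal (walkProb k (t - 1) s) + ENNReal.ofReal (walkProb k t (s - 1)) +
          ENNReal.ofReal (walkProb k t (s + 1))) := by
      intro s
      have h1 := walkProb_nonneg k (t - 1) s
      have h2 := walkProb_nonneg k t (s - 1)
      have h3 := walkProb_nonneg k t (s + 1)
      rw [← ENNReal.ofReal_add h1 h2, ← ENNReal.ofReal_add (by positivity) h3,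
        ← ENNReal.ofReal_mul (by norm_num), walkProb]
      congr 1; ring
    simp only [h]
    have e1 : ∑' s : ℤ, ENNReal.ofReal (walkProb k t (s - 1)) = _ :=
      (Equiv.subRight (1 : ℤ)).tsum_eq (fun s => ENNReal.ofReal (walkProb k t s))
    have e2 : ∑' s : ℤ, ENNReal.ofReal (walkProb k t (s + 1)) = _ :=
      (Equiv.addRight (1 : ℤ)).tsum_eq (fun s => ENNReal.ofReal (walkProb k t s))
    rw [ENNReal.tsum_mul_left, ENNReal.tsum_add, ENNReal.tsum_add, e1, e2, ih, ih]
    have h1 := walkFourier_zero_nonneg k (t - 1)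
    have h2 := walkFourier_zero_nonneg k t
    rw [← ENNReal.ofReal_add h1 h2, ← ENNReal.ofReal_add (by positivity) h2,
        ← ENNReal.ofReal_mul (by norm_num), walkFourier, Real.cos_zero]
    congr 1; ring

lemma tsum_walkFourier_zero (k : ℕ) : ∑' t, ENNReal.ofReal (walkFourier k t 0) = 1 := by
  induction k with
  | zero =>
    unfold walkFourier
    rw [tsum_eq_single 0 (fun s hs => by simp [hs])]
    simp
  | succ k ih =>
    have h : ∀ t, ENNReal.ofReal (walkFourier (k + 1) t 0) = ENNReal.ofReal 3⁻¹ *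
        (ENNReal.ofReal (walkFourier k (t - 1) 0) + 2 * ENNReal.ofReal (walkFourier k t 0)) := by
      intro t
      have h1 := walkFourier_zero_nonneg k (t - 1)
      have h2 := walkFourier_zero_nonneg k t
      rw [show (2 : ℝ≥0∞) = ENNReal.ofReal 2 by simp, ← ENNReal.ofReal_mul (by norm_num),
        ← ENNReal.ofReal_add h1 (by positivity), ← ENNReal.ofReal_mul (by norm_num), walkFourier,
        Real.cos_zero]
      congr 1; ring
    simp only [h]
    have e1 : ∑' t : ℤ, ENNReal.ofReal (walkFourier k (t - 1) 0) = _ :=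
      (Equiv.subRight (1 : ℤ)).tsum_eq (fun t => ENNReal.ofReal (walkFourier k t 0))
    rw [ENNReal.tsum_mul_left, ENNReal.tsum_add, ENNReal.tsum_mul_left, e1, ih]
    rw [show (1 : ℝ≥0∞) + 2 * 1 = ENNReal.ofReal 3 by norm_num, ← ENNReal.ofReal_mul (by norm_num)]
    norm_num

lemma ofReal_green3 (ha : 0 ≤ a) (ha1 : a < 1) (t s : ℤ) :
    ENNReal.ofReal (green3 t s a) =
      ∑' k, ENNReal.ofReal (a ^ k) * ENNReal.ofReal (walkProb k t s) := by
  rw [green3, ENNReal.ofReal_tsum_of_nonneg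
    (fun k => mul_nonneg (pow_nonneg ha k) (walkProb_nonneg k t s))
    (summable_pow_mul ha ha1 fun k => abs_le.2
      ⟨by linarith [walkProb_nonneg k t s], walkProb_le_one k t s⟩)]
  exact tsum_congr fun k => ENNReal.ofReal_mul (pow_nonneg ha k)

lemma tsum_green3_eq_tsum (ha : 0 ≤ a) (ha1 : a < 1) (t : ℤ) :
    ∑' s, ENNReal.ofReal (green3 t s a) =
      ∑' k, ENNReal.ofReal (a ^ k) * ENNReal.ofReal (walkFourier k t 0) := by
  simp only [ofReal_green3 ha ha1]
  rw [ENNReal.tsum_comm]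
  simp only [ENNReal.tsum_mul_left, tsum_walkProb]

/-- The mass of the Green function on a vertical line. -/
lemma tsum_green3 (ha : 0 ≤ a) (ha1 : a < 1) (t : ℕ) :
    ∑' s, ENNReal.ofReal (green3 t s a) = ENNReal.ofReal (greenFourier t 0 a) := by
  rw [tsum_green3_eq_tsum ha ha1, ← tsum_walkFourier ha ha1, ENNReal.ofReal_tsum_of_nonneg
    (fun k => mul_nonneg (pow_nonneg ha k) (walkFourier_zero_nonneg k t))
    (summable_pow_mul ha ha1 fun k => abs_walkFourier_le k t 0)]
  exact tsum_congr fun k => (ENNReal.ofReal_mul (pow_nonneg ha k)).symm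

/-- The total mass of the Green function. -/
lemma tsum_tsum_green3 (ha : 0 ≤ a) (ha1 : a < 1) :
    ∑' t, ∑' s, ENNReal.ofReal (green3 t s a) = ENNReal.ofReal (1 - a)⁻¹ := by
  simp only [tsum_green3_eq_tsum ha ha1]
  rw [ENNReal.tsum_comm]
  simp only [ENNReal.tsum_mul_left, tsum_walkFourier_zero, mul_one]
  rw [← tsum_geometric_of_lt_one ha ha1, ENNReal.ofReal_tsum_of_nonneg
    (fun k => pow_nonneg ha k) (summable_geometric_of_lt_one ha ha1)]

end Green

/-! ### Bounds of the lattice Green function -/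

section LocalLimit

variable {a : ℝ}

lemma greenFourier_nonneg (ha : 0 ≤ a) (ha1 : a ≤ 1) (t : ℕ) (x : ℝ) : 0 ≤ greenFourier t x a := by
  have := one_le_three_sub ha ha1 x
  unfold greenFourier
  positivity

lemma exp_div_eight_le {w : ℝ} (h0 : 0 ≤ w) (h7 : w ≤ 7) : Real.exp (w / 8) ≤ 1 + w := by
  have h1 : 1 - w / 8 ≤ Real.exp (-(w / 8)) := Real.one_sub_le_exp_neg _
  have h2 : Real.exp (w / 8) * Real.exp (-(w / 8)) = 1 := by rw [← Real.exp_add]; simp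
  have h3 := Real.exp_pos (w / 8)
  have h4 : Real.exp (w / 8) * (1 - w / 8) ≤ 1 :=
    (mul_le_mul_of_nonneg_left h1 h3.le).trans_eq h2
  have h5 : (1 : ℝ) ≤ (1 + w) * (1 - w / 8) := by nlinarith
  have h6 : 0 < 1 - w / 8 := by linarith
  exact le_of_mul_le_mul_right (h4.trans h5) h6

lemma ratio_le_exp (ha : 0 ≤ a) (ha1 : a ≤ 1) {x : ℝ} (hx : |x| ≤ Real.pi) :
    a / (3 - 2 * a * Real.cos x) ≤ Real.exp (-((3 / 8) * (1 - a) + x ^ 2 / 20)) := by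
  have hd := one_le_three_sub ha ha1 x
  have hc := Real.cos_le_one_sub_mul_cos_sq hx
  have hπ : (2 : ℝ) / 10 ≤ 2 / Real.pi ^ 2 := by
    have h1 : Real.pi ^ 2 ≤ 10 := by nlinarith [Real.pi_lt_d2, Real.pi_pos]
    exact div_le_div_of_nonneg_left (by norm_num) (by positivity) h1
  have hx2 : 2 / 10 * x ^ 2 ≤ 1 - Real.cos x := by nlinarith [sq_nonneg x]
  set w := 3 * (1 - a) + 2 * (1 - Real.cos x) with hw
  have hw0 : 0 ≤ w := by nlinarith [Real.cos_le_one x]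
  have hw7 : w ≤ 7 := by nlinarith [Real.neg_one_le_cos x]
  have h1 : a / (3 - 2 * a * Real.cos x) ≤ 1 / (1 + w) := by
    rw [div_le_div_iff₀ (by linarith) (by linarith), hw]
    nlinarith [sq_nonneg (1 - a)]
  refine h1.trans ?_
  rw [Real.exp_neg, one_div]
  refine inv_anti₀ (Real.exp_pos _) (le_trans (Real.exp_le_exp.2 ?_) (exp_div_eight_le hw0 hw7))
  rw [hw]; linarith

lemma greenFourier_le (ha : 0 ≤ a) (ha1 : a ≤ 1) (t : ℕ) {x : ℝ} (hx : |x| ≤ Real.pi) :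
    greenFourier t x a ≤ 3 * Real.exp (-(3 / 8 * (1 - a) * t)) * Real.exp (-(t / 20) * x ^ 2) := by
  have hd := one_le_three_sub ha ha1 x
  have h1 : greenFourier t x a =
      3 / (3 - 2 * a * Real.cos x) * (a / (3 - 2 * a * Real.cos x)) ^ t := by
    rw [greenFourier, div_pow, div_mul_div_comm, pow_succ']
  have h2 : (a / (3 - 2 * a * Real.cos x)) ^ t ≤
      Real.exp (-(3 / 8 * (1 - a) * t)) * Real.exp (-(t / 20) * x ^ 2) := by
    refine (pow_le_pow_left₀ (by positivity) (ratio_le_exp ha ha1 hx) t).trans (le_of_eq ?_)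
    rw [← Real.exp_nat_mul, ← Real.exp_add]
    congr 1; ring
  rw [h1, mul_assoc (3 : ℝ)]
  refine mul_le_mul ?_ h2 (by positivity) (by norm_num)
  rw [div_le_iff₀ (by linarith)]; linarith

lemma green3_le_mass (ha : 0 ≤ a) (ha1 : a < 1) (t : ℕ) (s : ℤ) :
    green3 t s a ≤ greenFourier t 0 a := by
  rw [← ENNReal.ofReal_le_ofReal_iff (greenFourier_nonneg ha ha1.le t 0), ← tsum_green3 ha ha1]
  exact ENNReal.le_tsum s

lemma mass_le (ha : 0 ≤ a) (ha1 : a ≤ 1) (t : ℕ) :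
    greenFourier t 0 a ≤ 3 * Real.exp (-(3 / 8 * (1 - a) * t)) := by
  have := greenFourier_le ha ha1 t (x := 0) (by simpa using Real.pi_pos.le)
  simpa using this

lemma green3_le_sqrt (ha : 0 ≤ a) (ha1 : a < 1) (t : ℕ) (s : ℤ) :
    green3 t s a ≤ 6 / Real.sqrt (t + 1) * Real.exp (-(3 / 8 * (1 - a) * t)) := by
  rcases Nat.eq_zero_or_pos t with rfl | ht
  · have h := (green3_le_mass ha ha1 0 s).trans (mass_le ha ha1.le 0)
    refine h.trans ?_
    simp only [Nat.cast_zero, mul_zero, neg_zero, Real.exp_zero, mul_one, zero_add, Real.sqrt_one]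
    norm_num
  have ht1 : (1 : ℝ) ≤ t := by exact_mod_cast ht
  have hπ := Real.pi_pos
  set D := Real.exp (-(3 / 8 * (1 - a) * t)) with hD
  have hcont : Continuous fun x => greenFourier t x a := by
    unfold greenFourier
    refine Continuous.div (by fun_prop) (by fun_prop) fun x => ?_
    have := one_le_three_sub ha ha1.le x
    positivity
  have h1 : ∫ x in (-Real.pi)..Real.pi, Real.cos (s * x) * greenFourier t x a ≤
      ∫ x in (-Real.pi)..Real.pi, 3 * D * Real.exp (-(t / 20) * x ^ 2) := by
    refine intervalIntegral.integral_mono_on (by linarith) ?_ ?_ fun x hx => ?_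
    · exact (by fun_prop : Continuous fun x =>
        Real.cos (s * x) * greenFourier t x a).intervalIntegrable _ _
    · exact (by fun_prop : Continuous fun x : ℝ =>
        3 * D * Real.exp (-(t / 20) * x ^ 2)).intervalIntegrable _ _
    · refine le_trans ?_ (greenFourier_le ha ha1.le t (abs_le.2 hx))
      exact mul_le_of_le_one_left (greenFourier_nonneg ha ha1.le t x) (Real.cos_le_one _)
  have h2 : ∫ x in (-Real.pi)..Real.pi, 3 * D * Real.exp (-(t / 20) * x ^ 2) ≤
      3 * D * Real.sqrt (Real.pi / (t / 20)) := by
    rw [intervalIntegral.integral_const_mul, ← integral_gaussian,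
      intervalIntegral.integral_of_le (by linarith)]
    refine mul_le_mul_of_nonneg_left ?_ (by positivity)
    exact setIntegral_le_integral (integrable_exp_neg_mul_sq (by positivity))
      (Eventually.of_forall fun x => (Real.exp_pos _).le)
  rw [green3_eq_integral ha ha1]
  have h3 : Real.sqrt (Real.pi / (t / 20)) ≤ 4 * Real.pi / Real.sqrt (t + 1) := by
    rw [← Real.sqrt_sq (by positivity : (0 : ℝ) ≤ 4 * Real.pi), ← Real.sqrt_div (by positivity)]
    refine Real.sqrt_le_sqrt ?_
    rw [div_div_eq_mul_div, div_le_div_iff₀ (by positivity) (by positivity)]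
    have h4 : 3 * (Real.pi * t) ≤ Real.pi * (Real.pi * t) :=
      mul_le_mul_of_nonneg_right Real.pi_gt_three.le (by positivity)
    have h5 : Real.pi * 1 ≤ Real.pi * t := mul_le_mul_of_nonneg_left ht1 hπ.le
    nlinarith
  calc (2 * Real.pi)⁻¹ * ∫ x in (-Real.pi)..Real.pi, Real.cos (s * x) * greenFourier t x a
      ≤ (2 * Real.pi)⁻¹ * (3 * D * (4 * Real.pi / Real.sqrt (t + 1))) := by
        gcongr
        exact h1.trans (h2.trans (by gcongr))
    _ = 6 / Real.sqrt (t + 1) * D := by field_simp; ring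

/-! ### Bounds in the scaled variables `t = ⌊N w⌋`, `a = 1 - z / N` -/

lemma exp_floor_le {N w z : ℝ} (hN : 0 < N) (hz : 0 < z) (hzN : z ≤ N) :
    Real.exp (-(3 / 8 * (1 - (1 - z / N)) * (⌊N * w⌋₊ : ℝ))) ≤
      3 / 2 * Real.exp (-(3 / 8 * z * w)) := by
  have h1 : N * w < ⌊N * w⌋₊ + 1 := Nat.lt_floor_add_one _
  have h2 : z / N ≤ 1 := (div_le_one hN).2 hzN
  have h3 : z * w ≤ z / N * ⌊N * w⌋₊ + 1 := by
    have : z * w = z / N * (N * w) := by field_simp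
    rw [this]
    nlinarith [div_pos hz hN]
  have h4 : Real.exp (3 / 8) ≤ 3 / 2 := by
    have := Real.exp_bound_div_one_sub_of_interval (x := 3 / 8) (by norm_num) (by norm_num)
    have h5 : Real.exp (3 / 8) ^ 8 ≤ (3 / 2) ^ 8 := by
      rw [← Real.exp_nat_mul]
      norm_num
      have h6 := Real.exp_one_lt_d9
      have h7 : Real.exp 3 = Real.exp 1 ^ 3 := by rw [← Real.exp_nat_mul]; norm_num
      rw [h7]
      calc Real.exp 1 ^ 3 ≤ 2.72 ^ 3 := by gcongr; linarith
        _ ≤ _ := by norm_num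
    exact le_of_pow_le_pow_left₀ (by norm_num) (by norm_num) h5
  calc _ ≤ Real.exp (3 / 8 + -(3 / 8 * z * w)) := Real.exp_le_exp.2 (by
        rw [sub_sub_cancel]; linarith)
    _ ≤ _ := by rw [Real.exp_add]; gcongr

lemma scaled_param_mem {N z : ℝ} (hN : 0 < N) (hz : 0 < z) (hzN : z ≤ N) :
    0 ≤ 1 - z / N ∧ 1 - z / N < 1 := by
  have h2 : z / N ≤ 1 := (div_le_one hN).2 hzN
  exact ⟨by linarith, by linarith [div_pos hz hN]⟩

lemma mass_floor_le {N w z : ℝ} (hN : 0 < N) (hz : 0 < z) (hzN : z ≤ N) :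
    greenFourier ⌊N * w⌋₊ 0 (1 - z / N) ≤ 9 * Real.exp (-(3 / 8 * z * w)) := by
  obtain ⟨h0, h1⟩ := scaled_param_mem hN hz hzN
  refine (mass_le h0 h1.le _).trans ?_
  have := exp_floor_le (w := w) hN hz hzN
  nlinarith [Real.exp_pos (-(3 / 8 * z * w))]

lemma sqrt_mul_green3_floor_le {N w z : ℝ} (hN : 0 < N) (hz : 0 < z) (hzN : z ≤ N) (hw : 0 < w)
    (s : ℤ) :
    Real.sqrt N * green3 (⌊N * w⌋₊ : ℕ) s (1 - z / N) ≤
      9 / Real.sqrt w * Real.exp (-(3 / 8 * z * w)) := by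
  obtain ⟨h0, h1⟩ := scaled_param_mem hN hz hzN
  have h2 : N * w < ⌊N * w⌋₊ + 1 := Nat.lt_floor_add_one _
  have h3 : Real.sqrt N * Real.sqrt w ≤ Real.sqrt (⌊N * w⌋₊ + 1) := by
    rw [← Real.sqrt_mul hN.le]; exact Real.sqrt_le_sqrt h2.le
  have hsw : 0 < Real.sqrt w := Real.sqrt_pos.2 hw
  have hsN : 0 < Real.sqrt N := Real.sqrt_pos.2 hN
  have h4 : Real.sqrt N * (6 / Real.sqrt (⌊N * w⌋₊ + 1)) ≤ 6 / Real.sqrt w := by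
    rw [mul_div_assoc', div_le_div_iff₀ (by positivity) hsw]
    nlinarith
  calc Real.sqrt N * green3 (⌊N * w⌋₊ : ℕ) s (1 - z / N)
      ≤ Real.sqrt N * (6 / Real.sqrt (⌊N * w⌋₊ + 1) *
          Real.exp (-(3 / 8 * (1 - (1 - z / N)) * (⌊N * w⌋₊ : ℝ)))) := by
        gcongr; exact green3_le_sqrt h0 h1 _ s
    _ = (Real.sqrt N * (6 / Real.sqrt (⌊N * w⌋₊ + 1))) *
          Real.exp (-(3 / 8 * (1 - (1 - z / N)) * (⌊N * w⌋₊ : ℝ))) := by ring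
    _ ≤ 6 / Real.sqrt w * (3 / 2 * Real.exp (-(3 / 8 * z * w))) := by
        gcongr
        exact exp_floor_le hN hz hzN
    _ = 9 / Real.sqrt w * Real.exp (-(3 / 8 * z * w)) := by ring

/-! ### The local limit theorem -/

lemma tendsto_one_add_pow_exp {k : ℕ → ℕ} {g : ℕ → ℝ} {L : ℝ} (hg : Tendsto g atTop (𝓝 0))
    (h : Tendsto (fun n => (k n : ℝ) * g n) atTop (𝓝 L)) :
    Tendsto (fun n => (1 + g n) ^ k n) atTop (𝓝 (Real.exp L)) := by
  have hpos : ∀ᶠ n in atTop, 0 < 1 + g n :=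
    (hg.eventually (lt_mem_nhds (show (-1 : ℝ) < 0 by norm_num))).mono fun n hn => by linarith
  have hlow : Tendsto (fun n => (k n : ℝ) * g n * (1 + g n)⁻¹) atTop (𝓝 L) := by
    have := h.mul ((tendsto_const_nhds (x := (1 : ℝ)).add hg).inv₀ (by norm_num))
    simpa using this
  have hlog : Tendsto (fun n => (k n : ℝ) * Real.log (1 + g n)) atTop (𝓝 L) := by
    refine tendsto_of_tendsto_of_tendsto_of_le_of_le' hlow h ?_ ?_
    · filter_upwards [hpos] with n hn
      rw [mul_assoc]
      refine mul_le_mul_of_nonneg_left ?_ (Nat.cast_nonneg _)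
      have := Real.one_sub_inv_le_log_of_pos hn
      refine le_trans (le_of_eq ?_) this
      field_simp; ring
    · filter_upwards [hpos] with n hn
      refine mul_le_mul_of_nonneg_left ?_ (Nat.cast_nonneg _)
      linarith [Real.log_le_sub_one_of_pos hn]
  refine ((Real.continuous_exp.tendsto _).comp hlog).congr' ?_
  filter_upwards [hpos] with n hn
  rw [Function.comp, Real.exp_nat_mul, Real.exp_log hn]

lemma tendsto_mul_one_sub_cos {N : ℕ → ℝ} (hN : Tendsto N atTop atTop) (y : ℝ) :
    Tendsto (fun n => N n * (1 - Real.cos (y / Real.sqrt (N n)))) atTop (𝓝 (y ^ 2 / 2)) := by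
  have h0 : Tendsto (fun n => y / Real.sqrt (N n)) atTop (𝓝 0) :=
    tendsto_const_nhds.div_atTop (Real.tendsto_sqrt_atTop.comp hN)
  have hb : Tendsto (fun n => y ^ 4 * (5 / 96) / N n) atTop (𝓝 0) :=
    tendsto_const_nhds.div_atTop hN
  rw [tendsto_iff_norm_sub_tendsto_zero]
  refine squeeze_zero' (Eventually.of_forall fun _ => norm_nonneg _) ?_ hb
  have h1 : ∀ᶠ n in atTop, |y / Real.sqrt (N n)| ≤ 1 := by
    have := h0.abs
    rw [abs_zero] at this
    exact this.eventually_le_const (by norm_num)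
  filter_upwards [h1, hN.eventually_gt_atTop 0] with n hn hpos
  have hc := Real.cos_bound hn
  have hs : Real.sqrt (N n) ^ 2 = N n := Real.sq_sqrt hpos.le
  have h2 : (y / Real.sqrt (N n)) ^ 2 = y ^ 2 / N n := by rw [div_pow, hs]
  have h4 : |y / Real.sqrt (N n)| ^ 4 = y ^ 4 / N n ^ 2 := by
    rw [show (4 : ℕ) = 2 * 2 by norm_num, pow_mul, sq_abs, h2, div_pow]; ring
  rw [h4, h2] at hc
  have h5 : N n * (1 - Real.cos (y / Real.sqrt (N n))) - y ^ 2 / 2 =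
      -(N n * (Real.cos (y / Real.sqrt (N n)) - (1 - y ^ 2 / N n / 2))) := by
    field_simp; ring
  rw [h5, norm_neg, norm_mul, Real.norm_of_nonneg hpos.le, Real.norm_eq_abs]
  calc N n * _ ≤ N n * (y ^ 4 / N n ^ 2 * (5 / 96)) := by gcongr
    _ = y ^ 4 * (5 / 96) / N n := by field_simp

lemma tendsto_greenFourier {N : ℕ → ℝ} (hN : Tendsto N atTop atTop) {k : ℕ → ℕ} {τ : ℝ}
    (hk : Tendsto (fun n => (k n : ℝ) / N n) atTop (𝓝 τ)) (z y : ℝ) :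
    Tendsto (fun n => greenFourier (k n) (y / Real.sqrt (N n)) (1 - z / N n)) atTop
      (𝓝 (3 * Real.exp (-(3 * z * τ) - τ * y ^ 2))) := by
  have hε : Tendsto (fun n => z / N n) atTop (𝓝 0) := tendsto_const_nhds.div_atTop hN
  have h0 : Tendsto (fun n => y / Real.sqrt (N n)) atTop (𝓝 0) :=
    tendsto_const_nhds.div_atTop (Real.tendsto_sqrt_atTop.comp hN)
  have hcos : Tendsto (fun n => Real.cos (y / Real.sqrt (N n))) atTop (𝓝 1) := by
    simpa using! (Real.continuous_cos.tendsto 0).comp h0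
  have ha : Tendsto (fun n => 1 - z / N n) atTop (𝓝 1) := by simpa using hε.const_sub 1
  set d : ℕ → ℝ := fun n => 3 - 2 * (1 - z / N n) * Real.cos (y / Real.sqrt (N n)) with hd_def
  have hd : Tendsto d atTop (𝓝 1) := by
    have := ((ha.const_mul 2).mul hcos).const_sub 3
    norm_num at this
    exact this
  have hd0 : ∀ᶠ n in atTop, d n ≠ 0 := hd.eventually_ne one_ne_zero
  set g : ℕ → ℝ := fun n => -(3 * (z / N n) + 2 * (1 - z / N n) *
    (1 - Real.cos (y / Real.sqrt (N n)))) / d n with hg_def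
  have hNg : Tendsto (fun n => N n * g n) atTop (𝓝 (-(3 * z + y ^ 2))) := by
    have h1 := tendsto_mul_one_sub_cos hN y
    have h2 := ((((ha.const_mul 2).mul h1).const_add (3 * z)).neg.div hd one_ne_zero)
    have e : -(3 * z + 2 * 1 * (y ^ 2 / 2)) / 1 = -(3 * z + y ^ 2) := by ring
    rw [e] at h2
    refine h2.congr' ?_
    filter_upwards [hd0, hN.eventually_gt_atTop 0] with n hn hpos
    simp only [Pi.div_apply, hg_def]
    field_simp
  have hg : Tendsto g atTop (𝓝 0) := by
    have h1 := hNg.mul hN.inv_tendsto_atTop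
    rw [mul_zero] at h1
    refine h1.congr' ?_
    filter_upwards [hN.eventually_gt_atTop 0] with n hpos
    simp only [Pi.inv_apply]
    field_simp
  have hkg : Tendsto (fun n => (k n : ℝ) * g n) atTop (𝓝 (-(3 * z * τ) - τ * y ^ 2)) := by
    have h1 := hk.mul hNg
    rw [show τ * -(3 * z + y ^ 2) = -(3 * z * τ) - τ * y ^ 2 by ring] at h1
    refine h1.congr' ?_
    filter_upwards [hN.eventually_gt_atTop 0] with n hpos
    field_simp
  have hpow := tendsto_one_add_pow_exp hg hkg
  have h3 : Tendsto (fun n => 3 / d n) atTop (𝓝 3) := by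
    simpa using! (tendsto_const_nhds (x := (3 : ℝ))).div hd one_ne_zero
  refine (h3.mul hpow).congr' ?_
  filter_upwards [hd0] with n hn
  have h4 : 1 + g n = (1 - z / N n) / d n := by
    rw [eq_div_iff hn]
    simp only [hg_def, add_mul, div_mul_cancel₀ _ hn]
    simp only [hd_def]; ring
  rw [h4, greenFourier, div_pow, div_mul_div_comm, pow_succ']

lemma integral_cos_mul_gaussian {τ : ℝ} (hτ : 0 < τ) (σ : ℝ) :
    ∫ y : ℝ, Real.cos (σ * y) * Real.exp (-τ * y ^ 2) =
      Real.sqrt (Real.pi / τ) * Real.exp (-σ ^ 2 / (4 * τ)) := by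
  have h := fourierIntegral_gaussian (b := (τ : ℂ)) (by simpa using hτ) σ
  have h1 : ((Real.pi : ℂ) / τ) ^ (1 / 2 : ℂ) = ((Real.sqrt (Real.pi / τ) : ℝ) : ℂ) := by
    rw [Real.sqrt_eq_rpow, Complex.ofReal_cpow (by positivity)]
    push_cast; rfl
  rw [h1] at h
  have h2 : ((Real.sqrt (Real.pi / τ) : ℝ) : ℂ) * Complex.exp (-(σ : ℂ) ^ 2 / (4 * (τ : ℂ))) =
      ((Real.sqrt (Real.pi / τ) * Real.exp (-σ ^ 2 / (4 * τ)) : ℝ) : ℂ) := by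
    push_cast; rfl
  rw [h2] at h
  have hint : Integrable fun y : ℝ => Complex.exp (Complex.I * σ * y) *
      Complex.exp (-(τ : ℂ) * (y : ℂ) ^ 2) := by
    refine (integrable_cexp_neg_mul_sq (b := (τ : ℂ)) (by simpa using hτ)).bdd_mul (c := 1)
      (by fun_prop) (Eventually.of_forall fun y => ?_)
    rw [mul_assoc, mul_comm, ← Complex.ofReal_mul, Complex.norm_exp_ofReal_mul_I]
  have h3 := congrArg Complex.re h
  rw [Complex.ofReal_re, ← RCLike.re_eq_complex_re, ← integral_re hint] at h3
  rw [← h3]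
  congr 1
  ext y
  rw [RCLike.re_eq_complex_re, show Complex.I * (σ : ℂ) * y = ((σ * y : ℝ) : ℂ) * Complex.I by
      push_cast; ring, show -(τ : ℂ) * (y : ℂ) ^ 2 = ((-τ * y ^ 2 : ℝ) : ℂ) by push_cast; ring,
    ← Complex.ofReal_exp, Complex.re_mul_ofReal, Complex.exp_ofReal_mul_I_re]

/-- Local limit theorem for the Green function. -/
lemma tendsto_sqrt_mul_green3 {N : ℕ → ℝ} (hN : Tendsto N atTop atTop) {k : ℕ → ℕ} {s : ℕ → ℤ}
    {τ σ z : ℝ} (hτ : 0 < τ) (hz : 0 < z)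
    (hk : Tendsto (fun n => (k n : ℝ) / N n) atTop (𝓝 τ))
    (hs : Tendsto (fun n => (s n : ℝ) / Real.sqrt (N n)) atTop (𝓝 σ)) :
    Tendsto (fun n => Real.sqrt (N n) * green3 (k n) (s n) (1 - z / N n)) atTop
      (𝓝 (h3 τ σ z)) := by
  have hπ := Real.pi_pos
  set F : ℕ → ℝ → ℝ := fun n =>
    (Ioc (-Real.pi * Real.sqrt (N n)) (Real.pi * Real.sqrt (N n))).indicator fun y => Real.cos (s n * (y / Real.sqrt (N n))) *
      greenFourier (k n) (y / Real.sqrt (N n)) (1 - z / N n) with hF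
  have hNz : ∀ᶠ n in atTop, 0 < N n ∧ z ≤ N n :=
    (hN.eventually_gt_atTop 0).and (hN.eventually_ge_atTop z)
  have heq : ∀ᶠ n in atTop, Real.sqrt (N n) * green3 (k n) (s n) (1 - z / N n) =
      (2 * Real.pi)⁻¹ * ∫ y, F n y := by
    filter_upwards [hNz] with n ⟨hpos, hzN⟩
    obtain ⟨h0, h1⟩ := scaled_param_mem hpos hz hzN
    have hsq : 0 < Real.sqrt (N n) := Real.sqrt_pos.2 hpos
    have hc := intervalIntegral.integral_comp_div (a := -Real.pi * Real.sqrt (N n))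
      (b := Real.pi * Real.sqrt (N n)) (c := Real.sqrt (N n))
      (fun x => Real.cos (s n * x) * greenFourier (k n) x (1 - z / N n)) hsq.ne'
    rw [mul_div_cancel_right₀ _ hsq.ne', mul_div_cancel_right₀ _ hsq.ne', smul_eq_mul] at hc
    rw [green3_eq_integral h0 h1, hF, integral_indicator measurableSet_Ioc,
      ← intervalIntegral.integral_of_le (by nlinarith), hc]
    ring
  have hlim : Tendsto (fun n => ∫ y, F n y) atTop
      (𝓝 (∫ y, Real.cos (σ * y) * (3 * Real.exp (-(3 * z * τ) - τ * y ^ 2)))) := by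
    have hk2 : ∀ᶠ n in atTop, τ / 2 ≤ (k n : ℝ) / N n :=
      hk.eventually_const_le (by linarith)
    refine tendsto_integral_filter_of_dominated_convergence
      (fun y => 3 * Real.exp (-(τ / 40) * y ^ 2)) ?_ ?_ ?_ ?_
    · refine Eventually.of_forall fun n => ?_
      refine Measurable.aestronglyMeasurable (Measurable.indicator ?_ measurableSet_Ioc)
      unfold greenFourier
      fun_prop
    · filter_upwards [hNz, hk2] with n ⟨hpos, hzN⟩ hkn
      refine Eventually.of_forall fun y => ?_
      obtain ⟨h0, h1⟩ := scaled_param_mem hpos hz hzN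
      have hsq : 0 < Real.sqrt (N n) := Real.sqrt_pos.2 hpos
      simp only [hF]
      by_cases hy : y ∈ Ioc (-Real.pi * Real.sqrt (N n)) (Real.pi * Real.sqrt (N n))
      · rw [indicator_of_mem hy, norm_mul]
        have hy' : |y / Real.sqrt (N n)| ≤ Real.pi := by
          rw [abs_le, le_div_iff₀ hsq, div_le_iff₀ hsq]; exact ⟨hy.1.le, hy.2⟩
        have hg := greenFourier_le h0 h1.le (k n) hy'
        have hg0 := greenFourier_nonneg h0 h1.le (k n) (y / Real.sqrt (N n))
        rw [Real.norm_of_nonneg hg0, Real.norm_eq_abs]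
        refine (mul_le_of_le_one_left hg0 (Real.abs_cos_le_one _)).trans (hg.trans ?_)
        have e1 : Real.exp (-(3 / 8 * (1 - (1 - z / N n)) * (k n : ℝ))) ≤ 1 := by
          rw [Real.exp_le_one_iff, neg_nonpos, sub_sub_cancel]
          positivity
        have e2 : Real.exp (-((k n : ℝ) / 20) * (y / Real.sqrt (N n)) ^ 2) ≤
            Real.exp (-(τ / 40) * y ^ 2) := by
          rw [Real.exp_le_exp, div_pow, Real.sq_sqrt hpos.le]
          have : -((k n : ℝ) / 20) * (y ^ 2 / N n) = -((k n : ℝ) / N n / 20) * y ^ 2 := by ring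
          rw [this]
          nlinarith [sq_nonneg y]
        calc 3 * Real.exp (-(3 / 8 * (1 - (1 - z / N n)) * (k n : ℝ))) *
              Real.exp (-((k n : ℝ) / 20) * (y / Real.sqrt (N n)) ^ 2)
            ≤ 3 * 1 * Real.exp (-(τ / 40) * y ^ 2) := by gcongr
          _ = _ := by ring
      · rw [indicator_of_notMem hy, norm_zero]; positivity
    · exact (integrable_exp_neg_mul_sq (by positivity)).const_mul 3
    · refine Eventually.of_forall fun y => ?_
      have h1 := tendsto_greenFourier hN hk z y
      have h2 : Tendsto (fun n => Real.cos (s n * (y / Real.sqrt (N n)))) atTop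
          (𝓝 (Real.cos (σ * y))) := by
        refine (Real.continuous_cos.tendsto _).comp ((hs.mul_const y).congr fun n => ?_)
        ring
      refine (h2.mul h1).congr' ?_
      have h3 : ∀ᶠ n in atTop, |y| < Real.pi * Real.sqrt (N n) :=
        ((Real.tendsto_sqrt_atTop.comp hN).const_mul_atTop hπ).eventually_gt_atTop _
      filter_upwards [h3] with n hn
      have := abs_lt.1 hn
      simp only [hF]
      rw [indicator_of_mem (show y ∈ Ioc (-Real.pi * Real.sqrt (N n)) (Real.pi * Real.sqrt (N n))
        from ⟨by linarith [this.1], this.2.le⟩)]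
  refine ((hlim.const_mul (2 * Real.pi)⁻¹).congr' (heq.mono fun n hn => hn.symm)).trans
    (le_of_eq ?_)
  congr 1
  have e : (fun y : ℝ => Real.cos (σ * y) * (3 * Real.exp (-(3 * z * τ) - τ * y ^ 2))) =
      fun y => 3 * Real.exp (-(3 * z * τ)) * (Real.cos (σ * y) * Real.exp (-τ * y ^ 2)) := by
    ext y
    rw [sub_eq_add_neg, Real.exp_add, neg_mul]; ring
  rw [e, integral_const_mul, integral_cos_mul_gaussian hτ, h3, if_pos ⟨hτ, hz⟩, sub_eq_add_neg,
    Real.exp_add, Real.sqrt_div hπ.le, Real.sqrt_mul hπ.le, ← neg_div,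
    show -(3 * z * τ) = -3 * z * τ by ring]
  have hs1 : Real.sqrt Real.pi ≠ 0 := (Real.sqrt_pos.2 hπ).ne'
  have hs2 : Real.sqrt τ ≠ 0 := (Real.sqrt_pos.2 hτ).ne'
  have hs3 : Real.pi = Real.sqrt Real.pi * Real.sqrt Real.pi := (Real.mul_self_sqrt hπ.le).symm
  field_simp
  rw [Real.sq_sqrt hπ.le]

end LocalLimit

/-! ### Riemann sums as integrals of step functions -/

section Tools

/-- Dominated convergence with varying dominating functions, whose integrals converge. -/
lemma tendsto_lintegral_of_dominated_tendsto {X : Type*} [MeasurableSpace X] {μ : Measure X}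
    {f g : ℕ → X → ℝ≥0∞} {f₀ g₀ : X → ℝ≥0∞} (hf : ∀ n, Measurable (f n))
    (hg : ∀ n, Measurable (g n)) (hg₀ : Measurable g₀) (hfg : ∀ n, ∀ᵐ x ∂μ, f n x ≤ g n x)
    (hflim : ∀ᵐ x ∂μ, Tendsto (fun n => f n x) atTop (𝓝 (f₀ x)))
    (hglim : ∀ᵐ x ∂μ, Tendsto (fun n => g n x) atTop (𝓝 (g₀ x)))
    (hfin : ∫⁻ x, g₀ x ∂μ ≠ ∞)
    (hint : Tendsto (fun n => ∫⁻ x, g n x ∂μ) atTop (𝓝 (∫⁻ x, g₀ x ∂μ))) :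
    Tendsto (fun n => ∫⁻ x, f n x ∂μ) atTop (𝓝 (∫⁻ x, f₀ x ∂μ)) := by
  have hle : ∀ᵐ x ∂μ, f₀ x ≤ g₀ x := by
    filter_upwards [hflim, hglim, ae_all_iff.2 hfg] with x h1 h2 h3
    exact le_of_tendsto_of_tendsto' h1 h2 h3
  have hfmin : Tendsto (fun n => ∫⁻ x, min (f n x) (g₀ x) ∂μ) atTop (𝓝 (∫⁻ x, f₀ x ∂μ)) := by
    refine tendsto_lintegral_of_dominated_convergence g₀ (fun n => (hf n).min hg₀)
      (fun n => Eventually.of_forall fun x => min_le_right _ _) hfin ?_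
    filter_upwards [hflim, hle] with x h1 h2
    have := h1.min (tendsto_const_nhds (x := g₀ x))
    rwa [min_eq_left h2] at this
  have hgmin : Tendsto (fun n => ∫⁻ x, min (g n x) (g₀ x) ∂μ) atTop (𝓝 (∫⁻ x, g₀ x ∂μ)) := by
    refine tendsto_lintegral_of_dominated_convergence g₀ (fun n => (hg n).min hg₀)
      (fun n => Eventually.of_forall fun x => min_le_right _ _) hfin ?_
    filter_upwards [hglim] with x h1
    have := h1.min (tendsto_const_nhds (x := g₀ x))
    rwa [min_self] at this
  -- the excess of `g n` over `g₀` is negligible, hence so is the excess of `f n`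
  have hgex : Tendsto (fun n => ∫⁻ x, g n x - g₀ x ∂μ) atTop (𝓝 0) := by
    have h1 := ENNReal.Tendsto.sub hint hgmin (Or.inl hfin)
    rw [tsub_self] at h1
    refine h1.congr fun n => ?_
    have h2 : ∫⁻ x, g n x ∂μ = ∫⁻ x, g n x - g₀ x ∂μ + ∫⁻ x, min (g n x) (g₀ x) ∂μ := by
      rw [← lintegral_add_right _ ((hg n).min hg₀)]
      simp only [tsub_add_min]
    rw [h2]
    refine ENNReal.add_sub_cancel_right (ne_top_of_le_ne_top hfin ?_)
    exact lintegral_mono fun x => min_le_right _ _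
  have hfex : Tendsto (fun n => ∫⁻ x, f n x - g₀ x ∂μ) atTop (𝓝 0) := by
    refine tendsto_of_tendsto_of_tendsto_of_le_of_le tendsto_const_nhds hgex (fun _ => zero_le) ?_
    intro n
    refine lintegral_mono_ae ((hfg n).mono fun x hx => tsub_le_tsub_right hx _)
  have h3 := hfex.add hfmin
  rw [zero_add] at h3
  refine h3.congr fun n => ?_
  rw [← lintegral_add_right _ ((hf n).min hg₀)]
  simp only [tsub_add_min]

lemma lintegral_comp_floor (f : ℤ → ℝ≥0∞) {N : ℝ} (hN : 0 < N) :
    ∫⁻ w : ℝ, f ⌊N * w⌋ = ENNReal.ofReal N⁻¹ * ∑' k, f k := by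
  have hm : Measurable fun x : ℝ => f ⌊x⌋ := (measurable_of_countable f).comp Int.measurable_floor
  have h1 : ∫⁻ x : ℝ, f ⌊x⌋ = ∑' k, f k := by
    rw [← setLIntegral_univ, ← iUnion_Ico_intCast ℝ, lintegral_iUnion
      (fun _ => measurableSet_Ico) (pairwise_disjoint_Ico_intCast ℝ)]
    refine tsum_congr fun k => ?_
    rw [setLIntegral_congr_fun measurableSet_Ico (g := fun _ => f k)
      (fun x hx => by rw [Int.floor_eq_iff.2 ⟨hx.1, hx.2⟩])]
    simp
  have h2 := lintegral_map (μ := volume) hm (measurable_const_mul N)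
  rw [← h2, Real.map_volume_mul_left hN.ne', lintegral_smul_measure, h1,
    abs_of_pos (inv_pos.2 hN), smul_eq_mul]

lemma sum_Icc_sub_eq_tsum (f : ℤ → ℝ≥0∞) (j m : ℤ) :
    ∑ s ∈ Finset.Icc 1 m, f (s - j) =
      ∑' r, if 1 ≤ r + j ∧ r + j ≤ m then f r else 0 := by
  have e : ∑' s : ℤ, (if 1 ≤ s - j + j ∧ s - j + j ≤ m then f (s - j) else 0) = _ :=
    (Equiv.subRight j).tsum_eq (fun r => if 1 ≤ r + j ∧ r + j ≤ m then f r else 0)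
  rw [← e, tsum_eq_sum (s := Finset.Icc 1 m)]
  · refine Finset.sum_congr rfl fun s hs => ?_
    rw [sub_add_cancel, if_pos (Finset.mem_Icc.1 hs)]
  · intro s hs
    rw [sub_add_cancel, if_neg (by simpa [Finset.mem_Icc] using hs)]

lemma sum_Icc_sub_eq_lintegral (f : ℤ → ℝ≥0∞) (j m : ℤ) {N : ℝ} (hN : 0 < N) :
    ∑ s ∈ Finset.Icc 1 m, f (s - j) = ENNReal.ofReal N *
      ∫⁻ w : ℝ, if 1 ≤ ⌊N * w⌋ + j ∧ ⌊N * w⌋ + j ≤ m then f ⌊N * w⌋ else 0 := by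
  rw [lintegral_comp_floor (fun r => if 1 ≤ r + j ∧ r + j ≤ m then f r else 0) hN, ← mul_assoc,
    ← ENNReal.ofReal_mul hN.le, mul_inv_cancel₀ hN.ne', ENNReal.ofReal_one, one_mul,
    sum_Icc_sub_eq_tsum]

lemma tendsto_floor_mul_div {L : ℕ → ℝ} (hL : Tendsto L atTop atTop) (v : ℝ) :
    Tendsto (fun n => (⌊L n * v⌋ : ℝ) / L n) atTop (𝓝 v) := by
  have h1 : Tendsto (fun n => v - 1 / L n) atTop (𝓝 v) := by
    simpa using (tendsto_const_nhds (x := (1 : ℝ)).div_atTop hL).const_sub v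
  refine tendsto_of_tendsto_of_tendsto_of_le_of_le' h1 tendsto_const_nhds ?_ ?_
  · filter_upwards [hL.eventually_gt_atTop 0] with n hn
    rw [le_div_iff₀ hn, sub_mul, one_div_mul_cancel hn.ne']
    linarith [Int.lt_floor_add_one (L n * v)]
  · filter_upwards [hL.eventually_gt_atTop 0] with n hn
    rw [div_le_iff₀ hn]
    linarith [Int.floor_le (L n * v)]

lemma eventually_mem_Icc_iff {L : ℕ → ℝ} (hL : Tendsto L atTop atTop) {i : ℕ → ℤ} {r x : ℝ}
    (hi : Tendsto (fun n => (i n : ℝ) / L n) atTop (𝓝 r)) (h0 : r ≠ 0) (hx : r ≠ x) :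
    ∀ᶠ n in atTop, (1 ≤ i n ∧ i n ≤ ⌊L n * x⌋) ↔ r ∈ Ioc 0 x := by
  have hpos := hL.eventually_gt_atTop 0
  rcases h0.lt_or_gt with h | h
  · filter_upwards [hi.eventually_lt_const h, hpos] with n hn hp
    have : (i n : ℝ) < 0 := by rwa [div_lt_iff₀ hp, zero_mul] at hn
    have h1 : i n < 0 := by exact_mod_cast this
    exact iff_of_false (fun h => by omega) (fun h => by linarith [h.1])
  have hge : ∀ᶠ n in atTop, 1 ≤ i n := by
    filter_upwards [hi.eventually_const_lt h, hpos] with n hn hp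
    have : (0 : ℝ) < (i n : ℝ) := by rwa [lt_div_iff₀ hp, zero_mul] at hn
    have h1 : 0 < i n := by exact_mod_cast this
    omega
  rcases hx.lt_or_gt with h' | h'
  · filter_upwards [hge, hi.eventually_lt_const h', hpos] with n h1 hn hp
    rw [div_lt_iff₀ hp, mul_comm] at hn
    exact iff_of_true ⟨h1, Int.le_floor.2 hn.le⟩ ⟨h, h'.le⟩
  · filter_upwards [hi.eventually_const_lt h', hpos] with n hn hp
    rw [lt_div_iff₀ hp, mul_comm] at hn
    refine iff_of_false (fun h => ?_) (fun h => by linarith [h.2])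
    linarith [Int.le_floor.1 h.2]

end Tools

section Levels

/-- The lattice Green function with values in `[0, ∞]`. -/
def greenE (t s : ℤ) (a : ℝ) : ℝ≥0∞ :=
  ∑' k, ENNReal.ofReal (a ^ k) * ENNReal.ofReal (walkProb k t s)

lemma greenE_eq {a : ℝ} (ha : 0 ≤ a) (ha1 : a < 1) (t s : ℤ) :
    greenE t s a = ENNReal.ofReal (green3 t s a) := (ofReal_green3 ha ha1 t s).symm

lemma measurable_greenE : Measurable fun q : ℤ × ℤ × ℝ => greenE q.1 q.2.1 q.2.2 := by
  refine measurable_from_prod_countable_right fun t => measurable_from_prod_countable_right fun s =>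
    Measurable.tsum fun k => ?_
  fun_prop

lemma greenE_of_neg {t : ℤ} (ht : t < 0) (s : ℤ) (a : ℝ) : greenE t s a = 0 := by
  simp [greenE, walkProb_of_neg _ ht]

/-- The contribution of a vertical line to a partial sum of the Green function, in rescaled
coordinates: `c ∑_{1 ≤ s ≤ m} g₃(⌊N w⌋, s - ⌊L v⌋, 1 - z / N)`. -/
def levelSum (N L c : ℝ) (m : ℤ) (w v z : ℝ) : ℝ≥0∞ :=
  ENNReal.ofReal c * ∑ s ∈ Finset.Icc 1 m, greenE ⌊N * w⌋ (s - ⌊L * v⌋) (1 - z / N)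

/-- A partial sum of the Green function in rescaled coordinates:
`(c / N) ∑_{1 ≤ t ≤ l, 1 ≤ s ≤ m} g₃(t - ⌊λ u⌋, s - ⌊L v⌋, 1 - z / N)`. -/
def rectSum (lam N L c : ℝ) (l m : ℤ) (u v z : ℝ) : ℝ≥0∞ :=
  ENNReal.ofReal (c / N) * ∑ t ∈ Finset.Icc 1 l, ∑ s ∈ Finset.Icc 1 m,
    greenE (t - ⌊lam * u⌋) (s - ⌊L * v⌋) (1 - z / N)

/-- The limit of `levelSum`, for the increment over a set `J` of heights. The parameters
`ρ', ε ∈ {0, 1}` distinguish the scaling regimes: with `ε = 1` the limit is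
`∫ 1(ρ' s + v ∈ J) h₃(w, s, z) ds`, with `ρ' = 1`, `ε = 0` it is `|J| h₃(w, v, z)`. -/
def limitLevel (ρ' ε : ℝ) (J : Set ℝ) (w v z : ℝ) : ℝ≥0∞ :=
  ∫⁻ s, J.indicator 1 (ρ' * s + ε * v) * ENNReal.ofReal (h3 w (ε * s + (1 - ε) * v) z)

/-- The limit of `rectSum`, for the increment over the rectangle `I × J`. -/
def limitRect (ρ ρ' ε : ℝ) (I J : Set ℝ) (e : ℝ × ℝ × ℝ) : ℝ≥0∞ :=
  ∫⁻ w, I.indicator 1 (ρ * w + e.1) * limitLevel ρ' ε J w e.2.1 e.2.2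

lemma rectSum_eq_lintegral (lam L c : ℝ) {N : ℝ} (hN : 0 < N) (hc : 0 ≤ c) (l m : ℤ)
    (u v z : ℝ) :
    rectSum lam N L c l m u v z = ∫⁻ w : ℝ,
      if 1 ≤ ⌊N * w⌋ + ⌊lam * u⌋ ∧ ⌊N * w⌋ + ⌊lam * u⌋ ≤ l then levelSum N L c m w v z else 0 := by
  rw [rectSum, sum_Icc_sub_eq_lintegral
    (fun k => ∑ s ∈ Finset.Icc 1 m, greenE k (s - ⌊L * v⌋) (1 - z / N)) _ _ hN, ← mul_assoc,
    ← ENNReal.ofReal_mul (by positivity), div_mul_cancel₀ _ hN.ne', ← lintegral_const_mul']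
  · refine lintegral_congr fun w => ?_
    rw [mul_ite, mul_zero, levelSum]
  · exact ENNReal.ofReal_ne_top

lemma levelSum_of_neg {N L c : ℝ} {m : ℤ} {w v z : ℝ} (hN : 0 < N) (hw : w < 0) :
    levelSum N L c m w v z = 0 := by
  have : ⌊N * w⌋ < 0 := Int.floor_lt_zero.2 (mul_neg_of_pos_of_neg hN hw)
  simp [levelSum, greenE_of_neg this]

lemma intFloor_eq {N w : ℝ} (hN : 0 < N) (hw : 0 ≤ w) : ⌊N * w⌋ = ((⌊N * w⌋₊ : ℕ) : ℤ) :=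
  (Int.natCast_floor_eq_floor (by positivity)).symm

lemma tsum_greenE_floor {N w z : ℝ} (hN : 0 < N) (hz : 0 < z) (hzN : z ≤ N) (hw : 0 ≤ w) :
    ∑' s, greenE ⌊N * w⌋ s (1 - z / N) =
      ENNReal.ofReal (greenFourier ⌊N * w⌋₊ 0 (1 - z / N)) := by
  obtain ⟨h0, h1⟩ := scaled_param_mem hN hz hzN
  simp only [greenE_eq h0 h1, intFloor_eq hN hw]
  exact tsum_green3 h0 h1 _

lemma levelSum_le_exp {N L z : ℝ} (m : ℤ) (w v : ℝ) (hN : 0 < N) (hz : 0 < z) (hzN : z ≤ N) :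
    levelSum N L 1 m w v z ≤
      (Ici 0).indicator (fun w => ENNReal.ofReal (9 * Real.exp (-(3 / 8 * z * w)))) w := by
  rcases lt_or_ge w 0 with hw | hw
  · rw [levelSum_of_neg hN hw]; exact zero_le
  rw [indicator_of_mem (mem_Ici.2 hw), levelSum, ENNReal.ofReal_one, one_mul, sum_Icc_sub_eq_tsum
    (fun s => greenE ⌊N * w⌋ s (1 - z / N))]
  calc _ ≤ ∑' s, greenE ⌊N * w⌋ s (1 - z / N) := ENNReal.tsum_le_tsum fun s => by
        split_ifs
        · exact le_rfl
        · exact zero_le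
    _ ≤ _ := by
        rw [tsum_greenE_floor hN hz hzN hw]
        exact ENNReal.ofReal_le_ofReal (mass_floor_le hN hz hzN)

lemma greenE_floor_le {N w z : ℝ} (hN : 0 < N) (hz : 0 < z) (hzN : z ≤ N) (hw : 0 < w) (s : ℤ) :
    ENNReal.ofReal (Real.sqrt N) * greenE ⌊N * w⌋ s (1 - z / N) ≤
      ENNReal.ofReal (9 / Real.sqrt w * Real.exp (-(3 / 8 * z * w))) := by
  obtain ⟨h0, h1⟩ := scaled_param_mem hN hz hzN
  rw [greenE_eq h0 h1, intFloor_eq hN hw.le, ← ENNReal.ofReal_mul (Real.sqrt_nonneg _)]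
  exact ENNReal.ofReal_le_ofReal (sqrt_mul_green3_floor_le hN hz hzN hw s)

lemma levelSum_le_sqrt {N L c z Y : ℝ} {m : ℤ} {w : ℝ} (v : ℝ) (hN : 0 < N) (hz : 0 < z)
    (hzN : z ≤ N) (hw : w ≠ 0) (hm : 0 ≤ m) (hc : 0 ≤ c) (hY : c * m / Real.sqrt N ≤ Y) :
    levelSum N L c m w v z ≤ ENNReal.ofReal Y * (Ioi 0).indicator
      (fun w => ENNReal.ofReal (9 / Real.sqrt w * Real.exp (-(3 / 8 * z * w)))) w := by
  rcases hw.lt_or_gt with hw | hw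
  · rw [levelSum_of_neg hN hw]; exact zero_le
  have hsN : 0 < Real.sqrt N := Real.sqrt_pos.2 hN
  rw [indicator_of_mem (mem_Ioi.2 hw), levelSum]
  set B := ENNReal.ofReal (9 / Real.sqrt w * Real.exp (-(3 / 8 * z * w)))
  have h1 : ∀ s, greenE ⌊N * w⌋ s (1 - z / N) ≤ ENNReal.ofReal (Real.sqrt N)⁻¹ * B := by
    intro s
    have := mul_le_mul_right (greenE_floor_le hN hz hzN hw s) (ENNReal.ofReal (Real.sqrt N)⁻¹)
    rwa [← mul_assoc, ← ENNReal.ofReal_mul (by positivity), inv_mul_cancel₀ hsN.ne',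
      ENNReal.ofReal_one, one_mul] at this
  calc ENNReal.ofReal c * ∑ s ∈ Finset.Icc 1 m, greenE ⌊N * w⌋ (s - ⌊L * v⌋) (1 - z / N)
      ≤ ENNReal.ofReal c * ∑ s ∈ Finset.Icc 1 m, ENNReal.ofReal (Real.sqrt N)⁻¹ * B := by
        gcongr
        exact h1 _
    _ = ENNReal.ofReal (c * m / Real.sqrt N) * B := by
        have h2 : (((m + 1 - 1).toNat : ℕ) : ℝ≥0∞) = ENNReal.ofReal m := by
          rw [← ENNReal.ofReal_natCast, add_sub_cancel_right]
          congr 1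
          exact_mod_cast Int.toNat_of_nonneg hm
        rw [Finset.sum_const, Int.card_Icc, nsmul_eq_mul, h2, ← mul_assoc, ← mul_assoc,
          ← ENNReal.ofReal_mul hc, ← ENNReal.ofReal_mul (mul_nonneg hc (by exact_mod_cast hm)),
          div_eq_mul_inv]
    _ ≤ ENNReal.ofReal Y * B := by gcongr

lemma h3_of_nonpos {w : ℝ} (hw : w ≤ 0) (s z : ℝ) : h3 w s z = 0 := by
  rw [h3, if_neg (fun h => by linarith [h.1])]

lemma h3_nonneg (w s z : ℝ) : 0 ≤ h3 w s z := by
  unfold h3; split_ifs <;> positivity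

lemma h3_pos {w z : ℝ} (hw : 0 < w) (hz : 0 < z) (s : ℝ) : 0 < h3 w s z := by
  unfold h3; rw [if_pos ⟨hw, hz⟩]; have := Real.pi_pos; positivity

lemma h3_neg (w s z : ℝ) : h3 w (-s) z = h3 w s z := by
  unfold h3; rw [neg_sq]

lemma measurable_h3 : Measurable fun q : ℝ × ℝ × ℝ => h3 q.1 q.2.1 q.2.2 := by
  unfold h3
  refine Measurable.ite ?_ (by fun_prop) measurable_const
  exact (measurableSet_lt measurable_const measurable_fst).inter
    (measurableSet_lt measurable_const measurable_snd.snd)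

lemma lintegral_h3 {w z : ℝ} (hw : 0 < w) (hz : 0 < z) :
    ∫⁻ s, ENNReal.ofReal (h3 w s z) = ENNReal.ofReal (3 * Real.exp (-(3 * z * w))) := by
  have hπ := Real.pi_pos
  have h1 : ∀ s, h3 w s z = 3 / (2 * Real.sqrt (Real.pi * w)) * Real.exp (-(3 * z * w)) *
      Real.exp (-(1 / (4 * w)) * s ^ 2) := by
    intro s
    rw [h3, if_pos ⟨hw, hz⟩, mul_assoc (3 / _), ← Real.exp_add]
    congr 2
    ring
  simp only [h1]
  have hint : Integrable fun s : ℝ => 3 / (2 * Real.sqrt (Real.pi * w)) *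
      Real.exp (-(3 * z * w)) * Real.exp (-(1 / (4 * w)) * s ^ 2) :=
    (integrable_exp_neg_mul_sq (by positivity)).const_mul _
  rw [← ofReal_integral_eq_lintegral_ofReal hint (Eventually.of_forall fun s => by positivity),
    integral_const_mul, integral_gaussian]
  congr 1
  have h2 : Real.pi / (1 / (4 * w)) = 2 ^ 2 * (Real.pi * w) := by field_simp; norm_num
  have h3 : 0 < Real.sqrt (Real.pi * w) := Real.sqrt_pos.2 (by positivity)
  rw [h2, Real.sqrt_mul (x := 2 ^ 2) (by norm_num), Real.sqrt_sq (by norm_num)]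
  field_simp

lemma tendsto_greenE_floor {N : ℕ → ℝ} (hN : Tendsto N atTop atTop) {s : ℕ → ℤ} {w σ z : ℝ}
    (hw : 0 < w) (hz : 0 < z) (hs : Tendsto (fun n => (s n : ℝ) / Real.sqrt (N n)) atTop (𝓝 σ)) :
    Tendsto (fun n => ENNReal.ofReal (Real.sqrt (N n)) * greenE ⌊N n * w⌋ (s n) (1 - z / N n)) atTop
      (𝓝 (ENNReal.ofReal (h3 w σ z))) := by
  have hk : Tendsto (fun n => ((⌊N n * w⌋₊ : ℕ) : ℝ) / N n) atTop (𝓝 w) := by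
    refine (tendsto_floor_mul_div hN w).congr' ?_
    filter_upwards [hN.eventually_gt_atTop 0] with n hn
    rw [intFloor_eq hn hw.le]; simp
  refine (ENNReal.tendsto_ofReal (tendsto_sqrt_mul_green3 hN hw hz hk hs)).congr' ?_
  filter_upwards [hN.eventually_gt_atTop 0, hN.eventually_ge_atTop z] with n hn hzN
  obtain ⟨h0, h1⟩ := scaled_param_mem hn hz hzN
  rw [greenE_eq h0 h1, intFloor_eq hn hw.le, ENNReal.ofReal_mul (Real.sqrt_nonneg _)]

/-- Convergence of the contribution of a vertical line, when the heights are summed on the scale of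
the walk (`ρ' = 1`) or on a larger scale (`ρ' = 0`). The total mass of the line serves to dominate
the sum. -/
lemma tendsto_levelSum_one {N L : ℕ → ℝ} (hN : Tendsto N atTop atTop) (hL : Tendsto L atTop atTop)
    {ρ' : ℝ} (hρ : Tendsto (fun n => Real.sqrt (N n) / L n) atTop (𝓝 ρ')) (hρ01 : ρ' = 1 ∨ ρ' = 0)
    {w v z y : ℝ} (hw : 0 < w) (hz : 0 < z) (hv : v ≠ 0 ∧ v ≠ y) :
    Tendsto (fun n => levelSum (N n) (L n) 1 ⌊L n * y⌋ w v z) atTop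
      (𝓝 (limitLevel ρ' 1 (Ioc 0 y) w v z)) := by
  have hsN : Tendsto (fun n => Real.sqrt (N n)) atTop atTop := Real.tendsto_sqrt_atTop.comp hN
  have hlev : ∀ n, 0 < N n → levelSum (N n) (L n) 1 ⌊L n * y⌋ w v z = ∫⁻ s : ℝ,
      if 1 ≤ ⌊Real.sqrt (N n) * s⌋ + ⌊L n * v⌋ ∧ ⌊Real.sqrt (N n) * s⌋ + ⌊L n * v⌋ ≤ ⌊L n * y⌋ then
      ENNReal.ofReal (Real.sqrt (N n)) * greenE ⌊N n * w⌋ ⌊Real.sqrt (N n) * s⌋ (1 - z / N n)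
      else 0 := by
    intro n hn
    rw [levelSum, ENNReal.ofReal_one, one_mul, sum_Icc_sub_eq_lintegral
      (fun s => greenE ⌊N n * w⌋ s (1 - z / N n)) _ _ (Real.sqrt_pos.2 hn), ← lintegral_const_mul']
    · simp only [mul_ite, mul_zero]
    · exact ENNReal.ofReal_ne_top
  have hev : ∀ᶠ n in atTop, 0 < N n ∧ z ≤ N n :=
    (hN.eventually_gt_atTop 0).and (hN.eventually_ge_atTop z)
  have hmeasg : ∀ n, Measurable fun s : ℝ => ENNReal.ofReal (Real.sqrt (N n)) *
      greenE ⌊N n * w⌋ ⌊Real.sqrt (N n) * s⌋ (1 - z / N n) := fun n =>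
    ((measurable_of_countable fun r => greenE ⌊N n * w⌋ r (1 - z / N n)).comp
      (Int.measurable_floor.comp (measurable_const_mul _))).const_mul _
  have hpt : ∀ s, Tendsto (fun n => ENNReal.ofReal (Real.sqrt (N n)) *
      greenE ⌊N n * w⌋ ⌊Real.sqrt (N n) * s⌋ (1 - z / N n)) atTop (𝓝 (ENNReal.ofReal (h3 w s z))) :=
    fun s => tendsto_greenE_floor hN hw hz (tendsto_floor_mul_div hsN s)
  have hae : ∀ᵐ s : ℝ, ρ' * s + v ≠ 0 ∧ ρ' * s + v ≠ y := by
    rcases hρ01 with rfl | rfl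
    · have : ∀ᵐ s : ℝ, s ∉ ({-v, y - v} : Set ℝ) :=
        measure_eq_zero_iff_ae_notMem.1 (Set.Finite.measure_zero (by simp) _)
      filter_upwards [this] with s hs
      simp only [mem_insert_iff, mem_singleton_iff, not_or] at hs
      exact ⟨fun h => hs.1 (by linarith), fun h => hs.2 (by linarith)⟩
    · exact Eventually.of_forall fun s => by simpa using hv
  have hmain := tendsto_lintegral_of_dominated_tendsto (μ := (volume : Measure ℝ))
    (f := fun n s => if 1 ≤ ⌊Real.sqrt (N n) * s⌋ + ⌊L n * v⌋ ∧
        ⌊Real.sqrt (N n) * s⌋ + ⌊L n * v⌋ ≤ ⌊L n * y⌋ then ENNReal.ofReal (Real.sqrt (N n)) *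
        greenE ⌊N n * w⌋ ⌊Real.sqrt (N n) * s⌋ (1 - z / N n) else 0)
    (g := fun n s => ENNReal.ofReal (Real.sqrt (N n)) *
        greenE ⌊N n * w⌋ ⌊Real.sqrt (N n) * s⌋ (1 - z / N n))
    (f₀ := fun s => (Ioc 0 y).indicator 1 (ρ' * s + 1 * v) *
      ENNReal.ofReal (h3 w (1 * s + (1 - 1) * v) z))
    (g₀ := fun s => ENNReal.ofReal (h3 w s z))
    (fun n => by
      refine Measurable.ite ?_ (hmeasg n) measurable_const
      have hfl : Measurable fun s : ℝ => ⌊Real.sqrt (N n) * s⌋ + ⌊L n * v⌋ :=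
        (Int.measurable_floor.comp (measurable_const_mul _)).add_const _
      exact (hfl (measurableSet_Ici (a := (1 : ℤ)))).inter
        (hfl (measurableSet_Iic (a := ⌊L n * y⌋))))
    hmeasg
    ((measurable_h3.comp (by fun_prop : Measurable fun s : ℝ => (w, s, z))).ennreal_ofReal)
    (fun n => Eventually.of_forall fun s => by
      split_ifs
      · exact le_rfl
      · exact zero_le)
    (by
      filter_upwards [hae] with s hs
      have hi : Tendsto (fun n => ((⌊Real.sqrt (N n) * s⌋ + ⌊L n * v⌋ : ℤ) : ℝ) / L n) atTop
          (𝓝 (ρ' * s + v)) := by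
        have h1 := ((tendsto_floor_mul_div hsN s).mul hρ).add (tendsto_floor_mul_div hL v)
        rw [mul_comm s] at h1
        refine h1.congr' ?_
        filter_upwards [hN.eventually_gt_atTop 0] with n hn
        have := (Real.sqrt_pos.2 hn).ne'
        push_cast
        field_simp
      have hiff := eventually_mem_Icc_iff hL hi hs.1 hs.2
      rw [one_mul, one_mul, sub_self, zero_mul, add_zero]
      by_cases hmem : ρ' * s + v ∈ Ioc 0 y
      · rw [indicator_of_mem hmem, Pi.one_apply, one_mul]
        refine (hpt s).congr' ?_
        filter_upwards [hiff] with n hn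
        rw [if_pos (hn.2 hmem)]
      · rw [indicator_of_notMem hmem, zero_mul]
        refine tendsto_const_nhds.congr' ?_
        filter_upwards [hiff] with n hn
        rw [if_neg (fun h => hmem (hn.1 h))])
    (Eventually.of_forall hpt)
    (by rw [lintegral_h3 hw hz]; exact ENNReal.ofReal_ne_top)
    (by
      rw [lintegral_h3 hw hz]
      have hk : Tendsto (fun n => ((⌊N n * w⌋₊ : ℕ) : ℝ) / N n) atTop (𝓝 w) := by
        refine (tendsto_floor_mul_div hN w).congr' ?_
        filter_upwards [hN.eventually_gt_atTop 0] with n hn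
        rw [intFloor_eq hn hw.le]; simp
      have h1 := tendsto_greenFourier hN hk z 0
      have h2 : 3 * Real.exp (-(3 * z * w) - w * 0 ^ 2) = 3 * Real.exp (-(3 * z * w)) := by simp
      rw [h2] at h1
      refine (ENNReal.tendsto_ofReal h1).congr' ?_
      filter_upwards [hev] with n ⟨hn, hzN⟩
      have hs := Real.sqrt_pos.2 hn
      rw [lintegral_const_mul' _ _ ENNReal.ofReal_ne_top,
        lintegral_comp_floor (fun r => greenE ⌊N n * w⌋ r (1 - z / N n)) hs, ← mul_assoc,
        ← ENNReal.ofReal_mul hs.le, mul_inv_cancel₀ hs.ne', ENNReal.ofReal_one, one_mul,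
        tsum_greenE_floor hn hz hzN hw.le, zero_div])
  refine hmain.congr' ?_
  filter_upwards [hev] with n hn
  rw [hlev n hn.1]

/-- Convergence of the contribution of a vertical line, when the heights are summed on a scale
smaller than that of the walk. -/
lemma tendsto_levelSum_zero {N K : ℕ → ℝ} (hN : Tendsto N atTop atTop) (hK : Tendsto K atTop atTop)
    (hρ : Tendsto (fun n => K n / Real.sqrt (N n)) atTop (𝓝 0))
    {w v z y : ℝ} (hw : 0 < w) (hz : 0 < z) :
    Tendsto (fun n => levelSum (N n) (Real.sqrt (N n)) (Real.sqrt (N n) / K n) ⌊K n * y⌋ w v z)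
      atTop (𝓝 (limitLevel 1 0 (Ioc 0 y) w v z)) := by
  have hsN : Tendsto (fun n => Real.sqrt (N n)) atTop atTop := Real.tendsto_sqrt_atTop.comp hN
  have hev : ∀ᶠ n in atTop, 0 < N n ∧ z ≤ N n ∧ 1 ≤ K n :=
    (hN.eventually_gt_atTop 0).and ((hN.eventually_ge_atTop z).and (hK.eventually_ge_atTop 1))
  have hlev : ∀ᶠ n in atTop, (∫⁻ s : ℝ, if 1 ≤ ⌊K n * s⌋ + 0 ∧ ⌊K n * s⌋ + 0 ≤ ⌊K n * y⌋ then
      ENNReal.ofReal (Real.sqrt (N n)) *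
        greenE ⌊N n * w⌋ (⌊K n * s⌋ - ⌊Real.sqrt (N n) * v⌋) (1 - z / N n) else 0) =
      levelSum (N n) (Real.sqrt (N n)) (Real.sqrt (N n) / K n) ⌊K n * y⌋ w v z := by
    filter_upwards [hev] with n ⟨hn, hzN, hKn⟩
    have h := sum_Icc_sub_eq_lintegral
      (fun s => greenE ⌊N n * w⌋ (s - ⌊Real.sqrt (N n) * v⌋) (1 - z / N n)) 0 ⌊K n * y⌋
      (by linarith : 0 < K n)
    simp only [sub_zero] at h
    rw [levelSum, h, ← mul_assoc, ← ENNReal.ofReal_mul (by positivity),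
      div_mul_cancel₀ _ (by linarith : K n ≠ 0), ← lintegral_const_mul' _ _ ENNReal.ofReal_ne_top]
    simp only [mul_ite, mul_zero]
  refine Tendsto.congr' hlev ?_
  unfold limitLevel
  refine tendsto_lintegral_filter_of_dominated_convergence ((Icc 0 (y + 1)).indicator fun _ =>
    ENNReal.ofReal (9 / Real.sqrt w * Real.exp (-(3 / 8 * z * w)))) ?_ ?_ ?_ ?_
  · refine Eventually.of_forall fun n => ?_
    have hfl : Measurable fun s : ℝ => ⌊K n * s⌋ := Int.measurable_floor.comp (measurable_const_mul _)
    exact (measurable_of_countable fun r : ℤ => if 1 ≤ r + 0 ∧ r + 0 ≤ ⌊K n * y⌋ then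
      ENNReal.ofReal (Real.sqrt (N n)) *
        greenE ⌊N n * w⌋ (r - ⌊Real.sqrt (N n) * v⌋) (1 - z / N n) else 0).comp hfl
  · filter_upwards [hev] with n ⟨hn, hzN, hKn⟩
    refine Eventually.of_forall fun s => ?_
    split_ifs with h
    · have hmem : s ∈ Icc 0 (y + 1) := by
        have hK0 : 0 < K n := by linarith
        simp only [add_zero] at h
        have h1 : (1 : ℝ) ≤ K n * s := by
          have := Int.le_floor.1 h.1
          simpa using this
        have h2 : K n * s < K n * y + 1 := by
          have h3 := Int.lt_floor_add_one (K n * s)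
          have h4 : (⌊K n * s⌋ : ℝ) ≤ ⌊K n * y⌋ := by exact_mod_cast h.2
          linarith [Int.floor_le (K n * y)]
        constructor
        · by_contra hneg
          nlinarith
        · by_contra hneg
          nlinarith
      rw [indicator_of_mem hmem]
      exact greenE_floor_le hn hz hzN hw _
    · exact zero_le
  · rw [lintegral_indicator measurableSet_Icc, setLIntegral_const]
    exact ENNReal.mul_ne_top ENNReal.ofReal_ne_top (by simp)
  · have hae : ∀ᵐ s : ℝ, s ∉ ({0, y} : Set ℝ) :=
      measure_eq_zero_iff_ae_notMem.1 (Set.Finite.measure_zero (by simp) _)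
    filter_upwards [hae] with s hs
    simp only [mem_insert_iff, mem_singleton_iff, not_or] at hs
    have hiff := eventually_mem_Icc_iff hK (tendsto_floor_mul_div hK s) hs.1 hs.2
    have hpt : Tendsto (fun n => ENNReal.ofReal (Real.sqrt (N n)) *
        greenE ⌊N n * w⌋ (⌊K n * s⌋ - ⌊Real.sqrt (N n) * v⌋) (1 - z / N n)) atTop
        (𝓝 (ENNReal.ofReal (h3 w v z))) := by
      rw [← h3_neg]
      refine tendsto_greenE_floor hN hw hz ?_
      have h1 := ((tendsto_floor_mul_div hK s).mul hρ).sub (tendsto_floor_mul_div hsN v)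
      rw [mul_zero, zero_sub] at h1
      refine h1.congr' ?_
      filter_upwards [hev] with n ⟨hn, hzN, hKn⟩
      have h2 := (Real.sqrt_pos.2 hn).ne'
      have h3 : K n ≠ 0 := by linarith
      push_cast
      field_simp
    simp only [one_mul, zero_mul, sub_zero, zero_add, add_zero]
    by_cases hmem : s ∈ Ioc 0 y
    · rw [indicator_of_mem hmem, Pi.one_apply, one_mul]
      refine hpt.congr' ?_
      filter_upwards [hiff] with n hn
      rw [if_pos (hn.2 hmem)]
    · rw [indicator_of_notMem hmem, zero_mul]
      refine tendsto_const_nhds.congr' ?_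
      filter_upwards [hiff] with n hn
      rw [if_neg (fun h => hmem (hn.1 h))]

end Levels

/-! ### Measurability and total mass of the partial sums -/

section Measurability

lemma measurable_rectSum (lam N L c : ℝ) (l m : ℤ) :
    Measurable fun e : ℝ × ℝ × ℝ => rectSum lam N L c l m e.1 e.2.1 e.2.2 := by
  unfold rectSum
  refine Measurable.const_mul (Finset.measurable_sum _ fun t _ =>
    Finset.measurable_sum _ fun s _ => ?_) _
  have h1 : Measurable fun e : ℝ × ℝ × ℝ => t - ⌊lam * e.1⌋ :=
    (Int.measurable_floor.comp (measurable_fst.const_mul lam)).const_sub t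
  have h2 : Measurable fun e : ℝ × ℝ × ℝ => s - ⌊L * e.2.1⌋ :=
    (Int.measurable_floor.comp (measurable_snd.fst.const_mul L)).const_sub s
  exact measurable_greenE.comp (h1.prodMk (h2.prodMk
    (measurable_const.sub (measurable_snd.snd.div_const N))))

lemma measurable_levelSum (N L c : ℝ) (m : ℤ) (v z : ℝ) :
    Measurable fun w => levelSum N L c m w v z := by
  unfold levelSum
  refine Measurable.const_mul (Finset.measurable_sum _ fun s _ => ?_) _
  exact (measurable_of_countable fun k : ℤ => greenE k (s - ⌊L * v⌋) (1 - z / N)).comp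
    (Int.measurable_floor.comp (measurable_const_mul N))

lemma measurable_h3_right (w z : ℝ) : Measurable fun s => ENNReal.ofReal (h3 w s z) :=
  (measurable_h3.comp (by fun_prop : Measurable fun s : ℝ => (w, s, z))).ennreal_ofReal

lemma measurable_limitLevel {J : Set ℝ} (hJ : MeasurableSet J) (ρ' ε : ℝ) :
    Measurable fun q : ℝ × ℝ × ℝ => limitLevel ρ' ε J q.1 q.2.1 q.2.2 := by
  unfold limitLevel
  refine Measurable.lintegral_prod_right'
    (f := fun q : (ℝ × ℝ × ℝ) × ℝ => J.indicator (1 : ℝ → ℝ≥0∞) (ρ' * q.2 + ε * q.1.2.1) *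
      ENNReal.ofReal (h3 q.1.1 (ε * q.2 + (1 - ε) * q.1.2.1) q.1.2.2)) ?_
  refine Measurable.mul ?_ ?_
  · exact ((measurable_const (a := (1 : ℝ≥0∞))).indicator hJ).comp (by fun_prop)
  · exact (measurable_h3.comp (by fun_prop : Measurable fun q : (ℝ × ℝ × ℝ) × ℝ =>
      (q.1.1, ε * q.2 + (1 - ε) * q.1.2.1, q.1.2.2))).ennreal_ofReal

lemma measurable_limitRect {I J : Set ℝ} (hI : MeasurableSet I) (hJ : MeasurableSet J)
    (ρ ρ' ε : ℝ) : Measurable (limitRect ρ ρ' ε I J) := by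
  unfold limitRect
  refine Measurable.lintegral_prod_right'
    (f := fun q : (ℝ × ℝ × ℝ) × ℝ => I.indicator (1 : ℝ → ℝ≥0∞) (ρ * q.2 + q.1.1) *
      limitLevel ρ' ε J q.2 q.1.2.1 q.1.2.2) ?_
  refine Measurable.mul ?_ ?_
  · exact ((measurable_const (a := (1 : ℝ≥0∞))).indicator hI).comp (by fun_prop)
  · exact (measurable_limitLevel hJ ρ' ε).comp (by fun_prop : Measurable
      fun q : (ℝ × ℝ × ℝ) × ℝ => (q.2, q.1.2.1, q.1.2.2))

lemma limitLevel_of_nonpos {ρ' ε : ℝ} {J : Set ℝ} {w v z : ℝ} (hw : w ≤ 0) :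
    limitLevel ρ' ε J w v z = 0 := by
  simp [limitLevel, h3_of_nonpos hw]

/-- Integration over `ℝ × ℝ × ℝ` with the last variable outermost. -/
lemma lintegral_triple {f : ℝ × ℝ × ℝ → ℝ≥0∞} (hf : Measurable f) :
    ∫⁻ e, f e = ∫⁻ z, ∫⁻ u, ∫⁻ v, f (u, v, z) := by
  rw [Measure.volume_eq_prod, lintegral_prod _ hf.aemeasurable]
  have h1 : ∀ u, ∫⁻ q : ℝ × ℝ, f (u, q) = ∫⁻ z, ∫⁻ v, f (u, v, z) := by
    intro u
    have hu : Measurable fun q : ℝ × ℝ => f (u, q) := hf.comp measurable_prodMk_left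
    rw [Measure.volume_eq_prod, lintegral_prod_symm _ hu.aemeasurable]
  simp only [h1]
  refine lintegral_lintegral_swap (f := fun u z => ∫⁻ v, f (u, v, z)) ?_
  refine Measurable.aemeasurable ?_
  exact Measurable.lintegral_prod_right' (f := fun q : (ℝ × ℝ) × ℝ => f (q.1.1, q.2, q.1.2))
    (hf.comp (by fun_prop))

end Measurability

section Mass

lemma lintegral_comp_sub_floor (f : ℤ → ℝ≥0∞) {L : ℝ} (hL : 0 < L) (t : ℤ) :
    ∫⁻ u : ℝ, f (t - ⌊L * u⌋) = ENNReal.ofReal L⁻¹ * ∑' k, f k := by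
  rw [lintegral_comp_floor (fun k => f (t - k)) hL]
  congr 1
  exact (Equiv.subLeft t).tsum_eq f

lemma tsum_tsum_greenE {N z : ℝ} (hN : 0 < N) (hz : 0 < z) (hzN : z ≤ N) :
    ∑' t, ∑' s, greenE t s (1 - z / N) = ENNReal.ofReal (N / z) := by
  obtain ⟨h0, h1⟩ := scaled_param_mem hN hz hzN
  simp only [greenE_eq h0 h1]
  rw [tsum_tsum_green3 h0 h1]
  congr 1
  rw [sub_sub_cancel, inv_div]

lemma lintegral_rectSum {lam N L c z : ℝ} (hlam : 0 < lam) (hN : 0 < N) (hL : 0 < L) (hc : 0 ≤ c)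
    {l m : ℤ} (hl : 0 ≤ l) (hm : 0 ≤ m) (hz : 0 < z) (hzN : z ≤ N) :
    ∫⁻ u, ∫⁻ v, rectSum lam N L c l m u v z =
      ENNReal.ofReal (l / lam * (c * m / L) / z) := by
  have hv : ∀ u, ∫⁻ v, rectSum lam N L c l m u v z = ENNReal.ofReal (c / N) *
      ∑ t ∈ Finset.Icc 1 l, ∑ s ∈ Finset.Icc 1 m,
        ENNReal.ofReal L⁻¹ * ∑' k, greenE (t - ⌊lam * u⌋) k (1 - z / N) := by
    intro u
    have hmeas : ∀ t s : ℤ, Measurable fun v : ℝ =>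
        greenE (t - ⌊lam * u⌋) (s - ⌊L * v⌋) (1 - z / N) := fun t s =>
      (measurable_of_countable fun k : ℤ => greenE (t - ⌊lam * u⌋) (s - k) (1 - z / N)).comp
        (Int.measurable_floor.comp (measurable_const_mul L))
    unfold rectSum
    rw [lintegral_const_mul' _ _ ENNReal.ofReal_ne_top, lintegral_finsetSum' _
      fun t _ => (Finset.measurable_sum _ fun s _ => hmeas t s).aemeasurable]
    congr 1
    refine Finset.sum_congr rfl fun t _ => ?_
    rw [lintegral_finsetSum' _ fun s _ => (hmeas t s).aemeasurable]
    refine Finset.sum_congr rfl fun s _ => ?_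
    exact lintegral_comp_sub_floor (fun k => greenE (t - ⌊lam * u⌋) k (1 - z / N)) hL s
  have hcard : ∀ {m : ℤ}, 0 ≤ m → (((m + 1 - 1).toNat : ℕ) : ℝ≥0∞) = ENNReal.ofReal m := by
    intro m hm
    rw [← ENNReal.ofReal_natCast, add_sub_cancel_right]
    congr 1
    exact_mod_cast Int.toNat_of_nonneg hm
  have hl' : (0 : ℝ) ≤ l := by exact_mod_cast hl
  have hm' : (0 : ℝ) ≤ m := by exact_mod_cast hm
  simp only [hv, Finset.sum_const, Int.card_Icc, nsmul_eq_mul, hcard hm]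
  have hmeas : ∀ t : ℤ, Measurable fun u : ℝ =>
      ∑' k, greenE (t - ⌊lam * u⌋) k (1 - z / N) := fun t =>
    (measurable_of_countable fun j : ℤ => ∑' k, greenE (t - j) k (1 - z / N)).comp
      (Int.measurable_floor.comp (measurable_const_mul lam))
  rw [lintegral_const_mul' _ _ ENNReal.ofReal_ne_top, lintegral_finsetSum' _
    fun t _ => (((hmeas t).const_mul _).const_mul _).aemeasurable]
  have hu : ∀ t : ℤ, ∫⁻ u : ℝ, ENNReal.ofReal m * (ENNReal.ofReal L⁻¹ *
      ∑' k, greenE (t - ⌊lam * u⌋) k (1 - z / N)) = ENNReal.ofReal m * (ENNReal.ofReal L⁻¹ *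
        (ENNReal.ofReal lam⁻¹ * ENNReal.ofReal (N / z))) := by
    intro t
    rw [lintegral_const_mul' _ _ ENNReal.ofReal_ne_top,
      lintegral_const_mul' _ _ ENNReal.ofReal_ne_top,
      lintegral_comp_sub_floor (fun j => ∑' k, greenE j k (1 - z / N)) hlam,
      tsum_tsum_greenE hN hz hzN]
  simp only [hu, Finset.sum_const, Int.card_Icc, nsmul_eq_mul, hcard hl]
  rw [← ENNReal.ofReal_mul (by positivity), ← ENNReal.ofReal_mul (by positivity),
    ← ENNReal.ofReal_mul hm', ← ENNReal.ofReal_mul hl', ← ENNReal.ofReal_mul (by positivity)]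
  congr 1
  field_simp

lemma lintegral_indicator_one_comp_mul_add {J : Set ℝ} (hJ : MeasurableSet J) (b : ℝ) :
    ∫⁻ v : ℝ, J.indicator (1 : ℝ → ℝ≥0∞) (b + v) = volume J := by
  rw [lintegral_add_left_eq_self (fun v => J.indicator (1 : ℝ → ℝ≥0∞) v) b]
  exact lintegral_indicator_one hJ

/-- The total mass of a vertical line in the limit. -/
lemma lintegral_limitLevel {ρ' ε : ℝ} (h : ε = 1 ∨ (ρ' = 1 ∧ ε = 0)) {J : Set ℝ}
    (hJ : MeasurableSet J) {w z : ℝ} (hw : 0 < w) (hz : 0 < z) :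
    ∫⁻ v, limitLevel ρ' ε J w v z = volume J * ENNReal.ofReal (3 * Real.exp (-(3 * z * w))) := by
  unfold limitLevel
  rw [lintegral_lintegral_swap]
  · rcases h with rfl | ⟨rfl, rfl⟩
    · simp only [one_mul, sub_self, zero_mul, add_zero]
      rw [← lintegral_h3 hw hz, ← lintegral_const_mul _ (measurable_h3_right w z)]
      refine lintegral_congr fun s => ?_
      rw [lintegral_mul_const' _ _ ENNReal.ofReal_ne_top,
        lintegral_indicator_one_comp_mul_add hJ]
    · simp only [one_mul, zero_mul, add_zero, zero_add, sub_zero]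
      have h1 : ∀ s : ℝ, ∫⁻ v, J.indicator (1 : ℝ → ℝ≥0∞) s * ENNReal.ofReal (h3 w v z) =
          J.indicator (1 : ℝ → ℝ≥0∞) s * ENNReal.ofReal (3 * Real.exp (-(3 * z * w))) := by
        intro s
        rw [lintegral_const_mul _ (measurable_h3_right w z), lintegral_h3 hw hz]
      simp only [h1]
      rw [lintegral_mul_const' _ _ ENNReal.ofReal_ne_top, lintegral_indicator_one hJ]
  · refine Measurable.aemeasurable (Measurable.mul ?_ ?_)
    · exact ((measurable_const (a := (1 : ℝ≥0∞))).indicator hJ).comp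
        (by fun_prop : Measurable fun q : ℝ × ℝ => ρ' * q.2 + ε * q.1)
    · exact (measurable_h3.comp (by fun_prop : Measurable fun q : ℝ × ℝ =>
        (w, ε * q.2 + (1 - ε) * q.1, z))).ennreal_ofReal

lemma lintegral_exp_neg_mul {b : ℝ} (hb : 0 < b) {C : ℝ} (hC : 0 ≤ C) :
    ∫⁻ w in Ioi (0 : ℝ), ENNReal.ofReal (C * Real.exp (-(b * w))) = ENNReal.ofReal (C / b) := by
  have h := integral_exp_mul_Ioi (a := -b) (by linarith) 0
  have hi := integrableOn_exp_mul_Ioi (a := -b) (by linarith) 0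
  simp only [neg_mul] at h hi
  rw [← ofReal_integral_eq_lintegral_ofReal (hi.const_mul C)
    (Eventually.of_forall fun w => by positivity), integral_const_mul, h]
  congr 1
  simp [div_eq_mul_inv]

lemma lintegral_limitRect {ρ ρ' ε : ℝ} (h : ε = 1 ∨ (ρ' = 1 ∧ ε = 0)) {I J : Set ℝ}
    (hI : MeasurableSet I) (hJ : MeasurableSet J) {z : ℝ} (hz : 0 < z) :
    ∫⁻ u, ∫⁻ v, limitRect ρ ρ' ε I J (u, v, z) = volume I * volume J * ENNReal.ofReal z⁻¹ := by
  have hlev := measurable_limitLevel hJ ρ' ε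
  have hind : Measurable (I.indicator (1 : ℝ → ℝ≥0∞)) := measurable_one.indicator hI
  have h1 : ∀ u, ∫⁻ v, limitRect ρ ρ' ε I J (u, v, z) = ∫⁻ w in Ioi 0,
      I.indicator 1 (ρ * w + u) * (volume J * ENNReal.ofReal (3 * Real.exp (-(3 * z * w)))) := by
    intro u
    unfold limitRect
    rw [lintegral_lintegral_swap, ← lintegral_indicator measurableSet_Ioi]
    · refine lintegral_congr fun w => ?_
      have hm : Measurable fun v => limitLevel ρ' ε J w v z :=
        hlev.comp (by fun_prop : Measurable fun v : ℝ => (w, v, z))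
      dsimp only
      rw [lintegral_const_mul _ hm]
      rcases le_or_gt w 0 with hw | hw
      · rw [indicator_of_notMem (s := Ioi (0 : ℝ)) (by simpa using hw)]
        simp [limitLevel_of_nonpos hw]
      · rw [indicator_of_mem (s := Ioi (0 : ℝ)) (mem_Ioi.2 hw), lintegral_limitLevel h hJ hw hz]
    · refine Measurable.aemeasurable (Measurable.mul ?_ ?_)
      · exact hind.comp (by fun_prop : Measurable fun q : ℝ × ℝ => ρ * q.2 + u)
      · exact hlev.comp (by fun_prop : Measurable fun q : ℝ × ℝ => (q.2, q.1, z))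
  simp only [h1]
  have hexp : Measurable fun w : ℝ => ENNReal.ofReal (3 * Real.exp (-(3 * z * w))) := by fun_prop
  rw [lintegral_lintegral_swap]
  · have h2 : ∀ w, ∫⁻ u : ℝ, I.indicator 1 (ρ * w + u) *
        (volume J * ENNReal.ofReal (3 * Real.exp (-(3 * z * w)))) =
        volume I * volume J * ENNReal.ofReal (3 * Real.exp (-(3 * z * w))) := by
      intro w
      have hm : Measurable fun u : ℝ => I.indicator (1 : ℝ → ℝ≥0∞) (ρ * w + u) :=
        hind.comp (by fun_prop)
      rw [lintegral_mul_const _ hm,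
        lintegral_indicator_one_comp_mul_add hI, ← mul_assoc]
    simp only [h2]
    rw [lintegral_const_mul _ hexp, lintegral_exp_neg_mul (by positivity) (by norm_num)]
    congr 2
    field_simp
  · refine Measurable.aemeasurable (Measurable.mul ?_ ?_)
    · exact hind.comp (by fun_prop : Measurable fun q : ℝ × ℝ => ρ * q.2 + q.1)
    · exact (measurable_const.mul hexp).comp measurable_snd

end Mass

/-! ### Uniform bounds of the partial sums -/

section Bounds

lemma rectSum_le_of_levelSum_le {lam N L c : ℝ} (hN : 0 < N) (hc : 0 ≤ c) {l m : ℤ} {u v z : ℝ}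
    {G : ℝ → ℝ≥0∞} (hG : ∀ w, w ≠ 0 → levelSum N L c m w v z ≤ G w) :
    rectSum lam N L c l m u v z ≤ ∫⁻ w, G w := by
  rw [rectSum_eq_lintegral lam L c hN hc]
  refine lintegral_mono_ae ?_
  have h0 : ∀ᵐ w : ℝ, w ≠ 0 := by simp [ae_iff]
  filter_upwards [h0] with w hw
  split_ifs
  · exact hG w hw
  · exact zero_le

lemma sum_greenE_le {a : ℝ} (ha : 0 ≤ a) (ha1 : a < 1) (t : ℤ) (m j : ℤ) :
    ∑ s ∈ Finset.Icc 1 m, greenE t (s - j) a ≤ 3 := by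
  rcases lt_or_ge t 0 with ht | ht
  · simp [greenE_of_neg ht]
  lift t to ℕ using ht
  rw [sum_Icc_sub_eq_tsum (fun s => greenE t s a)]
  calc _ ≤ ∑' s, greenE t s a := ENNReal.tsum_le_tsum fun s => by
        split_ifs
        · exact le_rfl
        · exact zero_le
    _ = ENNReal.ofReal (greenFourier t 0 a) := by
        simp only [greenE_eq ha ha1]
        exact tsum_green3 ha ha1 t
    _ ≤ ENNReal.ofReal 3 := by
        refine ENNReal.ofReal_le_ofReal ((mass_le ha ha1.le t).trans ?_)
        have h1 : Real.exp (-(3 / 8 * (1 - a) * t)) ≤ 1 := by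
          rw [Real.exp_le_one_iff]
          have := mul_nonneg (sub_nonneg.2 ha1.le) (Nat.cast_nonneg (α := ℝ) t)
          nlinarith
        linarith
    _ = 3 := by simp

lemma rectSum_le_mul {lam N L z : ℝ} (hN : 0 < N) {l m : ℤ} (hl : 0 ≤ l) (u v : ℝ) (hz : 0 < z)
    (hzN : z ≤ N) : rectSum lam N L 1 l m u v z ≤ ENNReal.ofReal (3 * (l / N)) := by
  obtain ⟨h0, h1⟩ := scaled_param_mem hN hz hzN
  have hl' : (0 : ℝ) ≤ l := by exact_mod_cast hl
  have hcard : (((l + 1 - 1).toNat : ℕ) : ℝ≥0∞) = ENNReal.ofReal l := by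
    rw [← ENNReal.ofReal_natCast, add_sub_cancel_right]
    congr 1
    exact_mod_cast Int.toNat_of_nonneg hl
  calc rectSum lam N L 1 l m u v z
      ≤ ENNReal.ofReal (1 / N) * ∑ t ∈ Finset.Icc 1 l, 3 := by
        unfold rectSum
        gcongr
        exact sum_greenE_le h0 h1 _ _ _
    _ = ENNReal.ofReal (1 / N) * (ENNReal.ofReal l * ENNReal.ofReal 3) := by
        rw [Finset.sum_const, Int.card_Icc, nsmul_eq_mul, hcard]
        simp
    _ = _ := by
        rw [← ENNReal.ofReal_mul hl', ← ENNReal.ofReal_mul (by positivity)]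
        congr 1
        field_simp

lemma rectSum_le_inv {lam N L z : ℝ} (hN : 0 < N) (l m : ℤ) (u v : ℝ) (hz : 0 < z) (hzN : z ≤ N) :
    rectSum lam N L 1 l m u v z ≤ ENNReal.ofReal (24 / z) := by
  refine (rectSum_le_of_levelSum_le hN zero_le_one
    fun w _ => levelSum_le_exp m w v hN hz hzN).trans ?_
  rw [lintegral_indicator measurableSet_Ici, setLIntegral_congr Ioi_ae_eq_Ici.symm,
    lintegral_exp_neg_mul (by positivity) (by norm_num)]
  refine ENNReal.ofReal_le_ofReal (le_of_eq ?_)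
  field_simp
  norm_num

lemma lintegral_inv_sqrt_mul_exp {z : ℝ} (hz : 0 < z) :
    ∫⁻ w in Ioi (0 : ℝ), ENNReal.ofReal (9 / Real.sqrt w * Real.exp (-(3 / 8 * z * w))) =
      ENNReal.ofReal (9 * (8 / 3) ^ (1 / 2 : ℝ) * Real.sqrt Real.pi * z ^ (-(1 / 2) : ℝ)) := by
  have h := Real.integral_rpow_mul_exp_neg_mul_Ioi (a := 1 / 2) (r := 3 / 8 * z) (by norm_num)
    (by positivity)
  rw [Real.Gamma_one_half_eq] at h
  have hi : IntegrableOn (fun w : ℝ => w ^ (1 / 2 - 1 : ℝ) * Real.exp (-(3 / 8 * z * w)))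
      (Ioi 0) := by
    refine not_imp_comm.1 integral_undef ?_
    rw [h]
    have := Real.pi_pos
    positivity
  have hc : ∀ w ∈ Ioi (0 : ℝ), ENNReal.ofReal (9 / Real.sqrt w * Real.exp (-(3 / 8 * z * w))) =
      ENNReal.ofReal (9 * (w ^ (1 / 2 - 1 : ℝ) * Real.exp (-(3 / 8 * z * w)))) := by
    intro w hw
    rw [show (1 / 2 - 1 : ℝ) = -(1 / 2) by norm_num, Real.rpow_neg (le_of_lt hw),
      ← Real.sqrt_eq_rpow, div_eq_mul_inv, mul_assoc]
  rw [setLIntegral_congr_fun measurableSet_Ioi hc, ← ofReal_integral_eq_lintegral_ofReal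
    (hi.const_mul 9), integral_const_mul, h]
  · congr 1
    rw [one_div (3 / 8 * z), mul_inv, Real.mul_rpow (by norm_num) (by positivity), Real.rpow_neg hz.le,
      Real.inv_rpow hz.le]
    norm_num
    ring
  · filter_upwards [ae_restrict_mem measurableSet_Ioi] with w hw
    have : (0 : ℝ) < w := hw
    simp only [Pi.zero_apply]
    positivity

/-- A bound of order `z^{-1/2}`, from the decay of the Green function of order `t^{-1/2}` on the
vertical line at `t`. -/
lemma rectSum_le_rpow {lam N L c z Y : ℝ} (hN : 0 < N) {l m : ℤ} (u v : ℝ) (hz : 0 < z)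
    (hzN : z ≤ N) (hm : 0 ≤ m) (hc : 0 ≤ c) (hY0 : 0 ≤ Y) (hY : c * m / Real.sqrt N ≤ Y) :
    rectSum lam N L c l m u v z ≤ ENNReal.ofReal
      (Y * (9 * (8 / 3) ^ (1 / 2 : ℝ) * Real.sqrt Real.pi) * z ^ (-(1 / 2) : ℝ)) := by
  refine (rectSum_le_of_levelSum_le hN hc
    fun w hw => levelSum_le_sqrt v hN hz hzN hw hm hc hY).trans ?_
  rw [lintegral_const_mul' _ _ ENNReal.ofReal_ne_top, lintegral_indicator measurableSet_Ioi,
    lintegral_inv_sqrt_mul_exp hz, ← ENNReal.ofReal_mul hY0]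
  exact ENNReal.ofReal_le_ofReal (le_of_eq (by ring))

lemma lintegral_indicator_inv_sqrt :
    ∫⁻ w : ℝ, (Ioc (0 : ℝ) 1).indicator (fun w => ENNReal.ofReal (1 / Real.sqrt w)) w = 2 := by
  rw [lintegral_indicator measurableSet_Ioc]
  have hc : ∀ w ∈ Ioc (0 : ℝ) 1, ENNReal.ofReal (1 / Real.sqrt w) =
      ENNReal.ofReal (w ^ (-(1 / 2) : ℝ)) := by
    intro w hw
    rw [Real.rpow_neg hw.1.le, ← Real.sqrt_eq_rpow, one_div]
  rw [setLIntegral_congr_fun measurableSet_Ioc hc]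
  have hi : IntervalIntegrable (fun w : ℝ => w ^ (-(1 / 2) : ℝ)) volume 0 1 :=
    intervalIntegral.intervalIntegrable_rpow' (by norm_num)
  rw [intervalIntegrable_iff_integrableOn_Ioc_of_le zero_le_one] at hi
  rw [← ofReal_integral_eq_lintegral_ofReal hi, ← intervalIntegral.integral_of_le zero_le_one,
    integral_rpow (by norm_num)]
  · norm_num
  · filter_upwards [ae_restrict_mem measurableSet_Ioc] with w hw
    exact Real.rpow_nonneg hw.1.le _

/-- A bound of the partial sums that does not depend on `z`. The factor `w^{-1/2}` in the bound of
the levels is at most `1` away from the unit interval. -/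
lemma rectSum_le_const {lam N L c z Y : ℝ} (hN : 0 < N) {l m : ℤ} (u v : ℝ) (hz : 0 < z)
    (hzN : z ≤ N) (hl : 0 ≤ l) (hm : 0 ≤ m) (hc : 0 ≤ c) (hY0 : 0 ≤ Y)
    (hY : c * m / Real.sqrt N ≤ Y) :
    rectSum lam N L c l m u v z ≤ ENNReal.ofReal (9 * Y * (2 + l / N)) := by
  have hl' : (0 : ℝ) ≤ l := by exact_mod_cast hl
  set A : ℝ → ℝ≥0∞ := fun w =>
    if 1 ≤ ⌊N * w⌋ + ⌊lam * u⌋ ∧ ⌊N * w⌋ + ⌊lam * u⌋ ≤ l then 1 else 0 with hA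
  have hAint : ∫⁻ w, A w = ENNReal.ofReal (l / N) := by
    have h := sum_Icc_sub_eq_lintegral (fun _ => 1) ⌊lam * u⌋ l hN
    rw [Finset.sum_const, Int.card_Icc, nsmul_eq_mul, mul_one, ← ENNReal.ofReal_natCast,
      add_sub_cancel_right, show ((l.toNat : ℕ) : ℝ) = l by exact_mod_cast Int.toNat_of_nonneg hl]
      at h
    rw [div_eq_inv_mul, ENNReal.ofReal_mul (by positivity), h, ← mul_assoc,
      ← ENNReal.ofReal_mul (by positivity), inv_mul_cancel₀ hN.ne', ENNReal.ofReal_one, one_mul]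
  set S : ℝ → ℝ≥0∞ := (Ioc (0 : ℝ) 1).indicator fun w => ENNReal.ofReal (1 / Real.sqrt w) with hS
  have hSm : Measurable S := by
    refine Measurable.indicator ?_ measurableSet_Ioc
    fun_prop
  rw [rectSum_eq_lintegral lam L c hN hc]
  calc _ ≤ ∫⁻ w, ENNReal.ofReal (9 * Y) * (S w + A w) := by
        refine lintegral_mono_ae ?_
        have h0 : ∀ᵐ w : ℝ, w ≠ 0 := by simp [ae_iff]
        filter_upwards [h0] with w hw
        simp only [hA]
        split_ifs with hif
        · refine (levelSum_le_sqrt v hN hz hzN hw hm hc hY).trans ?_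
          rw [mul_comm 9 Y, ENNReal.ofReal_mul hY0, mul_assoc]
          refine mul_le_mul_right ?_ _
          rcases hw.lt_or_gt with hw | hw
          · rw [indicator_of_notMem (by simpa using hw.le)]; exact zero_le
          rw [indicator_of_mem (mem_Ioi.2 hw)]
          have he : Real.exp (-(3 / 8 * z * w)) ≤ 1 := by
            rw [Real.exp_le_one_iff]; nlinarith [mul_pos hz hw]
          have hsw := Real.sqrt_pos.2 hw
          have h1 : ENNReal.ofReal (9 / Real.sqrt w * Real.exp (-(3 / 8 * z * w))) ≤
              ENNReal.ofReal 9 * ENNReal.ofReal (1 / Real.sqrt w) := by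
            rw [← ENNReal.ofReal_mul (by norm_num)]
            refine ENNReal.ofReal_le_ofReal ?_
            rw [mul_one_div]
            exact mul_le_of_le_one_right (by positivity) he
          refine h1.trans (mul_le_mul_right ?_ _)
          rcases le_or_gt w 1 with hw1 | hw1
          · simp [hS, indicator_of_mem (show w ∈ Ioc (0 : ℝ) 1 from ⟨hw, hw1⟩)]
          · refine le_add_left ?_
            rw [← ENNReal.ofReal_one]
            refine ENNReal.ofReal_le_ofReal ?_
            rw [div_le_one hsw]
            exact Real.one_le_sqrt.2 hw1.le
        · exact zero_le
    _ = ENNReal.ofReal (9 * Y) * (2 + ENNReal.ofReal (l / N)) := by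
        rw [lintegral_const_mul' _ _ ENNReal.ofReal_ne_top, lintegral_add_left hSm, hAint, hS,
          lintegral_indicator_inv_sqrt]
    _ = _ := by
        rw [ENNReal.ofReal_mul (p := 9 * Y) (by positivity), ENNReal.ofReal_add (by norm_num)
          (by positivity)]
        simp

end Bounds

/-! ### The scaling regimes -/

section Regimes

/-- The data of a scaling regime. A partial sum over `[1, λ x] × [1, λ^γ y]` is viewed in units `λ`
and `L` of the starting point of the walk, while `N` is the unit of time in which the walk is
observed and `1 - z / N` its survival probability. The normalised sums converge level by level, and
are bounded by multiples of `z^{-p}` and `z^{-q}`, where `(α - 1) p < β < (α - 1) q`. -/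
structure ScalingRegime (α β γ H ρ ρ' ε p q : ℝ) (lam N L c : ℕ → ℝ) : Prop where
  lam_pos : ∀ n, 0 < lam n
  N_pos : ∀ n, 0 < N n
  L_pos : ∀ n, 0 < L n
  c_pos : ∀ n, 0 < c n
  lam_tendsto : Tendsto lam atTop atTop
  N_tendsto : Tendsto N atTop atTop
  ratio : Tendsto (fun n => N n / lam n) atTop (𝓝 ρ)
  cell : ∀ n, c n * lam n ^ γ = L n
  norm : ∀ n, lam n * L n / N n * (lam n ^ (-H) * N n / c n) ^ α * N n ^ (-β) = 1
  rho : ρ = 1 ∨ ρ = 0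
  eps : ε = 1 ∨ (ρ' = 1 ∧ ε = 0)
  lt_beta : (α - 1) * p < β
  beta_lt : β < (α - 1) * q
  level : ∀ y w v z, 0 < w → 0 < z → v ≠ 0 → v ≠ y →
    Tendsto (fun n => levelSum (N n) (L n) (c n) ⌊lam n ^ γ * y⌋ w v z) atTop
      (𝓝 (limitLevel ρ' ε (Ioc 0 y) w v z))
  level_le : ∀ y z, 0 ≤ y → 0 < z → ∃ G : ℝ → ℝ≥0∞, ∫⁻ w, G w ≠ ∞ ∧ ∀ᶠ n in atTop, ∀ w v,
    w ≠ 0 → levelSum (N n) (L n) (c n) ⌊lam n ^ γ * y⌋ w v z ≤ G w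
  rect_le : ∀ x y, 0 ≤ x → 0 ≤ y → ∃ K, 0 < K ∧ ∀ n u v z, 0 < z → z ≤ N n →
    rectSum (lam n) (N n) (L n) (c n) ⌊lam n * x⌋ ⌊lam n ^ γ * y⌋ u v z ≤
      ENNReal.ofReal (K * z ^ (-p)) ∧
    rectSum (lam n) (N n) (L n) (c n) ⌊lam n * x⌋ ⌊lam n ^ γ * y⌋ u v z ≤
      ENNReal.ofReal (K * z ^ (-q))

variable {α β γ : ℝ} {lam : ℕ → ℝ}

lemma level_le_one {N L : ℕ → ℝ} (hN : Tendsto N atTop atTop) (m : ℕ → ℤ) {z : ℝ} (hz : 0 < z) :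
    ∃ G : ℝ → ℝ≥0∞, ∫⁻ w, G w ≠ ∞ ∧ ∀ᶠ n in atTop, ∀ w v,
      w ≠ 0 → levelSum (N n) (L n) 1 (m n) w v z ≤ G w := by
  refine ⟨(Ici 0).indicator fun w => ENNReal.ofReal (9 * Real.exp (-(3 / 8 * z * w))), ?_, ?_⟩
  rotate_left
  · filter_upwards [hN.eventually_gt_atTop 0, hN.eventually_ge_atTop z] with n hn hzN w v _
    exact levelSum_le_exp (m n) w v hn hz hzN
  · rw [lintegral_indicator measurableSet_Ici, setLIntegral_congr Ioi_ae_eq_Ici.symm,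
      lintegral_exp_neg_mul (by positivity) (by norm_num)]
    exact ENNReal.ofReal_ne_top

lemma tendsto_sqrt_div_rpow (hlam : Tendsto lam atTop atTop) (h : 1 / 2 < γ) :
    Tendsto (fun n => Real.sqrt (lam n) / lam n ^ γ) atTop (𝓝 0) := by
  have h1 : Tendsto (fun n => lam n ^ (-(γ - 1 / 2))) atTop (𝓝 0) :=
    (tendsto_rpow_neg_atTop (by linarith)).comp hlam
  refine h1.congr' ?_
  filter_upwards [hlam.eventually_gt_atTop 0] with n hn
  rw [Real.sqrt_eq_rpow, ← Real.rpow_sub hn]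
  congr 1; ring

/-- The regime `γ ≥ 1/2`: the walk is observed at the time scale `λ` of the partial sums. -/
lemma scalingRegime_of_half_le (hα : 1 < α) (hβ : 0 < β) (hβ' : β < α - 1) (hγ : 1 / 2 ≤ γ)
    {ρ' : ℝ} (hρ' : (γ = 1 / 2 ∧ ρ' = 1) ∨ (1 / 2 < γ ∧ ρ' = 0))
    (hpos : ∀ n, 0 < lam n) (hlam : Tendsto lam atTop atTop) :
    ScalingRegime α β γ (scalingExponent α β γ) 1 ρ' 1 0 1 lam lam (fun n => lam n ^ γ)
      (fun _ => 1) where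
  lam_pos := hpos
  N_pos := hpos
  L_pos n := Real.rpow_pos_of_pos (hpos n) _
  c_pos _ := one_pos
  lam_tendsto := hlam
  N_tendsto := hlam
  ratio := by simp only [div_self (hpos _).ne']; exact tendsto_const_nhds
  cell n := one_mul _
  norm n := by
    have h := hpos n
    rw [scalingExponent, if_pos hγ, div_one, mul_div_cancel_left₀ _ h.ne', ← Real.rpow_add_one h.ne',
      ← Real.rpow_mul h.le, ← Real.rpow_add h, ← Real.rpow_add h]
    convert Real.rpow_zero (lam n) using 2
    field_simp
    ring
  rho := Or.inl rfl
  eps := Or.inl rfl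
  lt_beta := by simpa using hβ
  beta_lt := by simpa using hβ'
  level y w v z hw hz h0 hy := by
    refine tendsto_levelSum_one hlam ((tendsto_rpow_atTop (by linarith)).comp hlam) ?_
      (hρ'.imp (·.2) (·.2)) hw hz ⟨h0, hy⟩
    rcases hρ' with ⟨rfl, rfl⟩ | ⟨h, rfl⟩
    · refine tendsto_const_nhds.congr fun n => ?_
      rw [Function.comp_apply, Real.sqrt_eq_rpow, div_self (Real.rpow_pos_of_pos (hpos n) _).ne']
    · exact tendsto_sqrt_div_rpow hlam h
  level_le y z _ hz := level_le_one hlam _ hz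
  rect_le x y hx hy := by
    refine ⟨3 * x + 24, by positivity, fun n u v z hz hzN => ⟨?_, ?_⟩⟩
    · refine (rectSum_le_mul (hpos n) (Int.floor_nonneg.2 (by have := hpos n; positivity)) u v hz
        hzN).trans (ENNReal.ofReal_le_ofReal ?_)
      rw [neg_zero, Real.rpow_zero, mul_one]
      have : (⌊lam n * x⌋ : ℝ) / lam n ≤ x := by
        rw [div_le_iff₀ (hpos n), mul_comm x]; exact Int.floor_le _
      linarith
    · refine (rectSum_le_inv (hpos n) _ _ u v hz hzN).trans (ENNReal.ofReal_le_ofReal ?_)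
      rw [Real.rpow_neg_one, div_eq_mul_inv]
      gcongr
      linarith

/-- The regime `γ < 1/2`, `β > (α - 1)/2`: the walk is observed at the time scale `λ^{2γ}` at which
it covers the height `λ^γ` of the partial sums. -/
lemma scalingRegime_of_lt_beta (hα : 1 < α) (hβ : (α - 1) / 2 < β) (hβ' : β < α - 1) (hγ0 : 0 < γ)
    (hγ : γ < 1 / 2) (hpos : ∀ n, 0 < lam n) (hlam : Tendsto lam atTop atTop) :
    ScalingRegime α β γ (scalingExponent α β γ) 0 1 1 (1 / 2) 1 lam (fun n => lam n ^ (2 * γ))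
      (fun n => lam n ^ γ) (fun _ => 1) := by
  have hsqrt : ∀ n, Real.sqrt (lam n ^ (2 * γ)) = lam n ^ γ := by
    intro n
    rw [mul_comm, Real.rpow_mul (hpos n).le, Real.rpow_two,
      Real.sqrt_sq (Real.rpow_pos_of_pos (hpos n) _).le]
  have hN : Tendsto (fun n => lam n ^ (2 * γ)) atTop atTop :=
    (tendsto_rpow_atTop (by linarith)).comp hlam
  refine ⟨hpos, fun n => Real.rpow_pos_of_pos (hpos n) _, fun n => Real.rpow_pos_of_pos (hpos n) _,
    fun _ => one_pos, hlam, hN, ?_, fun n => one_mul _, ?_, Or.inr rfl, Or.inl rfl, by linarith,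
    by linarith, ?_, fun y z _ hz => level_le_one hN _ hz, ?_⟩
  · have h1 : Tendsto (fun n => lam n ^ (-(1 - 2 * γ))) atTop (𝓝 0) :=
      (tendsto_rpow_neg_atTop (by linarith)).comp hlam
    refine h1.congr fun n => ?_
    rw [← Real.rpow_sub_one (hpos n).ne']
    congr 1; ring
  · intro n
    have h := hpos n
    rw [scalingExponent, if_neg (by linarith), if_pos hβ, div_one, ← Real.rpow_add h,
      ← Real.rpow_mul h.le, ← Real.rpow_mul h.le, ← Real.rpow_one_add' h.le (by linarith),
      ← Real.rpow_sub h, ← Real.rpow_add h, ← Real.rpow_add h]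
    convert Real.rpow_zero (lam n) using 2
    field_simp
    ring
  · intro y w v z hw hz h0 hy
    refine tendsto_levelSum_one hN ((tendsto_rpow_atTop hγ0).comp hlam) ?_ (Or.inl rfl) hw hz
      ⟨h0, hy⟩
    refine tendsto_const_nhds.congr fun n => ?_
    rw [Function.comp_apply, hsqrt, div_self (Real.rpow_pos_of_pos (hpos n) _).ne']
  · intro x y hx hy
    refine ⟨y * (9 * (8 / 3) ^ (1 / 2 : ℝ) * Real.sqrt Real.pi) + 24, by positivity,
      fun n u v z hz hzN => ⟨?_, ?_⟩⟩
    · have hL := Real.rpow_pos_of_pos (hpos n) γ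
      refine (rectSum_le_rpow (Y := y) (Real.rpow_pos_of_pos (hpos n) _) u v hz hzN
        (Int.floor_nonneg.2 (by positivity)) zero_le_one hy ?_).trans (ENNReal.ofReal_le_ofReal ?_)
      · rw [hsqrt, one_mul, div_le_iff₀ hL, mul_comm y]
        exact Int.floor_le _
      · gcongr
        linarith
    · refine (rectSum_le_inv (Real.rpow_pos_of_pos (hpos n) _) _ _ u v hz hzN).trans
        (ENNReal.ofReal_le_ofReal ?_)
      rw [Real.rpow_neg_one, div_eq_mul_inv]
      gcongr
      have : 0 ≤ y * (9 * (8 / 3) ^ (1 / 2 : ℝ) * Real.sqrt Real.pi) := by positivity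
      linarith

/-- The regime `γ < 1/2`, `β < (α - 1)/2`: the walk is observed at the time scale `λ`, at which
the height `λ^γ` of the partial sums is negligible. -/
lemma scalingRegime_of_beta_lt (hα : 1 < α) (hβ : 0 < β) (hβ' : β < (α - 1) / 2) (hγ0 : 0 < γ)
    (hγ : γ < 1 / 2) (hpos : ∀ n, 0 < lam n) (hlam : Tendsto lam atTop atTop) :
    ScalingRegime α β γ (scalingExponent α β γ) 1 1 0 0 (1 / 2) lam lam
      (fun n => Real.sqrt (lam n)) (fun n => Real.sqrt (lam n) / lam n ^ γ) := by
  have hK : ∀ n, 0 < lam n ^ γ := fun n => Real.rpow_pos_of_pos (hpos n) _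
  have hs : ∀ n, 0 < Real.sqrt (lam n) := fun n => Real.sqrt_pos.2 (hpos n)
  have hY : ∀ n y, Real.sqrt (lam n) / lam n ^ γ * ⌊lam n ^ γ * y⌋ / Real.sqrt (lam n) ≤ y := by
    intro n y
    have h1 : (⌊lam n ^ γ * y⌋ : ℝ) ≤ lam n ^ γ * y := Int.floor_le _
    have h2 := hK n
    have h3 := hs n
    rw [div_mul_eq_mul_div, div_div, div_le_iff₀ (by positivity)]
    nlinarith
  refine ⟨hpos, hpos, hs, fun n => div_pos (hs n) (hK n), hlam, hlam, ?_,
    fun n => div_mul_cancel₀ _ (hK n).ne', ?_, Or.inl rfl, Or.inr ⟨rfl, rfl⟩, by linarith,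
    by linarith, ?_, ?_, ?_⟩
  · simp only [div_self (hpos _).ne']; exact tendsto_const_nhds
  · intro n
    have h := hpos n
    rw [scalingExponent, if_neg (by linarith), if_neg (by linarith), mul_div_cancel_left₀ _ h.ne',
      Real.sqrt_eq_rpow, ← Real.rpow_sub h, ← Real.rpow_add_one h.ne', ← Real.rpow_sub h,
      ← Real.rpow_mul h.le, ← Real.rpow_add h, ← Real.rpow_add h]
    convert Real.rpow_zero (lam n) using 2
    field_simp
    ring
  · intro y w v z hw hz _ _
    refine tendsto_levelSum_zero hlam ((tendsto_rpow_atTop hγ0).comp hlam) ?_ hw hz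
    have h1 : Tendsto (fun n => lam n ^ (-(1 / 2 - γ))) atTop (𝓝 0) :=
      (tendsto_rpow_neg_atTop (by linarith)).comp hlam
    refine h1.congr fun n => ?_
    rw [Function.comp_apply, Real.sqrt_eq_rpow, ← Real.rpow_sub (hpos n)]
    congr 1; ring
  · intro y z hy hz
    refine ⟨fun w => ENNReal.ofReal y * (Ioi 0).indicator
      (fun w => ENNReal.ofReal (9 / Real.sqrt w * Real.exp (-(3 / 8 * z * w)))) w, ?_, ?_⟩
    rotate_left
    · filter_upwards [hlam.eventually_ge_atTop z] with n hzN w v hw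
      exact levelSum_le_sqrt v (hpos n) hz hzN hw
        (Int.floor_nonneg.2 (mul_nonneg (hK n).le hy)) (div_pos (hs n) (hK n)).le (hY n y)
    · rw [lintegral_const_mul' _ _ ENNReal.ofReal_ne_top, lintegral_indicator measurableSet_Ioi,
        lintegral_inv_sqrt_mul_exp hz]
      exact ENNReal.mul_ne_top ENNReal.ofReal_ne_top ENNReal.ofReal_ne_top
  · intro x y hx hy
    refine ⟨9 * y * (2 + x) + y * (9 * (8 / 3) ^ (1 / 2 : ℝ) * Real.sqrt Real.pi) + 1,
      by positivity, fun n u v z hz hzN => ⟨?_, ?_⟩⟩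
    · refine (rectSum_le_const (hpos n) u v hz hzN (Int.floor_nonneg.2 (mul_nonneg (hpos n).le hx))
        (Int.floor_nonneg.2 (mul_nonneg (hK n).le hy)) (div_pos (hs n) (hK n)).le hy
        (hY n y)).trans (ENNReal.ofReal_le_ofReal ?_)
      rw [neg_zero, Real.rpow_zero, mul_one]
      have h1 : (⌊lam n * x⌋ : ℝ) / lam n ≤ x := by
        rw [div_le_iff₀ (hpos n), mul_comm x]; exact Int.floor_le _
      have h2 : 9 * y * (2 + (⌊lam n * x⌋ : ℝ) / lam n) ≤ 9 * y * (2 + x) := by gcongr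
      have h3 : 0 ≤ y * (9 * (8 / 3) ^ (1 / 2 : ℝ) * Real.sqrt Real.pi) := by positivity
      linarith
    · refine (rectSum_le_rpow (hpos n) u v hz hzN (Int.floor_nonneg.2 (mul_nonneg (hK n).le hy))
        (div_pos (hs n) (hK n)).le hy (hY n y)).trans (ENNReal.ofReal_le_ofReal ?_)
      gcongr
      have : 0 ≤ 9 * y * (2 + x) := by positivity
      linarith

end Regimes

/-! ### Convergence of the energies -/

section Weights

/-- The rescaled mixing density `z ↦ N^β φ(1 - z / N)` on `(0, N]`. -/
def scaledDensity (β : ℝ) (φ : ℝ → ℝ) (N z : ℝ) : ℝ≥0∞ :=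
  (Ioc 0 N).indicator (fun z => ENNReal.ofReal (N ^ β * φ (1 - z / N))) z

/-- The limit `z ↦ φ₁ z^β`, `z > 0`, of the rescaled mixing densities. -/
def limitDensity (β φ₁ : ℝ) (z : ℝ) : ℝ≥0∞ :=
  (Ioi 0).indicator (fun z => ENNReal.ofReal (φ₁ * z ^ β)) z

variable {β φ₁ C : ℝ} {φ : ℝ → ℝ}

lemma exists_density_le (hβ : 0 < β) (hφ_bdd : ∃ C : ℝ, ∀ a ∈ Ico (0 : ℝ) 1, φ a ≤ C)
    (hφ_asymp : Asymptotics.IsEquivalent (𝓝[<] (1 : ℝ)) φ (fun a => φ₁ * (1 - a) ^ β)) :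
    ∃ C, 0 < C ∧ ∀ a ∈ Ico (0 : ℝ) 1, φ a ≤ C * (1 - a) ^ β := by
  obtain ⟨B, hB⟩ := hφ_bdd
  obtain ⟨c, hc⟩ := hφ_asymp.isBigO.bound
  rw [eventually_nhdsWithin_iff, Metric.eventually_nhds_iff] at hc
  obtain ⟨δ, hδ, hc⟩ := hc
  refine ⟨|c| * |φ₁| + |B| / δ ^ β + 1, by positivity, fun a ha => ?_⟩
  have h1 : 0 < 1 - a := by linarith [ha.2]
  have h2 : 0 < (1 - a) ^ β := Real.rpow_pos_of_pos h1 _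
  have hδβ : 0 < δ ^ β := Real.rpow_pos_of_pos hδ _
  rcases lt_or_ge (1 - a) δ with h | h
  · have h3 := hc (y := a) (by rw [dist_comm, Real.dist_eq, abs_of_pos h1]; exact h) ha.2
    rw [norm_mul, Real.norm_eq_abs, Real.norm_eq_abs, Real.norm_eq_abs, abs_of_pos h2] at h3
    have h4 : c * (|φ₁| * (1 - a) ^ β) ≤ |c| * (|φ₁| * (1 - a) ^ β) := by
      gcongr; exact le_abs_self c
    have h5 : 0 ≤ (|B| / δ ^ β + 1) * (1 - a) ^ β := by positivity
    nlinarith [le_abs_self (φ a)]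
  · have h3 : δ ^ β ≤ (1 - a) ^ β := Real.rpow_le_rpow hδ.le h hβ.le
    have h4 : |B| ≤ |B| / δ ^ β * (1 - a) ^ β := by
      rw [div_mul_eq_mul_div, le_div_iff₀ hδβ]; gcongr
    have h5 : 0 ≤ (|c| * |φ₁| + 1) * (1 - a) ^ β := by positivity
    nlinarith [hB a ha, le_abs_self B]

lemma measurable_scaledDensity (hφ : Measurable φ) (β N : ℝ) :
    Measurable (scaledDensity β φ N) := by
  unfold scaledDensity
  refine Measurable.indicator ?_ measurableSet_Ioc
  fun_prop

lemma measurable_limitDensity (β φ₁ : ℝ) : Measurable (limitDensity β φ₁) := by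
  unfold limitDensity
  refine Measurable.indicator ?_ measurableSet_Ioi
  fun_prop

lemma scaledDensity_le (hC : ∀ a ∈ Ico (0 : ℝ) 1, φ a ≤ C * (1 - a) ^ β) (N z : ℝ) :
    scaledDensity β φ N z ≤ (Ioc 0 N).indicator (fun z => ENNReal.ofReal (C * z ^ β)) z := by
  unfold scaledDensity
  by_cases h : z ∈ Ioc 0 N
  · rw [indicator_of_mem h, indicator_of_mem h]
    refine ENNReal.ofReal_le_ofReal ?_
    have hN : 0 < N := h.1.trans_le h.2
    have h1 := hC _ (scaled_param_mem hN h.1 h.2)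
    rw [sub_sub_cancel] at h1
    have hNβ : 0 < N ^ β := Real.rpow_pos_of_pos hN β
    calc N ^ β * φ (1 - z / N) ≤ N ^ β * (C * (z / N) ^ β) := by gcongr
      _ = C * z ^ β := by
        rw [Real.div_rpow h.1.le hN.le]
        field_simp
  · rw [indicator_of_notMem h, indicator_of_notMem h]

lemma tendsto_scaledDensity (hφ₁ : 0 < φ₁)
    (hφ_asymp : Asymptotics.IsEquivalent (𝓝[<] (1 : ℝ)) φ (fun a => φ₁ * (1 - a) ^ β))
    {N : ℕ → ℝ} (hN : Tendsto N atTop atTop) (z : ℝ) :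
    Tendsto (fun n => scaledDensity β φ (N n) z) atTop (𝓝 (limitDensity β φ₁ z)) := by
  rcases le_or_gt z 0 with hz | hz
  · have h1 : ∀ n, scaledDensity β φ (N n) z = 0 := fun n =>
      indicator_of_notMem (fun h => absurd h.1 hz.not_gt) _
    have h2 : limitDensity β φ₁ z = 0 := indicator_of_notMem (fun h => absurd h hz.not_gt) _
    simp only [h1, h2]; exact tendsto_const_nhds
  have h1 : Tendsto (fun n => 1 - z / N n) atTop (𝓝[<] 1) := by
    refine tendsto_nhdsWithin_iff.2 ⟨?_, ?_⟩
    · simpa using (tendsto_const_nhds (x := z).div_atTop hN).const_sub 1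
    · filter_upwards [hN.eventually_gt_atTop 0] with n hn
      have := div_pos hz hn
      simp only [mem_Iio]; linarith
  have hne : ∀ᶠ a in 𝓝[<] (1 : ℝ), φ₁ * (1 - a) ^ β ≠ 0 := by
    filter_upwards [self_mem_nhdsWithin] with a ha
    have : 0 < 1 - a := sub_pos.2 ha
    exact (mul_pos hφ₁ (Real.rpow_pos_of_pos this β)).ne'
  have h2 := ((Asymptotics.isEquivalent_iff_tendsto_one hne).1 hφ_asymp).comp h1
  have h3 := h2.mul_const (φ₁ * z ^ β)
  rw [one_mul] at h3
  unfold limitDensity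
  rw [indicator_of_mem (s := Ioi (0 : ℝ)) (mem_Ioi.2 hz)]
  refine (ENNReal.tendsto_ofReal h3).congr' ?_
  filter_upwards [hN.eventually_gt_atTop 0, hN.eventually_ge_atTop z] with n hn hzN
  unfold scaledDensity
  rw [indicator_of_mem (s := Ioc 0 (N n)) ⟨hz, hzN⟩]
  congr 1
  have hNβ : 0 < N n ^ β := Real.rpow_pos_of_pos hn β
  have hzβ : 0 < z ^ β := Real.rpow_pos_of_pos hz β
  simp only [Function.comp_apply, Pi.div_apply, sub_sub_cancel]
  rw [Real.div_rpow hz.le hn.le]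
  field_simp

/-- The envelope `min(z^{-p}, z^{-q})` is integrable enough at `0` and at infinity. -/
lemma lintegral_envelope_ne_top {α p q : ℝ} (hp : (α - 1) * p < β) (hq : β < (α - 1) * q)
    {K : ℝ} (hK : 0 ≤ K) (hC : 0 ≤ C) :
    ∫⁻ z in Ioi 0, ENNReal.ofReal ((K * if z ≤ 1 then z ^ (-p) else z ^ (-q)) ^ (α - 1) *
      (C * z ^ β)) * ENNReal.ofReal z⁻¹ ≠ ∞ := by
  have key : ∀ r z : ℝ, 0 < z → (K * z ^ (-r)) ^ (α - 1) * (C * z ^ β) * z⁻¹ =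
      K ^ (α - 1) * C * z ^ (β - (α - 1) * r - 1) := by
    intro r z hz
    rw [Real.mul_rpow hK (Real.rpow_nonneg hz.le _), ← Real.rpow_mul hz.le, sub_sub,
      Real.rpow_sub hz, Real.rpow_add hz, Real.rpow_one, neg_mul, Real.rpow_neg hz.le,
      mul_comm r]
    field_simp
  have hmul : ∀ z : ℝ, 0 < z → ∀ r, ENNReal.ofReal ((K * z ^ (-r)) ^ (α - 1) * (C * z ^ β)) *
      ENNReal.ofReal z⁻¹ = ENNReal.ofReal (K ^ (α - 1) * C * z ^ (β - (α - 1) * r - 1)) := by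
    intro z hz r
    rw [← ENNReal.ofReal_mul (by positivity), key r z hz]
  rw [← Ioc_union_Ioi_eq_Ioi (zero_le_one (α := ℝ)),
    lintegral_union measurableSet_Ioi (Set.Ioc_disjoint_Ioi le_rfl)]
  refine ENNReal.add_ne_top.2 ⟨?_, ?_⟩
  · have h1 : IntervalIntegrable (fun z : ℝ => z ^ (β - (α - 1) * p - 1)) volume 0 1 :=
      intervalIntegral.intervalIntegrable_rpow' (by linarith)
    rw [intervalIntegrable_iff_integrableOn_Ioc_of_le zero_le_one] at h1
    rw [setLIntegral_congr_fun measurableSet_Ioc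
      (g := fun z => ENNReal.ofReal (K ^ (α - 1) * C * z ^ (β - (α - 1) * p - 1)))
      (fun z hz => by rw [if_pos hz.2]; exact hmul z hz.1 p)]
    exact (h1.const_mul _).lintegral_lt_top.ne
  · have h1 : IntegrableOn (fun z : ℝ => z ^ (β - (α - 1) * q - 1)) (Ioi 1) :=
      integrableOn_Ioi_rpow_of_lt (by linarith) one_pos
    rw [setLIntegral_congr_fun measurableSet_Ioi
      (g := fun z => ENNReal.ofReal (K ^ (α - 1) * C * z ^ (β - (α - 1) * q - 1)))
      (fun z hz => by rw [if_neg (not_le.2 hz)]; exact hmul z (one_pos.trans hz) q)]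
    exact (h1.const_mul _).lintegral_lt_top.ne

end Weights

section Convergence

variable {α β γ H ρ ρ' ε p q : ℝ} {lam N L c : ℕ → ℝ}

lemma lintegral_mul_sum {ι : Type*} [Fintype ι] {ψ : ℝ → ℝ≥0∞} (hψ : Measurable ψ)
    (hψt : ∀ z, ψ z ≠ ∞) {f : ι → ℝ × ℝ × ℝ → ℝ≥0∞} (hf : ∀ i, Measurable (f i)) {a b : ι → ℝ≥0∞}
    (ha : ∀ i, a i ≠ ∞) (hb : ∀ i, b i ≠ ∞)
    (h : ∀ z, ψ z ≠ 0 → ∀ i, ∫⁻ u, ∫⁻ v, f i (u, v, z) = b i * ENNReal.ofReal z⁻¹) :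
    ∫⁻ e : ℝ × ℝ × ℝ, ψ e.2.2 * ∑ i, a i * f i e =
      (∑ i, a i * b i) * ∫⁻ z, ψ z * ENNReal.ofReal z⁻¹ := by
  have hm : Measurable fun e : ℝ × ℝ × ℝ => ψ e.2.2 * ∑ i, a i * f i e :=
    (hψ.comp measurable_snd.snd).mul (Finset.measurable_sum _ fun i _ => (hf i).const_mul _)
  rw [lintegral_triple hm, ← lintegral_const_mul' _ _ (ENNReal.sum_ne_top.2 fun i _ =>
    ENNReal.mul_ne_top (ha i) (hb i))]
  refine lintegral_congr fun z => ?_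
  have hv : ∀ u, ∫⁻ v, ψ z * ∑ i, a i * f i (u, v, z) =
      ψ z * ∑ i, a i * ∫⁻ v, f i (u, v, z) := by
    intro u
    rw [lintegral_const_mul' _ _ (hψt z), lintegral_finsetSum]
    · exact congrArg _ (Finset.sum_congr rfl fun i _ => lintegral_const_mul' _ _ (ha i))
    · intro i _
      exact ((hf i).comp (by fun_prop : Measurable fun v : ℝ => (u, v, z))).const_mul _
  simp only [hv]
  rw [lintegral_const_mul' _ _ (hψt z), lintegral_finsetSum]
  · rw [Finset.sum_congr rfl fun i _ => lintegral_const_mul' _ _ (ha i)]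
    by_cases hz : ψ z = 0
    · simp [hz]
    simp only [h z hz, ← mul_assoc]
    rw [← Finset.sum_mul, ← mul_assoc, mul_comm (ψ z)]
  · intro i _
    refine Measurable.const_mul ?_ _
    exact Measurable.lintegral_prod_right' (f := fun q : ℝ × ℝ => f i (q.1, q.2, z))
      ((hf i).comp (by fun_prop))

lemma ae_fst_ne (a : ℝ) : ∀ᵐ e : ℝ × ℝ × ℝ, e.1 ≠ a :=
  (Measure.quasiMeasurePreserving_fst (μ := (volume : Measure ℝ))
    (ν := (volume : Measure (ℝ × ℝ)))).ae (by simp [ae_iff] : ∀ᵐ x : ℝ, x ≠ a)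

lemma ae_snd_fst_ne (a : ℝ) : ∀ᵐ e : ℝ × ℝ × ℝ, e.2.1 ≠ a :=
  (Measure.quasiMeasurePreserving_snd (μ := (volume : Measure ℝ))
    (ν := (volume : Measure (ℝ × ℝ)))).ae
    ((Measure.quasiMeasurePreserving_fst (μ := (volume : Measure ℝ))
      (ν := (volume : Measure ℝ))).ae (by simp [ae_iff] : ∀ᵐ x : ℝ, x ≠ a))

namespace ScalingRegime

/-- Pointwise convergence of the rescaled partial sums of the Green function. -/
lemma tendsto_rectSum (R : ScalingRegime α β γ H ρ ρ' ε p q lam N L c) {x y u v z : ℝ}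
    (hy : 0 ≤ y) (hz : 0 < z) (hu0 : u ≠ 0) (hux : u ≠ x) (hv0 : v ≠ 0) (hvy : v ≠ y) :
    Tendsto (fun n => rectSum (lam n) (N n) (L n) (c n) ⌊lam n * x⌋ ⌊lam n ^ γ * y⌋ u v z) atTop
      (𝓝 (limitRect ρ ρ' ε (Ioc 0 x) (Ioc 0 y) (u, v, z))) := by
  have h0 : ∀ᵐ w : ℝ, w ≠ 0 := by simp [ae_iff]
  have hae : ∀ᵐ w : ℝ, ρ * w + u ≠ 0 ∧ ρ * w + u ≠ x := by
    rcases R.rho with rfl | rfl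
    · have : ∀ᵐ s : ℝ, s ∉ ({-u, x - u} : Set ℝ) :=
        measure_eq_zero_iff_ae_notMem.1 (Set.Finite.measure_zero (by simp) _)
      filter_upwards [this] with s hs
      simp only [mem_insert_iff, mem_singleton_iff, not_or] at hs
      exact ⟨fun h => hs.1 (by linarith), fun h => hs.2 (by linarith)⟩
    · exact Eventually.of_forall fun s => by simpa using ⟨hu0, hux⟩
  obtain ⟨G, hG, hle⟩ := R.level_le y z hy hz
  simp only [fun n => rectSum_eq_lintegral (lam n) (L n) (c n) (R.N_pos n) (R.c_pos n).le]
  refine tendsto_lintegral_filter_of_dominated_convergence G ?_ ?_ hG ?_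
  · refine Eventually.of_forall fun n => Measurable.ite ?_ (measurable_levelSum _ _ _ _ _ _)
      measurable_const
    have hfl : Measurable fun s : ℝ => ⌊N n * s⌋ + ⌊lam n * u⌋ :=
      (Int.measurable_floor.comp (measurable_const_mul _)).add_const _
    exact (hfl (measurableSet_Ici (a := (1 : ℤ)))).inter
      (hfl (measurableSet_Iic (a := ⌊lam n * x⌋)))
  · filter_upwards [hle] with n hn
    filter_upwards [h0] with w hw
    split_ifs
    · exact hn w v hw
    · exact zero_le
  · filter_upwards [h0, hae] with w hw hwx
    rcases hw.lt_or_gt with hw | hw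
    · simp only [levelSum_of_neg (R.N_pos _) hw, ite_self, limitLevel_of_nonpos hw.le, mul_zero]
      exact tendsto_const_nhds
    have hi : Tendsto (fun n => ((⌊N n * w⌋ + ⌊lam n * u⌋ : ℤ) : ℝ) / lam n) atTop
        (𝓝 (ρ * w + u)) := by
      have h1 := ((tendsto_floor_mul_div R.N_tendsto w).mul R.ratio).add
        (tendsto_floor_mul_div R.lam_tendsto u)
      rw [mul_comm w] at h1
      refine h1.congr fun n => ?_
      have h2 := (R.N_pos n).ne'
      have h3 := (R.lam_pos n).ne'
      push_cast
      field_simp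
    have hiff := eventually_mem_Icc_iff R.lam_tendsto hi hwx.1 hwx.2
    have hlev := R.level y w v z hw hz hv0 hvy
    by_cases hmem : ρ * w + u ∈ Ioc 0 x
    · rw [indicator_of_mem hmem, Pi.one_apply, one_mul]
      refine hlev.congr' ?_
      filter_upwards [hiff] with n hn
      rw [if_pos (hn.2 hmem)]
    · rw [indicator_of_notMem hmem, zero_mul]
      refine tendsto_const_nhds.congr' ?_
      filter_upwards [hiff] with n hn
      rw [if_neg (fun h => hmem (hn.1 h))]

lemma ae_tendsto_rectSum (R : ScalingRegime α β γ H ρ ρ' ε p q lam N L c) {x y : ℝ} (hy : 0 ≤ y) :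
    ∀ᵐ e : ℝ × ℝ × ℝ, 0 < e.2.2 →
      Tendsto (fun n => rectSum (lam n) (N n) (L n) (c n) ⌊lam n * x⌋ ⌊lam n ^ γ * y⌋
        e.1 e.2.1 e.2.2) atTop (𝓝 (limitRect ρ ρ' ε (Ioc 0 x) (Ioc 0 y) e)) := by
  filter_upwards [ae_fst_ne 0, ae_fst_ne x, ae_snd_fst_ne 0, ae_snd_fst_ne y] with e h1 h2 h3 h4 hz
  exact R.tendsto_rectSum hy hz h1 h2 h3 h4

lemma ae_limitRect_ne_top (R : ScalingRegime α β γ H ρ ρ' ε p q lam N L c) {x y : ℝ} (hx : 0 ≤ x)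
    (hy : 0 ≤ y) :
    ∀ᵐ e : ℝ × ℝ × ℝ, 0 < e.2.2 → limitRect ρ ρ' ε (Ioc 0 x) (Ioc 0 y) e ≠ ∞ := by
  obtain ⟨K, hK, hle⟩ := R.rect_le x y hx hy
  filter_upwards [R.ae_tendsto_rectSum (x := x) hy] with e he hz
  refine ne_top_of_le_ne_top ENNReal.ofReal_ne_top (b := ENNReal.ofReal (K * e.2.2 ^ (-p))) ?_
  refine le_of_tendsto (he hz) ?_
  filter_upwards [R.N_tendsto.eventually_ge_atTop e.2.2] with n hn
  exact (hle n _ _ _ hz hn).1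

lemma tendsto_mass (R : ScalingRegime α β γ H ρ ρ' ε p q lam N L c) (hγ : 0 < γ) (x y : ℝ) :
    Tendsto (fun n => (⌊lam n * x⌋ : ℝ) / lam n * (c n * ⌊lam n ^ γ * y⌋ / L n)) atTop
      (𝓝 (x * y)) := by
  refine ((tendsto_floor_mul_div R.lam_tendsto x).mul (tendsto_floor_mul_div
    ((tendsto_rpow_atTop hγ).comp R.lam_tendsto) y)).congr fun n => ?_
  have h1 := (R.c_pos n).ne'
  have h2 := (Real.rpow_pos_of_pos (R.lam_pos n) γ).ne'
  rw [← R.cell n, Function.comp_apply]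
  field_simp

/-- Convergence of the energies of linear combinations of the rescaled partial sums, together with
the finiteness of the limit. The integrand is dominated by a multiple of the partial sum itself,
whose total mass converges. -/
lemma tendsto_lintegral_sum (R : ScalingRegime α β γ H ρ ρ' ε p q lam N L c) (hα : 1 < α)
    (hγ : 0 < γ) {φ : ℝ → ℝ} {φ₁ : ℝ} (hφ : Measurable φ) (hφ₁ : 0 < φ₁) (hβ : 0 < β)
    (hφ_bdd : ∃ C : ℝ, ∀ a ∈ Ico (0 : ℝ) 1, φ a ≤ C)
    (hφ_asymp : Asymptotics.IsEquivalent (𝓝[<] (1 : ℝ)) φ (fun a => φ₁ * (1 - a) ^ β))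
    {ι : Type*} [Fintype ι] (θ : ι → ℝ) (x y : ι → ℝ) (hx : ∀ i, 0 ≤ x i) (hy : ∀ i, 0 ≤ y i) :
    Tendsto (fun n => ∫⁻ e : ℝ × ℝ × ℝ, ‖∑ i, θ i * (rectSum (lam n) (N n) (L n) (c n)
      ⌊lam n * x i⌋ ⌊lam n ^ γ * y i⌋ e.1 e.2.1 e.2.2).toReal‖ₑ ^ α *
        scaledDensity β φ (N n) e.2.2) atTop
      (𝓝 (∫⁻ e : ℝ × ℝ × ℝ, ‖∑ i, θ i *
        (limitRect ρ ρ' ε (Ioc 0 (x i)) (Ioc 0 (y i)) e).toReal‖ₑ ^ α *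
          limitDensity β φ₁ e.2.2)) ∧
    ∫⁻ e : ℝ × ℝ × ℝ, ‖∑ i, θ i *
        (limitRect ρ ρ' ε (Ioc 0 (x i)) (Ioc 0 (y i)) e).toReal‖ₑ ^ α *
          limitDensity β φ₁ e.2.2 ≠ ∞ := by
  obtain ⟨C, hC0, hC⟩ := exists_density_le hβ hφ_bdd hφ_asymp
  choose K hK0 hK using fun i => R.rect_le (x i) (y i) (hx i) (hy i)
  set rs : ℕ → ι → ℝ × ℝ × ℝ → ℝ≥0∞ := fun n i e => rectSum (lam n) (N n) (L n) (c n)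
      ⌊lam n * x i⌋ ⌊lam n ^ γ * y i⌋ e.1 e.2.1 e.2.2 with hrs
  set lr : ι → ℝ × ℝ × ℝ → ℝ≥0∞ := fun i => limitRect ρ ρ' ε (Ioc 0 (x i)) (Ioc 0 (y i)) with hlr
  have hrsm : ∀ n i, Measurable (rs n i) := fun n i => measurable_rectSum _ _ _ _ _ _
  have hlrm : ∀ i, Measurable (lr i) := fun i =>
    measurable_limitRect measurableSet_Ioc measurableSet_Ioc _ _ _
  set κ : ℝ := ∑ i, |θ i| * K i with hκ
  have hκ0 : 0 ≤ κ := Finset.sum_nonneg fun i _ => mul_nonneg (abs_nonneg _) (hK0 i).le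
  set ω : ℝ → ℝ := fun z => if z ≤ 1 then z ^ (-p) else z ^ (-q) with hω
  have hω0 : ∀ z, 0 < z → 0 ≤ ω z := by
    intro z hz; simp only [hω]; split_ifs <;> positivity
  set Ψ : ℝ → ℝ≥0∞ := fun z => ENNReal.ofReal ((κ * ω z) ^ (α - 1) * (C * z ^ β)) with hΨ
  have hωm : Measurable ω := Measurable.ite measurableSet_Iic (by fun_prop) (by fun_prop)
  have hΨm : Measurable Ψ := by
    refine Measurable.ennreal_ofReal (Measurable.mul ?_ (by fun_prop))
    exact (hωm.const_mul κ).pow_const _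
  set T : ℕ → ℝ × ℝ × ℝ → ℝ≥0∞ := fun n e => ∑ i, ENNReal.ofReal |θ i| * rs n i e with hT
  set T₀ : ℝ × ℝ × ℝ → ℝ≥0∞ := fun e => ∑ i, ENNReal.ofReal |θ i| * lr i e with hT₀
  have hTm : ∀ n, Measurable (T n) := fun n => Finset.measurable_sum _ fun i _ =>
    (hrsm n i).const_mul _
  have hT₀m : Measurable T₀ := Finset.measurable_sum _ fun i _ => (hlrm i).const_mul _
  have hTle : ∀ n e, 0 < e.2.2 → e.2.2 ≤ N n → T n e ≤ ENNReal.ofReal (κ * ω e.2.2) := by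
    intro n e hz hzN
    have : ENNReal.ofReal (κ * ω e.2.2) =
        ∑ i, ENNReal.ofReal |θ i| * ENNReal.ofReal (K i * ω e.2.2) := by
      rw [hκ, Finset.sum_mul, ENNReal.ofReal_sum_of_nonneg]
      · refine Finset.sum_congr rfl fun i _ => ?_
        rw [mul_assoc, ENNReal.ofReal_mul (abs_nonneg _)]
      · intro i _
        exact mul_nonneg (mul_nonneg (abs_nonneg _) (hK0 i).le) (hω0 _ hz)
    rw [this]
    refine Finset.sum_le_sum fun i _ => mul_le_mul_right ?_ _
    simp only [hω]
    split_ifs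
    · exact (hK i n _ _ _ hz hzN).1
    · exact (hK i n _ _ _ hz hzN).2
  have hnorm : ∀ (t : ι → ℝ≥0∞), ‖∑ i, θ i * (t i).toReal‖ₑ ≤ ∑ i, ENNReal.ofReal |θ i| * t i := by
    intro t
    refine (enorm_sum_le _ _).trans (Finset.sum_le_sum fun i _ => ?_)
    rw [enorm_mul, ← Real.norm_eq_abs, ofReal_norm]
    refine mul_le_mul_right ?_ _
    rw [Real.enorm_of_nonneg ENNReal.toReal_nonneg]
    exact ENNReal.ofReal_toReal_le
  -- the total masses of the dominating functions
  have henv : ∫⁻ z, (Ioi 0).indicator Ψ z * ENNReal.ofReal z⁻¹ ≠ ∞ := by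
    have h := lintegral_envelope_ne_top (β := β) (C := C) R.lt_beta R.beta_lt hκ0 hC0.le
    rw [← lintegral_indicator measurableSet_Ioi] at h
    convert h using 3 with z
    by_cases hz : z ∈ Ioi (0 : ℝ)
    · rw [indicator_of_mem hz, indicator_of_mem hz]
    · rw [indicator_of_notMem hz, indicator_of_notMem hz, zero_mul]
  have hindm : ∀ n, Measurable ((Ioc 0 (N n)).indicator Ψ) := fun n =>
    hΨm.indicator measurableSet_Ioc
  have hindm₀ : Measurable ((Ioi 0).indicator Ψ) := hΨm.indicator measurableSet_Ioi
  have hDint : ∀ n, ∫⁻ e : ℝ × ℝ × ℝ, (Ioc 0 (N n)).indicator Ψ e.2.2 * T n e =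
      (∑ i, ENNReal.ofReal |θ i| * ENNReal.ofReal ((⌊lam n * x i⌋ : ℝ) / lam n *
        (c n * ⌊lam n ^ γ * y i⌋ / L n))) *
        ∫⁻ z, (Ioc 0 (N n)).indicator Ψ z * ENNReal.ofReal z⁻¹ := by
    intro n
    refine lintegral_mul_sum (hindm n) (fun z => ?_) (hrsm n) (fun _ => ENNReal.ofReal_ne_top)
      (fun _ => ENNReal.ofReal_ne_top) fun z hz i => ?_
    · by_cases hz : z ∈ Ioc 0 (N n)
      · rw [indicator_of_mem hz]; exact ENNReal.ofReal_ne_top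
      · rw [indicator_of_notMem hz]; exact ENNReal.zero_ne_top
    · have hz := mem_of_indicator_ne_zero hz
      have hl : 0 ≤ ⌊lam n * x i⌋ := Int.floor_nonneg.2 (mul_nonneg (R.lam_pos n).le (hx i))
      have hm : 0 ≤ ⌊lam n ^ γ * y i⌋ :=
        Int.floor_nonneg.2 (mul_nonneg (Real.rpow_pos_of_pos (R.lam_pos n) _).le (hy i))
      simp only [hrs]
      rw [lintegral_rectSum (R.lam_pos n) (R.N_pos n) (R.L_pos n) (R.c_pos n).le hl hm hz.1 hz.2,
        div_eq_mul_inv (_ * _) z, ENNReal.ofReal_mul' (inv_nonneg.2 hz.1.le)]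
  have hgint : ∫⁻ e : ℝ × ℝ × ℝ, (Ioi 0).indicator Ψ e.2.2 * T₀ e =
      (∑ i, ENNReal.ofReal |θ i| * ENNReal.ofReal (x i * y i)) *
        ∫⁻ z, (Ioi 0).indicator Ψ z * ENNReal.ofReal z⁻¹ := by
    refine lintegral_mul_sum hindm₀ (fun z => ?_) hlrm (fun _ => ENNReal.ofReal_ne_top)
      (fun _ => ENNReal.ofReal_ne_top) fun z hz i => ?_
    · by_cases hz : z ∈ Ioi (0 : ℝ)
      · rw [indicator_of_mem hz]; exact ENNReal.ofReal_ne_top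
      · rw [indicator_of_notMem hz]; exact ENNReal.zero_ne_top
    · simp only [hlr]
      rw [lintegral_limitRect R.eps measurableSet_Ioc measurableSet_Ioc
        (mem_of_indicator_ne_zero hz), Real.volume_Ioc, Real.volume_Ioc, sub_zero, sub_zero,
        ENNReal.ofReal_mul (hx i)]
  have hgfin : ∫⁻ e : ℝ × ℝ × ℝ, (Ioi 0).indicator Ψ e.2.2 * T₀ e ≠ ∞ := by
    rw [hgint]
    exact ENNReal.mul_ne_top (ENNReal.sum_ne_top.2 fun i _ =>
        ENNReal.mul_ne_top ENNReal.ofReal_ne_top ENNReal.ofReal_ne_top) henv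
  have hDlim : Tendsto (fun n => ∫⁻ e : ℝ × ℝ × ℝ, (Ioc 0 (N n)).indicator Ψ e.2.2 * T n e) atTop
      (𝓝 (∫⁻ e : ℝ × ℝ × ℝ, (Ioi 0).indicator Ψ e.2.2 * T₀ e)) := by
    simp only [hDint, hgint]
    refine ENNReal.Tendsto.mul ?_ (Or.inr henv) ?_ (Or.inr ?_)
    · refine tendsto_finsetSum _ fun i _ => ENNReal.Tendsto.const_mul ?_
        (Or.inr ENNReal.ofReal_ne_top)
      exact ENNReal.tendsto_ofReal (R.tendsto_mass hγ (x i) (y i))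
    · refine tendsto_lintegral_of_dominated_convergence _
        (fun n => (hindm n).mul (by fun_prop)) (fun n => Eventually.of_forall fun z => ?_) henv
        (Eventually.of_forall fun z => ?_)
      · refine mul_le_mul_left ?_ _
        exact indicator_le_indicator_of_subset Ioc_subset_Ioi_self (fun _ => zero_le) z
      · refine Tendsto.congr' ?_ tendsto_const_nhds
        filter_upwards [R.N_tendsto.eventually_ge_atTop z] with n hn
        by_cases hz : z ∈ Ioi (0 : ℝ)
        · rw [indicator_of_mem hz, indicator_of_mem (s := Ioc 0 (N n)) ⟨hz, hn⟩]
        · rw [indicator_of_notMem hz, indicator_of_notMem (fun h => hz h.1)]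
    · exact ENNReal.sum_ne_top.2 fun i _ =>
        ENNReal.mul_ne_top ENNReal.ofReal_ne_top ENNReal.ofReal_ne_top
  -- pointwise domination
  have hle : ∀ n e, ‖∑ i, θ i * (rs n i e).toReal‖ₑ ^ α * scaledDensity β φ (N n) e.2.2 ≤
      (Ioc 0 (N n)).indicator Ψ e.2.2 * T n e := by
    intro n e
    have hsd := scaledDensity_le hC (N n) e.2.2
    by_cases hz : e.2.2 ∈ Ioc 0 (N n)
    · rw [indicator_of_mem hz] at hsd ⊢
      have hb : ‖∑ i, θ i * (rs n i e).toReal‖ₑ ^ α ≤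
          ENNReal.ofReal ((κ * ω e.2.2) ^ (α - 1)) * T n e := by
        calc _ ≤ T n e ^ α := ENNReal.rpow_le_rpow (hnorm fun i => rs n i e) (by linarith)
          _ = T n e ^ (α - 1) * T n e := by
            conv_lhs => rw [show α = (α - 1) + 1 by ring,
              ENNReal.rpow_add_of_nonneg _ _ (by linarith) zero_le_one, ENNReal.rpow_one]
          _ ≤ _ := by
            rw [← ENNReal.ofReal_rpow_of_nonneg (mul_nonneg hκ0 (hω0 _ hz.1)) (by linarith)]
            refine mul_le_mul_left (ENNReal.rpow_le_rpow (hTle n e hz.1 hz.2) (by linarith)) _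
      refine (mul_le_mul' hb hsd).trans (le_of_eq ?_)
      rw [hΨ]
      dsimp only
      rw [ENNReal.ofReal_mul (Real.rpow_nonneg (mul_nonneg hκ0 (hω0 _ hz.1)) _)]
      ring
    · rw [indicator_of_notMem hz] at hsd
      rw [le_zero_iff.1 hsd, mul_zero]
      exact zero_le
  -- pointwise convergence
  have hpt : ∀ᵐ e : ℝ × ℝ × ℝ, 0 < e.2.2 → ∀ i, Tendsto (fun n => rs n i e) atTop (𝓝 (lr i e)) ∧
      lr i e ≠ ∞ := by
    have h1 := ae_all_iff.2 fun i => R.ae_tendsto_rectSum (x := x i) (hy i)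
    have h2 := ae_all_iff.2 fun i => R.ae_limitRect_ne_top (hx i) (hy i)
    filter_upwards [h1, h2] with e he1 he2 hz i
    exact ⟨he1 i hz, he2 i hz⟩
  have hflim : ∀ᵐ e : ℝ × ℝ × ℝ, Tendsto (fun n => ‖∑ i, θ i * (rs n i e).toReal‖ₑ ^ α *
      scaledDensity β φ (N n) e.2.2) atTop
      (𝓝 (‖∑ i, θ i * (lr i e).toReal‖ₑ ^ α * limitDensity β φ₁ e.2.2)) := by
    filter_upwards [hpt] with e he
    have hsd := tendsto_scaledDensity hφ₁ hφ_asymp R.N_tendsto e.2.2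
    rcases le_or_gt e.2.2 0 with hz | hz
    · have h1 : ∀ n, scaledDensity β φ (N n) e.2.2 = 0 := fun n =>
        indicator_of_notMem (fun h => absurd h.1 hz.not_gt) _
      have h2 : limitDensity β φ₁ e.2.2 = 0 :=
        indicator_of_notMem (fun h => absurd h hz.not_gt) _
      simp only [h1, h2, mul_zero]; exact tendsto_const_nhds
    have hfin : ‖∑ i, θ i * (lr i e).toReal‖ₑ ^ α ≠ ∞ :=
      ENNReal.rpow_ne_top_of_nonneg (by linarith) enorm_ne_top
    refine ENNReal.Tendsto.mul ?_ (Or.inr ?_) hsd (Or.inr hfin)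
    · refine Tendsto.ennrpow_const α ?_
      refine (Tendsto.enorm ?_)
      refine tendsto_finsetSum _ fun i _ => Tendsto.const_mul _ ?_
      exact (ENNReal.tendsto_toReal (he hz i).2).comp (he hz i).1
    · unfold limitDensity
      rw [indicator_of_mem (s := Ioi (0 : ℝ)) hz]
      exact ENNReal.ofReal_ne_top
  have hglim : ∀ᵐ e : ℝ × ℝ × ℝ, Tendsto (fun n => (Ioc 0 (N n)).indicator Ψ e.2.2 * T n e) atTop
      (𝓝 ((Ioi 0).indicator Ψ e.2.2 * T₀ e)) := by
    filter_upwards [hpt] with e he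
    rcases le_or_gt e.2.2 0 with hz | hz
    · have h1 : ∀ n, (Ioc 0 (N n)).indicator Ψ e.2.2 = 0 := fun n =>
        indicator_of_notMem (fun h => absurd h.1 hz.not_gt) _
      have h2 : (Ioi 0).indicator Ψ e.2.2 = 0 :=
        indicator_of_notMem (fun h => absurd h hz.not_gt) _
      simp only [h1, h2, zero_mul]; exact tendsto_const_nhds
    have hT : Tendsto (fun n => Ψ e.2.2 * T n e) atTop (𝓝 (Ψ e.2.2 * T₀ e)) := by
      refine ENNReal.Tendsto.const_mul ?_ (Or.inr ENNReal.ofReal_ne_top)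
      exact tendsto_finsetSum _ fun i _ => ENNReal.Tendsto.const_mul (he hz i).1
        (Or.inr ENNReal.ofReal_ne_top)
    rw [indicator_of_mem (s := Ioi (0 : ℝ)) hz]
    refine hT.congr' ?_
    filter_upwards [R.N_tendsto.eventually_ge_atTop e.2.2] with n hn
    rw [indicator_of_mem (s := Ioc 0 (N n)) ⟨hz, hn⟩]
  have hfm : ∀ n, Measurable fun e : ℝ × ℝ × ℝ => ‖∑ i, θ i * (rs n i e).toReal‖ₑ ^ α *
      scaledDensity β φ (N n) e.2.2 := by
    intro n
    refine Measurable.mul ((Measurable.enorm ?_).pow_const _)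
      ((measurable_scaledDensity hφ β (N n)).comp measurable_snd.snd)
    exact Finset.measurable_sum _ fun i _ => (hrsm n i).ennreal_toReal.const_mul _
  refine ⟨tendsto_lintegral_of_dominated_tendsto hfm
    (fun n => ((hindm n).comp measurable_snd.snd).mul (hTm n))
    ((hindm₀.comp measurable_snd.snd).mul hT₀m)
    (fun n => Eventually.of_forall fun e => hle n e) hflim hglim hgfin hDlim, ?_⟩
  refine ne_top_of_le_ne_top hgfin (lintegral_mono_ae ?_)
  filter_upwards [hflim, hglim] with e h1 h2
  exact le_of_tendsto_of_tendsto' h1 h2 fun n => hle n e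

end ScalingRegime

end Convergence

/-! ### The lattice kernels -/

section Lattice

variable {α β C : ℝ} {φ : ℝ → ℝ}

lemma lintegral_mixingMeasure (hφ : Measurable φ) {h : ℝ → ℝ≥0∞} (hh : Measurable h) :
    ∫⁻ a, h a ∂(mixingMeasure φ) = ∫⁻ a in Ico (0 : ℝ) 1, ENNReal.ofReal (φ a) * h a := by
  rw [mixingMeasure, lintegral_withDensity_eq_lintegral_mul _ hφ.ennreal_ofReal hh]
  rfl

lemma lintegral_latticeControl (hφ : Measurable φ) {G : (ℤ × ℤ) × ℝ → ℝ≥0∞} (hG : Measurable G) :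
    ∫⁻ e, G e ∂(latticeControl φ) =
      ∑' j, ∑' k, ∫⁻ a in Ico (0 : ℝ) 1, ENNReal.ofReal (φ a) * G ((j, k), a) := by
  have : SFinite (mixingMeasure φ) := by unfold mixingMeasure; infer_instance
  rw [latticeControl, lintegral_prod _ hG.aemeasurable, lintegral_count, ENNReal.tsum_prod']
  refine tsum_congr fun j => tsum_congr fun k => ?_
  exact lintegral_mixingMeasure hφ (hG.comp measurable_prodMk_left)

lemma ae_latticeControl_mem (φ : ℝ → ℝ) : ∀ᵐ e ∂(latticeControl φ), e.2 ∈ Ico (0 : ℝ) 1 := by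
  have : SFinite (mixingMeasure φ) := by unfold mixingMeasure; infer_instance
  have h1 : ∀ᵐ a ∂(mixingMeasure φ), a ∈ Ico (0 : ℝ) 1 :=
    (withDensity_absolutelyContinuous _ _).ae_le (ae_restrict_mem measurableSet_Ico)
  exact (Measure.quasiMeasurePreserving_snd (μ := (Measure.count : Measure (ℤ × ℤ)))
    (ν := mixingMeasure φ)).ae h1

lemma measurable_greenE_sub (p : ℤ × ℤ) : Measurable fun e : (ℤ × ℤ) × ℝ =>
    greenE (p.1 - e.1.1) (p.2 - e.1.2) e.2 :=
  measurable_greenE.comp ((measurable_fst.fst.const_sub _).prodMk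
    ((measurable_fst.snd.const_sub _).prodMk measurable_snd))

lemma aggregatedKernel_eq (p : ℤ × ℤ) {e : (ℤ × ℤ) × ℝ} (he : e.2 ∈ Ico (0 : ℝ) 1) :
    aggregatedKernel p e = (greenE (p.1 - e.1.1) (p.2 - e.1.2) e.2).toReal := by
  rw [greenE_eq he.1 he.2, ENNReal.toReal_ofReal (green3_nonneg he.1 _ _)]
  rfl

lemma aggregatedKernel_ae_eq (φ : ℝ → ℝ) (p : ℤ × ℤ) : aggregatedKernel p =ᵐ[latticeControl φ]
    fun e => (greenE (p.1 - e.1.1) (p.2 - e.1.2) e.2).toReal := by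
  filter_upwards [ae_latticeControl_mem φ] with e he
  exact aggregatedKernel_eq p he

lemma lintegral_Ico_one_sub (h : ℝ → ℝ≥0∞) {N : ℝ} (hN : 0 < N) :
    ∫⁻ a in Ico (0 : ℝ) 1, h a =
      ENNReal.ofReal N⁻¹ * ∫⁻ z, (Ioc 0 N).indicator (fun z => h (1 - z / N)) z := by
  set g : ℝ → ℝ≥0∞ := fun b => (Ioc (0 : ℝ) 1).indicator (fun b => h (1 - b)) b with hg
  have h1 : ∫⁻ a in Ico (0 : ℝ) 1, h a = ∫⁻ b, g b := by
    rw [← lintegral_indicator measurableSet_Ico, ← lintegral_sub_left_eq_self _ 1]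
    refine lintegral_congr fun b => ?_
    by_cases hb : b ∈ Ioc (0 : ℝ) 1
    · rw [hg, indicator_of_mem (s := Ico (0 : ℝ) 1) ⟨by linarith [hb.2], by linarith [hb.1]⟩]
      dsimp only
      rw [indicator_of_mem hb]
    · rw [hg, indicator_of_notMem (s := Ico (0 : ℝ) 1)
        (fun h => hb ⟨by linarith [h.2], by linarith [h.1]⟩)]
      dsimp only
      rw [indicator_of_notMem hb]
  have h2 : ∫⁻ b, g b = ENNReal.ofReal N⁻¹ * ∫⁻ z, g (z / N) := by
    have e := (MeasurableEquiv.mulRight₀ N⁻¹ (inv_ne_zero hN.ne')).measurableEmbedding.lintegral_map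
      (μ := volume) g
    have e2 : Measure.map (MeasurableEquiv.mulRight₀ N⁻¹ (inv_ne_zero hN.ne')) volume =
        ENNReal.ofReal N • (volume : Measure ℝ) := by
      have := Real.map_volume_mul_right (inv_ne_zero hN.ne')
      rw [inv_inv, abs_of_pos hN] at this
      exact this
    rw [e2, lintegral_smul_measure] at e
    have e3 : ∫⁻ z, g (z / N) = ENNReal.ofReal N * ∫⁻ b, g b := by
      rw [← smul_eq_mul, e]; rfl
    rw [e3, ← mul_assoc, ← ENNReal.ofReal_mul (inv_nonneg.2 hN.le), inv_mul_cancel₀ hN.ne',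
      ENNReal.ofReal_one, one_mul]
  rw [h1, h2]
  congr 1
  refine lintegral_congr fun z => ?_
  rw [hg]
  dsimp only
  have hiff : z / N ∈ Ioc (0 : ℝ) 1 ↔ z ∈ Ioc 0 N := by
    simp only [mem_Ioc, div_le_one hN, div_pos_iff_of_pos_right hN]
  by_cases hz : z ∈ Ioc 0 N
  · rw [indicator_of_mem hz, indicator_of_mem (hiff.2 hz)]
  · rw [indicator_of_notMem hz, indicator_of_notMem (fun h => hz (hiff.1 h))]

lemma greenE_le {a : ℝ} (ha : 0 ≤ a) (ha1 : a < 1) (t s : ℤ) : greenE t s a ≤ 3 := by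
  have h := sum_greenE_le ha ha1 t 1 (1 - s)
  simpa using h

/-- The integrand of the aggregated field belongs to `L^α`: the Green function is bounded by `3` and
its total mass `1 / (1 - a)` is integrable against the mixing density. -/
lemma memLp_aggregatedKernel (hα : 1 < α) (hβ : 0 < β) (hφ : Measurable φ)
    (hC : ∀ a ∈ Ico (0 : ℝ) 1, φ a ≤ C * (1 - a) ^ β) (p : ℤ × ℤ) :
    MemLp (aggregatedKernel p) (ENNReal.ofReal α) (latticeControl φ) := by
  have hm := measurable_greenE_sub p
  rw [memLp_congr_ae (aggregatedKernel_ae_eq φ p)]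
  refine memLp_of_energy_ne_top (by linarith) hm.ennreal_toReal.aestronglyMeasurable ?_
  have h1 : energy α (latticeControl φ)
      (fun e => (greenE (p.1 - e.1.1) (p.2 - e.1.2) e.2).toReal) ≤
      ∫⁻ e, ENNReal.ofReal (3 ^ (α - 1)) * greenE (p.1 - e.1.1) (p.2 - e.1.2) e.2
        ∂(latticeControl φ) := by
    refine lintegral_mono_ae ?_
    filter_upwards [ae_latticeControl_mem φ] with e he
    set g := greenE (p.1 - e.1.1) (p.2 - e.1.2) e.2
    have hg : g ≤ 3 := greenE_le he.1 he.2 _ _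
    have hgt : g ≠ ∞ := ne_top_of_le_ne_top (by simp) hg
    rw [Real.enorm_of_nonneg ENNReal.toReal_nonneg, ENNReal.ofReal_toReal hgt,
      ← ENNReal.ofReal_rpow_of_nonneg (by norm_num) (by linarith)]
    conv_lhs => rw [show α = (α - 1) + 1 by ring,
      ENNReal.rpow_add_of_nonneg _ _ (by linarith) zero_le_one, ENNReal.rpow_one]
    refine mul_le_mul_left (ENNReal.rpow_le_rpow ?_ (by linarith)) _
    simpa using hg
  refine ne_top_of_le_ne_top ?_ h1
  rw [lintegral_const_mul' _ _ ENNReal.ofReal_ne_top, lintegral_latticeControl hφ hm]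
  refine ENNReal.mul_ne_top ENNReal.ofReal_ne_top ?_
  have hma : ∀ j k : ℤ, Measurable fun a : ℝ =>
      ENNReal.ofReal (φ a) * greenE (p.1 - j) (p.2 - k) a := fun j k =>
    hφ.ennreal_ofReal.mul (hm.comp (by fun_prop : Measurable fun a : ℝ => ((j, k), a)))
  have h2 : ∑' j, ∑' k, ∫⁻ a in Ico (0 : ℝ) 1, ENNReal.ofReal (φ a) * greenE (p.1 - j) (p.2 - k) a
      = ∫⁻ a in Ico (0 : ℝ) 1, ENNReal.ofReal (φ a) * ENNReal.ofReal (1 - a)⁻¹ := by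
    simp only [← lintegral_tsum fun k => (hma _ k).aemeasurable]
    rw [← lintegral_tsum fun j => (Measurable.tsum fun k => hma j k).aemeasurable]
    refine setLIntegral_congr_fun measurableSet_Ico fun a ha => ?_
    simp only [ENNReal.tsum_mul_left, ← tsum_tsum_green3 ha.1 ha.2, greenE_eq ha.1 ha.2]
    congr 1
    refine ((Equiv.subLeft p.1).tsum_eq
      (fun t => ∑' k, ENNReal.ofReal (green3 t (p.2 - k) a))).trans ?_
    exact tsum_congr fun t => (Equiv.subLeft p.2).tsum_eq fun s => ENNReal.ofReal (green3 t s a)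
  rw [h2, lintegral_Ico_one_sub _ one_pos, lintegral_indicator measurableSet_Ioc]
  refine ENNReal.mul_ne_top ENNReal.ofReal_ne_top ?_
  have h3 : IntervalIntegrable (fun z : ℝ => z ^ (β - 1)) volume 0 1 :=
    intervalIntegral.intervalIntegrable_rpow' (by linarith)
  rw [intervalIntegrable_iff_integrableOn_Ioc_of_le zero_le_one] at h3
  refine ne_top_of_le_ne_top (h3.const_mul C).lintegral_lt_top.ne ?_
  refine setLIntegral_mono' measurableSet_Ioc fun z hz => ?_
  have h4 := hC (1 - z) ⟨by linarith [hz.2], by linarith [hz.1]⟩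
  rw [div_one, ← ENNReal.ofReal_mul' (inv_nonneg.2 (by linarith [hz.1])), sub_sub_cancel]
  rw [sub_sub_cancel] at h4
  refine ENNReal.ofReal_le_ofReal ?_
  rw [Real.rpow_sub_one hz.1.ne', ← mul_div_assoc, ← div_eq_mul_inv]
  exact div_le_div_of_nonneg_right h4 hz.1.le

end Lattice

section Transfer

variable {α β γ H ρ ρ' ε p q : ℝ} {lam N L c : ℕ → ℝ}

lemma rectSum_toReal {lam N L c : ℝ} (hN : 0 < N) (hc : 0 < c) (l m : ℤ) (u v : ℝ) {z : ℝ}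
    (hz : z ∈ Ioc 0 N) :
    ∑ t ∈ Finset.Icc 1 l, ∑ s ∈ Finset.Icc 1 m,
      (greenE (t - ⌊lam * u⌋) (s - ⌊L * v⌋) (1 - z / N)).toReal =
        N / c * (rectSum lam N L c l m u v z).toReal := by
  obtain ⟨h0, h1⟩ := scaled_param_mem hN hz.1 hz.2
  have hne : ∀ t s, greenE t s (1 - z / N) ≠ ∞ := fun t s =>
    ne_top_of_le_ne_top (by simp) (greenE_le h0 h1 t s)
  rw [rectSum, ENNReal.toReal_mul, ENNReal.toReal_ofReal (by positivity), ENNReal.toReal_sum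
    (fun t _ => ENNReal.sum_ne_top.2 fun s _ => hne _ _)]
  simp only [fun t => ENNReal.toReal_sum (s := Finset.Icc 1 m) fun s _ =>
    hne (t - ⌊lam * u⌋) (s - ⌊L * v⌋)]
  field_simp

/-- The energy of a linear combination of normalised partial sums of the aggregated field, in
rescaled coordinates. -/
lemma ScalingRegime.energy_eq (R : ScalingRegime α β γ H ρ ρ' ε p q lam N L c) (hα : 1 < α)
    {φ : ℝ → ℝ} (hφ : Measurable φ) {ι : Type*} [Fintype ι] (θ : ι → ℝ) (l m : ι → ℤ) (n : ℕ) :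
    energy α (latticeControl φ) (fun e => ∑ i, θ i * (lam n ^ (-H) *
      ∑ t ∈ Finset.Icc 1 (l i), ∑ s ∈ Finset.Icc 1 (m i), aggregatedKernel (t, s) e)) =
    ∫⁻ e : ℝ × ℝ × ℝ, ‖∑ i, θ i * (rectSum (lam n) (N n) (L n) (c n) (l i) (m i)
      e.1 e.2.1 e.2.2).toReal‖ₑ ^ α * scaledDensity β φ (N n) e.2.2 := by
  have hlam := R.lam_pos n
  have hN := R.N_pos n
  have hL := R.L_pos n
  have hc := R.c_pos n
  set G : (ℤ × ℤ) × ℝ → ℝ≥0∞ := fun e => ‖∑ i, θ i * (lam n ^ (-H) *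
      ∑ t ∈ Finset.Icc 1 (l i), ∑ s ∈ Finset.Icc 1 (m i),
        (greenE (t - e.1.1) (s - e.1.2) e.2).toReal)‖ₑ ^ α with hG
  have hGm : Measurable G := by
    refine (Measurable.enorm ?_).pow_const _
    refine Finset.measurable_sum _ fun i _ => Measurable.const_mul (Measurable.const_mul
      (Finset.measurable_sum _ fun t _ => Finset.measurable_sum _ fun s _ => ?_) _) _
    exact (measurable_greenE_sub (t, s)).ennreal_toReal
  have h1 : energy α (latticeControl φ) (fun e => ∑ i, θ i * (lam n ^ (-H) *
      ∑ t ∈ Finset.Icc 1 (l i), ∑ s ∈ Finset.Icc 1 (m i), aggregatedKernel (t, s) e)) =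
      ∫⁻ e, G e ∂(latticeControl φ) := by
    refine lintegral_congr_ae ?_
    filter_upwards [ae_latticeControl_mem φ] with e he
    simp only [aggregatedKernel_eq _ he, hG]
  set F : ℤ → ℤ → ℝ → ℝ≥0∞ := fun j k z => (Ioc 0 (N n)).indicator
    (fun z => ENNReal.ofReal (φ (1 - z / N n)) * G ((j, k), 1 - z / N n)) z with hF
  have h2 : ∫⁻ e, G e ∂(latticeControl φ) =
      ∑' j, ∑' k, ENNReal.ofReal (N n)⁻¹ * ∫⁻ z, F j k z := by
    rw [lintegral_latticeControl hφ hGm]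
    refine tsum_congr fun j => tsum_congr fun k => ?_
    exact lintegral_Ico_one_sub (fun a => ENNReal.ofReal (φ a) * G ((j, k), a)) hN
  set κ : ℝ := lam n * L n * (N n)⁻¹ with hκ
  have h3 : ∫⁻ e, G e ∂(latticeControl φ) = ENNReal.ofReal κ *
      ∫⁻ u : ℝ, ∫⁻ v : ℝ, ∫⁻ z, F ⌊lam n * u⌋ ⌊L n * v⌋ z := by
    rw [h2]
    simp only [fun j => lintegral_comp_floor (fun k => ∫⁻ z, F j k z) hL]
    rw [lintegral_comp_floor (fun j => ENNReal.ofReal (L n)⁻¹ * ∑' k, ∫⁻ z, F j k z) hlam]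
    simp only [ENNReal.tsum_mul_left, ← mul_assoc]
    rw [← ENNReal.ofReal_mul (by positivity), ← ENNReal.ofReal_mul (by positivity)]
    congr 2
    rw [hκ]
    field_simp
  have hrsm : ∀ i, Measurable fun e : ℝ × ℝ × ℝ =>
      rectSum (lam n) (N n) (L n) (c n) (l i) (m i) e.1 e.2.1 e.2.2 := fun i =>
    measurable_rectSum _ _ _ _ _ _
  set Φ : ℝ × ℝ × ℝ → ℝ≥0∞ := fun e => ‖∑ i, θ i * (rectSum (lam n) (N n) (L n) (c n) (l i) (m i)
      e.1 e.2.1 e.2.2).toReal‖ₑ ^ α * scaledDensity β φ (N n) e.2.2 with hΦ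
  have hΦm : Measurable Φ := by
    refine Measurable.mul ((Measurable.enorm ?_).pow_const _)
      ((measurable_scaledDensity hφ β (N n)).comp measurable_snd.snd)
    exact Finset.measurable_sum _ fun i _ => (hrsm i).ennreal_toReal.const_mul _
  have h4 : ∫⁻ e, Φ e = ∫⁻ u, ∫⁻ v, ∫⁻ z, Φ (u, v, z) := by
    rw [Measure.volume_eq_prod, lintegral_prod _ hΦm.aemeasurable]
    refine lintegral_congr fun u => ?_
    rw [Measure.volume_eq_prod, lintegral_prod]
    exact (hΦm.comp measurable_prodMk_left).aemeasurable
  rw [h1, h3, h4, ← lintegral_const_mul' _ _ ENNReal.ofReal_ne_top]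
  refine lintegral_congr fun u => ?_
  rw [← lintegral_const_mul' _ _ ENNReal.ofReal_ne_top]
  refine lintegral_congr fun v => ?_
  rw [← lintegral_const_mul' _ _ ENNReal.ofReal_ne_top]
  refine lintegral_congr fun z => ?_
  simp only [hF, hΦ, scaledDensity]
  by_cases hz : z ∈ Ioc 0 (N n)
  · rw [indicator_of_mem hz, indicator_of_mem hz]
    set τ : ℝ := lam n ^ (-H) * N n / c n with hτ
    have hτ0 : 0 < τ := div_pos (mul_pos (Real.rpow_pos_of_pos hlam _) hN) hc
    have hGz : G ((⌊lam n * u⌋, ⌊L n * v⌋), 1 - z / N n) = ENNReal.ofReal (τ ^ α) *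
        ‖∑ i, θ i * (rectSum (lam n) (N n) (L n) (c n) (l i) (m i) u v z).toReal‖ₑ ^ α := by
      rw [hG, ← ENNReal.ofReal_rpow_of_nonneg hτ0.le (by linarith),
        ← ENNReal.mul_rpow_of_nonneg _ _ (by linarith), ← Real.enorm_of_nonneg hτ0.le, ← enorm_mul]
      dsimp only
      congr 2
      rw [Finset.mul_sum]
      refine Finset.sum_congr rfl fun i _ => ?_
      rw [rectSum_toReal hN hc (l i) (m i) u v hz, hτ]
      ring
    have hconst : κ * τ ^ α = N n ^ β := by
      have h := R.norm n
      rw [Real.rpow_neg hN.le, ← div_eq_mul_inv, div_eq_one_iff_eq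
        (Real.rpow_pos_of_pos hN _).ne'] at h
      rw [hκ, hτ, ← h, div_eq_mul_inv (lam n * L n)]
    rw [hGz, ← hconst, mul_assoc κ, ENNReal.ofReal_mul (p := κ) (by positivity),
      ENNReal.ofReal_mul (p := τ ^ α) (by positivity)]
    ring
  · rw [indicator_of_notMem hz, indicator_of_notMem hz, mul_zero, mul_zero]

end Transfer

/-! ### The kernels of the limit fields -/

section Kernels

lemma lintegral_h3_ne_top (w : ℝ) {z : ℝ} (hz : 0 < z) :
    ∫⁻ s, ENNReal.ofReal (h3 w s z) ≠ ∞ := by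
  rcases le_or_gt w 0 with hw | hw
  · simp [h3_of_nonpos hw]
  · rw [lintegral_h3 hw hz]; exact ENNReal.ofReal_ne_top

lemma lintegral_h3_left_ne_top (s : ℝ) {z : ℝ} (hz : 0 < z) :
    ∫⁻ w, ENNReal.ofReal (h3 w s z) ≠ ∞ := by
  have h1 := lintegral_inv_sqrt_mul_exp (z := 8 * z) (by positivity)
  rw [← lintegral_indicator measurableSet_Ioi] at h1
  refine ne_top_of_le_ne_top (h1 ▸ ENNReal.ofReal_ne_top) (lintegral_mono fun w => ?_)
  rcases le_or_gt w 0 with hw | hw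
  · simp [h3_of_nonpos hw]
  rw [indicator_of_mem (mem_Ioi.2 hw)]
  refine ENNReal.ofReal_le_ofReal ?_
  rw [h3, if_pos ⟨hw, hz⟩]
  have hsw := Real.sqrt_pos.2 hw
  refine mul_le_mul ?_ ?_ (by positivity) (by positivity)
  · rw [div_le_div_iff₀ (by have := Real.pi_pos; positivity) hsw, Real.sqrt_mul Real.pi_pos.le]
    have h2 : 1 ≤ Real.sqrt Real.pi := Real.one_le_sqrt.2 (by linarith [Real.pi_gt_three])
    nlinarith
  · refine Real.exp_le_exp.2 ?_
    have : 0 ≤ s ^ 2 / (4 * w) := by positivity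
    linarith

lemma measurable_h3_left (s z : ℝ) : Measurable fun w => ENNReal.ofReal (h3 w s z) :=
  (measurable_h3.comp (by fun_prop : Measurable fun w : ℝ => (w, s, z))).ennreal_ofReal

lemma integral_h3_right (w z : ℝ) :
    ∫ s, h3 w s z = (∫⁻ s, ENNReal.ofReal (h3 w s z)).toReal := by
  rw [← integral_toReal (measurable_h3_right w z).aemeasurable (by simp)]
  simp only [ENNReal.toReal_ofReal (h3_nonneg _ _ _)]

lemma integral_h3_left (s z : ℝ) :
    ∫ w, h3 w s z = (∫⁻ w, ENNReal.ofReal (h3 w s z)).toReal := by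
  rw [← integral_toReal (measurable_h3_left s z).aemeasurable (by simp)]
  simp only [ENNReal.toReal_ofReal (h3_nonneg _ _ _)]

/-- Interval integrals over a shifted interval, as Lebesgue integrals with values in `[0, ∞]`. -/
lemma intervalIntegral_toReal_sub {G : ℝ → ℝ≥0∞} (hG : Measurable G) (hfin : ∀ w, G w ≠ ∞) {x : ℝ}
    (hx : 0 ≤ x) (u : ℝ) : ∫ t in (0 : ℝ)..x, (G (t - u)).toReal =
      (∫⁻ w, (Ioc 0 x).indicator 1 (w + u) * G w).toReal := by
  have hm : Measurable fun t => G (t - u) := hG.comp (measurable_id.sub_const u)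
  rw [intervalIntegral.integral_of_le hx, integral_toReal hm.aemeasurable
    (Eventually.of_forall fun t => (hfin _).lt_top), ← lintegral_indicator measurableSet_Ioc,
    ← lintegral_add_right_eq_self _ u]
  congr 1
  refine lintegral_congr fun w => ?_
  by_cases h : w + u ∈ Ioc 0 x
  · rw [indicator_of_mem h, indicator_of_mem h, add_sub_cancel_right, Pi.one_apply, one_mul]
  · rw [indicator_of_notMem h, indicator_of_notMem h, zero_mul]

lemma limitLevel_one (ρ' : ℝ) (J : Set ℝ) (w v z : ℝ) : limitLevel ρ' 1 J w v z =
    ∫⁻ s, J.indicator 1 (ρ' * s + v) * ENNReal.ofReal (h3 w s z) := by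
  simp [limitLevel]

lemma limitLevel_zero {J : Set ℝ} (hJ : MeasurableSet J) (w v z : ℝ) : limitLevel 1 0 J w v z =
    volume J * ENNReal.ofReal (h3 w v z) := by
  simp only [limitLevel, one_mul, zero_mul, add_zero, zero_add, sub_zero]
  rw [lintegral_mul_const' _ _ ENNReal.ofReal_ne_top, lintegral_indicator_one hJ]

lemma limitLevel_one_ne_top (ρ' : ℝ) (J : Set ℝ) (w v : ℝ) {z : ℝ} (hz : 0 < z) :
    limitLevel ρ' 1 J w v z ≠ ∞ := by
  rw [limitLevel_one]
  refine ne_top_of_le_ne_top (lintegral_h3_ne_top w hz) (lintegral_mono fun s => ?_)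
  by_cases h : ρ' * s + v ∈ J
  · rw [indicator_of_mem h, Pi.one_apply, one_mul]
  · rw [indicator_of_notMem h, zero_mul]; exact zero_le

variable {α β γ : ℝ}

lemma limitKernel_eq_half {p : ℝ × ℝ} (hp : p ∈ closedQuadrant) {e : ℝ × ℝ × ℝ}
    (hz : 0 < e.2.2) : limitKernel α β (1 / 2) p e =
      (limitRect 1 1 1 (Ioc 0 p.1) (Ioc 0 p.2) e).toReal := by
  obtain ⟨u, v, z⟩ := e
  have h1 : ∀ w, ∫ s in (0 : ℝ)..p.2, h3 w (s - v) z =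
      (limitLevel 1 1 (Ioc 0 p.2) w v z).toReal := by
    intro w
    have := intervalIntegral_toReal_sub (measurable_h3_right w z) (by simp) hp.2 v
    simp only [ENNReal.toReal_ofReal (h3_nonneg _ _ _)] at this
    rw [this, limitLevel_one]
    simp only [one_mul]
  have hm : Measurable fun w => limitLevel 1 1 (Ioc 0 p.2) w v z :=
    (measurable_limitLevel measurableSet_Ioc 1 1).comp
      (by fun_prop : Measurable fun w : ℝ => (w, v, z))
  rw [limitKernel, if_pos rfl]
  simp only [h1]
  rw [intervalIntegral_toReal_sub hm (fun w => limitLevel_one_ne_top _ _ _ _ hz) hp.1]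
  simp only [limitRect, one_mul]

lemma limitKernel_eq_of_half_lt (hγ : 1 / 2 < γ) {p : ℝ × ℝ} (hp : p ∈ closedQuadrant)
    {e : ℝ × ℝ × ℝ} (hz : 0 < e.2.2) (hv : e.2.1 ≠ p.2) : limitKernel α β γ p e =
      (limitRect 1 0 1 (Ioc 0 p.1) (Ioc 0 p.2) e).toReal := by
  obtain ⟨u, v, z⟩ := e
  have hm : Measurable fun w => ∫⁻ s, ENNReal.ofReal (h3 w s z) :=
    Measurable.lintegral_prod_right' (f := fun q : ℝ × ℝ => ENNReal.ofReal (h3 q.1 q.2 z))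
      (measurable_h3.comp (by fun_prop : Measurable fun q : ℝ × ℝ => (q.1, q.2, z))).ennreal_ofReal
  have h1 := intervalIntegral_toReal_sub hm (fun w => lintegral_h3_ne_top w hz) hp.1 u
  have h2 : ∀ w, limitLevel 0 1 (Ioc 0 p.2) w v z = (Ioc 0 p.2).indicator 1 v *
      ∫⁻ s, ENNReal.ofReal (h3 w s z) := by
    intro w
    rw [limitLevel_one]
    simp only [zero_mul, zero_add]
    rw [lintegral_const_mul _ (measurable_h3_right w z)]
  rw [limitKernel, if_neg hγ.ne', if_pos hγ]
  simp only [integral_h3_right, h1, limitRect, h2, one_mul]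
  by_cases h : v ∈ Ioc 0 p.2
  · rw [if_pos ⟨h.1, lt_of_le_of_ne h.2 hv⟩, indicator_of_mem h, Pi.one_apply]
    simp only [one_mul]
  · rw [if_neg (fun h' => h ⟨h'.1, h'.2.le⟩), indicator_of_notMem h]
    simp

lemma limitKernel_eq_of_lt_beta (hγ : γ < 1 / 2) (hβ : (α - 1) / 2 < β) {p : ℝ × ℝ}
    (hp : p ∈ closedQuadrant) {e : ℝ × ℝ × ℝ} (hz : 0 < e.2.2) (hu : e.1 ≠ p.1) :
    limitKernel α β γ p e = (limitRect 0 1 1 (Ioc 0 p.1) (Ioc 0 p.2) e).toReal := by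
  obtain ⟨u, v, z⟩ := e
  have hm2 : Measurable fun q : ℝ × ℝ => ENNReal.ofReal (h3 q.2 q.1 z) :=
    (measurable_h3.comp (by fun_prop : Measurable fun q : ℝ × ℝ => (q.2, q.1, z))).ennreal_ofReal
  have hm : Measurable fun s => ∫⁻ w, ENNReal.ofReal (h3 w s z) :=
    Measurable.lintegral_prod_right' (f := fun q : ℝ × ℝ => ENNReal.ofReal (h3 q.2 q.1 z)) hm2
  have h1 := intervalIntegral_toReal_sub hm (fun s => lintegral_h3_left_ne_top s hz) hp.2 v
  have h2 : ∫⁻ w, limitLevel 1 1 (Ioc 0 p.2) w v z = ∫⁻ s, (Ioc 0 p.2).indicator 1 (s + v) *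
      ∫⁻ w, ENNReal.ofReal (h3 w s z) := by
    simp only [limitLevel_one, one_mul]
    rw [lintegral_lintegral_swap]
    · refine lintegral_congr fun s => ?_
      rw [lintegral_const_mul _ (measurable_h3_left s z)]
    · refine Measurable.aemeasurable (Measurable.mul ?_ ?_)
      · exact (measurable_one.indicator measurableSet_Ioc).comp
          (by fun_prop : Measurable fun q : ℝ × ℝ => q.2 + v)
      · exact hm2.comp measurable_swap
  have hsym : ∀ s, ∫ w, h3 w (v - s) z = (∫⁻ w, ENNReal.ofReal (h3 w (s - v) z)).toReal := by
    intro s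
    rw [integral_h3_left, ← neg_sub s v]
    simp only [h3_neg]
  have hm3 : Measurable fun w => limitLevel 1 1 (Ioc 0 p.2) w v z :=
    (measurable_limitLevel measurableSet_Ioc 1 1).comp
      (by fun_prop : Measurable fun w : ℝ => (w, v, z))
  rw [limitKernel, if_neg hγ.ne, if_neg hγ.not_gt, if_pos hβ]
  simp only [hsym, h1, limitRect, zero_mul, zero_add]
  rw [lintegral_const_mul _ hm3, h2]
  by_cases h : u ∈ Ioc 0 p.1
  · rw [if_pos ⟨h.1, lt_of_le_of_ne h.2 hu⟩, indicator_of_mem h, Pi.one_apply, one_mul, one_mul]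
  · rw [if_neg (fun h' => h ⟨h'.1, h'.2.le⟩), indicator_of_notMem h]
    simp

lemma limitKernel_eq_of_beta_lt (hγ : γ < 1 / 2) (hβ : β < (α - 1) / 2) {p : ℝ × ℝ}
    (hp : p ∈ closedQuadrant) {e : ℝ × ℝ × ℝ} :
    limitKernel α β γ p e = (limitRect 1 1 0 (Ioc 0 p.1) (Ioc 0 p.2) e).toReal := by
  obtain ⟨u, v, z⟩ := e
  have h1 := intervalIntegral_toReal_sub (measurable_h3_left v z) (by simp) hp.1 u
  simp only [ENNReal.toReal_ofReal (h3_nonneg _ _ _)] at h1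
  rw [limitKernel, if_neg hγ.ne, if_neg hγ.not_gt, if_neg hβ.not_gt]
  simp only [h1, limitRect, limitLevel_zero measurableSet_Ioc, one_mul, Real.volume_Ioc, sub_zero,
    mul_left_comm _ (ENNReal.ofReal p.2)]
  rw [lintegral_const_mul' _ _ ENNReal.ofReal_ne_top, ENNReal.toReal_mul,
    ENNReal.toReal_ofReal hp.2]

end Kernels

section Increments

variable {ρ ρ' ε : ℝ}

lemma indicator_one_Ioc_add {a b c : ℝ} (hab : a ≤ b) (hbc : b ≤ c) (r : ℝ) :
    (Ioc a c).indicator (1 : ℝ → ℝ≥0∞) r = (Ioc a b).indicator 1 r + (Ioc b c).indicator 1 r := by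
  rw [← Ioc_union_Ioc_eq_Ioc hab hbc, indicator_union_of_disjoint
    (Ioc_disjoint_Ioc_of_le le_rfl)]

lemma limitRect_add_left {a b c : ℝ} (hab : a ≤ b) (hbc : b ≤ c) {J : Set ℝ} (hJ : MeasurableSet J)
    (e : ℝ × ℝ × ℝ) : limitRect ρ ρ' ε (Ioc a c) J e =
      limitRect ρ ρ' ε (Ioc a b) J e + limitRect ρ ρ' ε (Ioc b c) J e := by
  unfold limitRect
  rw [← lintegral_add_left]
  · simp only [indicator_one_Ioc_add hab hbc, add_mul]
  · exact ((measurable_one.indicator measurableSet_Ioc).comp (by fun_prop)).mul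
      ((measurable_limitLevel hJ ρ' ε).comp
        (by fun_prop : Measurable fun w : ℝ => (w, e.2.1, e.2.2)))

lemma limitLevel_add {a b c : ℝ} (hab : a ≤ b) (hbc : b ≤ c) (w v z : ℝ) :
    limitLevel ρ' ε (Ioc a c) w v z =
      limitLevel ρ' ε (Ioc a b) w v z + limitLevel ρ' ε (Ioc b c) w v z := by
  unfold limitLevel
  rw [← lintegral_add_left]
  · simp only [indicator_one_Ioc_add hab hbc, add_mul]
  · exact ((measurable_one.indicator measurableSet_Ioc).comp (by fun_prop)).mul
      ((measurable_h3_right w z).comp (by fun_prop))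

lemma limitRect_add_right {a b c : ℝ} (hab : a ≤ b) (hbc : b ≤ c) {I : Set ℝ}
    (hI : MeasurableSet I) (e : ℝ × ℝ × ℝ) : limitRect ρ ρ' ε I (Ioc a c) e =
      limitRect ρ ρ' ε I (Ioc a b) e + limitRect ρ ρ' ε I (Ioc b c) e := by
  unfold limitRect
  rw [← lintegral_add_left]
  · simp only [limitLevel_add hab hbc, mul_add]
  · exact ((measurable_one.indicator hI).comp (by fun_prop)).mul
      ((measurable_limitLevel measurableSet_Ioc ρ' ε).comp
        (by fun_prop : Measurable fun w : ℝ => (w, e.2.1, e.2.2)))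

/-- The kernel of a rectangular increment. -/
lemma limitRect_rectIncrement {p q : ℝ × ℝ} (hp : p ∈ closedQuadrant) (h1 : p.1 ≤ q.1)
    (h2 : p.2 ≤ q.2) {e : ℝ × ℝ × ℝ} (hfin : limitRect ρ ρ' ε (Ioc 0 q.1) (Ioc 0 q.2) e ≠ ∞) :
    (limitRect ρ ρ' ε (Ioc p.1 q.1) (Ioc p.2 q.2) e).toReal =
      (limitRect ρ ρ' ε (Ioc 0 q.1) (Ioc 0 q.2) e).toReal -
      (limitRect ρ ρ' ε (Ioc 0 p.1) (Ioc 0 q.2) e).toReal -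
      (limitRect ρ ρ' ε (Ioc 0 q.1) (Ioc 0 p.2) e).toReal +
      (limitRect ρ ρ' ε (Ioc 0 p.1) (Ioc 0 p.2) e).toReal := by
  have e1 := limitRect_add_left (ρ := ρ) (ρ' := ρ') (ε := ε) hp.1 h1
    (measurableSet_Ioc (a := (0 : ℝ)) (b := q.2)) e
  have e2 := limitRect_add_right (ρ := ρ) (ρ' := ρ') (ε := ε) hp.2 h2
    (measurableSet_Ioc (a := p.1) (b := q.1)) e
  have e3 := limitRect_add_left (ρ := ρ) (ρ' := ρ') (ε := ε) hp.1 h1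
    (measurableSet_Ioc (a := (0 : ℝ)) (b := p.2)) e
  have e4 := limitRect_add_right (ρ := ρ) (ρ' := ρ') (ε := ε) hp.2 h2
    (measurableSet_Ioc (a := (0 : ℝ)) (b := q.1)) e
  have f0 := hfin
  rw [e1] at f0
  obtain ⟨f1, f2⟩ := ENNReal.add_ne_top.1 f0
  rw [e2] at f2
  obtain ⟨f3, f4⟩ := ENNReal.add_ne_top.1 f2
  have f5 := hfin
  rw [e4] at f5
  have f6 := (ENNReal.add_ne_top.1 f5).1
  rw [e3] at f6
  rw [e1, e2, e3, ENNReal.toReal_add f1 f2, ENNReal.toReal_add f3 f4,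
    ENNReal.toReal_add (ENNReal.add_ne_top.1 f6).1 f3]
  ring

lemma limitRect_ne_top_of_subset {I I' J J' : Set ℝ} (hI : I ⊆ I') (hJ : J ⊆ J') {e : ℝ × ℝ × ℝ}
    (h : limitRect ρ ρ' ε I' J' e ≠ ∞) : limitRect ρ ρ' ε I J e ≠ ∞ := by
  refine ne_top_of_le_ne_top h (lintegral_mono fun w => mul_le_mul' ?_ (lintegral_mono fun s =>
    mul_le_mul_left ?_ _))
  · exact indicator_le_indicator_of_subset hI (fun _ => zero_le) _
  · exact indicator_le_indicator_of_subset hJ (fun _ => zero_le) _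

lemma indicator_one_Ioc_sub (a b c r : ℝ) : (Ioc (a - c) (b - c)).indicator (1 : ℝ → ℝ≥0∞) r =
    (Ioc a b).indicator 1 (r + c) := by
  simp only [indicator, mem_Ioc, sub_lt_iff_lt_add, le_sub_iff_add_le, Pi.one_apply]

lemma limitLevel_shift (h : ε = 1 ∨ (ρ' = 1 ∧ ε = 0)) (a b c w v z : ℝ) :
    limitLevel ρ' ε (Ioc a b) w v z = limitLevel ρ' ε (Ioc (a - c) (b - c)) w (v - ε * c) z := by
  rcases h with rfl | ⟨rfl, rfl⟩
  · simp only [limitLevel_one, indicator_one_Ioc_sub]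
    refine lintegral_congr fun s => ?_
    congr 2; ring
  · rw [limitLevel_zero measurableSet_Ioc, limitLevel_zero measurableSet_Ioc, zero_mul, sub_zero,
      Real.volume_Ioc, Real.volume_Ioc, sub_sub_sub_cancel_right]

lemma limitRect_shift (h : ε = 1 ∨ (ρ' = 1 ∧ ε = 0)) (p q r : ℝ × ℝ) (e : ℝ × ℝ × ℝ) :
    limitRect ρ ρ' ε (Ioc p.1 q.1) (Ioc p.2 q.2) e =
      limitRect ρ ρ' ε (Ioc (p.1 - r.1) (q.1 - r.1)) (Ioc (p.2 - r.2) (q.2 - r.2))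
        (e - (r.1, ε * r.2, 0)) := by
  unfold limitRect
  refine lintegral_congr fun w => ?_
  rw [indicator_one_Ioc_sub, limitLevel_shift h _ _ r.2]
  simp only [Prod.fst_sub, Prod.snd_sub, sub_zero]
  congr 2; ring

end Increments

section Control

variable {α β φ₁ : ℝ}

lemma ae_limitControl_of_ae {P : ℝ × ℝ × ℝ → Prop} (h : ∀ᵐ e : ℝ × ℝ × ℝ, 0 < e.2.2 → P e) :
    ∀ᵐ e ∂(limitControl β φ₁), P e := by
  refine (withDensity_absolutelyContinuous _ _).ae_le ?_
  have hm : MeasurableSet {e : ℝ × ℝ × ℝ | 0 < e.2.2} :=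
    measurableSet_lt measurable_const measurable_snd.snd
  exact (ae_restrict_iff' hm).2 h

lemma lintegral_limitControl {F : ℝ × ℝ × ℝ → ℝ≥0∞} (hF : Measurable F) :
    ∫⁻ e, F e ∂(limitControl β φ₁) = ∫⁻ e, F e * limitDensity β φ₁ e.2.2 := by
  have hm : MeasurableSet {e : ℝ × ℝ × ℝ | 0 < e.2.2} :=
    measurableSet_lt measurable_const measurable_snd.snd
  rw [limitControl, lintegral_withDensity_eq_lintegral_mul _ (by fun_prop) hF,
    ← lintegral_indicator hm]
  refine lintegral_congr fun e => ?_
  by_cases h : 0 < e.2.2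
  · rw [indicator_of_mem (s := {e : ℝ × ℝ × ℝ | 0 < e.2.2}) h, limitDensity,
      indicator_of_mem (mem_Ioi.2 h), mul_comm]
    rfl
  · rw [indicator_of_notMem (s := {e : ℝ × ℝ × ℝ | 0 < e.2.2}) h, limitDensity,
      indicator_of_notMem (s := Ioi 0) h, mul_zero]

lemma energy_limitControl {f : ℝ × ℝ × ℝ → ℝ} (hf : Measurable f) :
    energy α (limitControl β φ₁) f = ∫⁻ e, ‖f e‖ₑ ^ α * limitDensity β φ₁ e.2.2 :=
  lintegral_limitControl (hf.enorm.pow_const _)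

/-- The control measure of the limit fields is invariant under translations of the plane. -/
lemma energy_limitControl_sub {f : ℝ × ℝ × ℝ → ℝ} (hf : Measurable f) (a b : ℝ) :
    energy α (limitControl β φ₁) (fun e => f (e - (a, b, 0))) =
      energy α (limitControl β φ₁) f := by
  have hm : Measurable fun e => f (e - (a, b, 0)) := hf.comp (by fun_prop)
  have : (volume : Measure (ℝ × ℝ × ℝ)).IsAddLeftInvariant :=
    Measure.prod.instIsAddLeftInvariant (ν := (volume : Measure (ℝ × ℝ)))
  rw [energy_limitControl hm, energy_limitControl hf,
    ← lintegral_sub_right_eq_self (fun e => ‖f e‖ₑ ^ α * limitDensity β φ₁ e.2.2) (a, b, 0)]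
  simp only [Prod.snd_sub, sub_zero]

lemma limitControl_pos (hφ₁ : 0 < φ₁) {S : Set (ℝ × ℝ × ℝ)} (hS : MeasurableSet S)
    (hSz : ∀ e ∈ S, 0 < e.2.2) (h0 : volume S ≠ 0) : limitControl β φ₁ S ≠ 0 := by
  intro h
  have h1 : ∫⁻ e, S.indicator 1 e ∂(limitControl β φ₁) = 0 := by
    rw [lintegral_indicator_one hS, h]
  have hm : Measurable fun e : ℝ × ℝ × ℝ =>
      S.indicator (1 : ℝ × ℝ × ℝ → ℝ≥0∞) e * limitDensity β φ₁ e.2.2 :=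
    (measurable_one.indicator hS).mul ((measurable_limitDensity β φ₁).comp measurable_snd.snd)
  rw [lintegral_limitControl (measurable_one.indicator hS), lintegral_eq_zero_iff hm] at h1
  refine h0 (measure_eq_zero_iff_ae_notMem.2 ?_)
  filter_upwards [h1] with e he hmem
  have hz := hSz e hmem
  rw [Pi.zero_apply, indicator_of_mem hmem, Pi.one_apply, one_mul, limitDensity,
    indicator_of_mem (mem_Ioi.2 hz), ENNReal.ofReal_eq_zero] at he
  exact absurd he (not_le.2 (mul_pos hφ₁ (Real.rpow_pos_of_pos hz _)))

end Control

/-! ### Scaling limits of the aggregated field -/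

section ScalingLimit

/-- The hypotheses on the mixing density. -/
structure IsMixingDensity (β φ₁ : ℝ) (φ : ℝ → ℝ) : Prop where
  measurable : Measurable φ
  bdd : ∃ C : ℝ, ∀ a ∈ Ico (0 : ℝ) 1, φ a ≤ C
  beta_pos : 0 < β
  coeff_pos : 0 < φ₁
  asymp : Asymptotics.IsEquivalent (𝓝[<] (1 : ℝ)) φ (fun a => φ₁ * (1 - a) ^ β)

/-- The limit kernels in the regime `(ρ, ρ', ε)`: they are the functions `limitRect`, up to null
sets, and belong to `L^α`. -/
structure LimitRegime (α β φ₁ γ ρ ρ' ε : ℝ) : Prop where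
  eps : ε = 1 ∨ (ρ' = 1 ∧ ε = 0)
  kernel_eq : ∀ p ∈ closedQuadrant, ∀ᵐ e : ℝ × ℝ × ℝ, 0 < e.2.2 →
    limitKernel α β γ p e = (limitRect ρ ρ' ε (Ioc 0 p.1) (Ioc 0 p.2) e).toReal
  ne_top : ∀ p ∈ closedQuadrant, ∀ᵐ e : ℝ × ℝ × ℝ, 0 < e.2.2 →
    limitRect ρ ρ' ε (Ioc 0 p.1) (Ioc 0 p.2) e ≠ ∞
  memLp : ∀ p ∈ closedQuadrant,
    MemLp (limitKernel α β γ p) (ENNReal.ofReal α) (limitControl β φ₁)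

variable {α β γ φ₁ H ρ ρ' ε p q : ℝ} {φ : ℝ → ℝ} {lam N L c : ℕ → ℝ}

lemma measurable_limitRect_toReal (ρ ρ' ε a b c d : ℝ) :
    Measurable fun e => (limitRect ρ ρ' ε (Ioc a b) (Ioc c d) e).toReal :=
  (measurable_limitRect measurableSet_Ioc measurableSet_Ioc ρ ρ' ε).ennreal_toReal

lemma energy_sum_limitKernel {ι : Type*} [Fintype ι] (hk : ∀ p ∈ closedQuadrant,
      ∀ᵐ e : ℝ × ℝ × ℝ, 0 < e.2.2 →
        limitKernel α β γ p e = (limitRect ρ ρ' ε (Ioc 0 p.1) (Ioc 0 p.2) e).toReal)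
    (θ : ι → ℝ) (r : ι → ℝ × ℝ) (hr : ∀ i, r i ∈ closedQuadrant) :
    energy α (limitControl β φ₁) (fun e => ∑ i, θ i * limitKernel α β γ (r i) e) =
      ∫⁻ e : ℝ × ℝ × ℝ, ‖∑ i, θ i *
        (limitRect ρ ρ' ε (Ioc 0 (r i).1) (Ioc 0 (r i).2) e).toReal‖ₑ ^ α *
          limitDensity β φ₁ e.2.2 := by
  have hm : Measurable fun e => ∑ i, θ i *
      (limitRect ρ ρ' ε (Ioc 0 (r i).1) (Ioc 0 (r i).2) e).toReal :=
    Finset.measurable_sum _ fun i _ => (measurable_limitRect_toReal _ _ _ _ _ _ _).const_mul _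
  rw [← energy_limitControl hm]
  refine lintegral_congr_ae ?_
  filter_upwards [ae_limitControl_of_ae (β := β) (φ₁ := φ₁)
    ((ae_all_iff.2 fun i => hk (r i) (hr i)).mono fun e he hz i => he i hz)] with e he
  simp only [he]

namespace ScalingRegime

lemma tendsto_energy (R : ScalingRegime α β γ H ρ ρ' ε p q lam N L c) (hα : 1 < α) (hγ : 0 < γ)
    (hφ : IsMixingDensity β φ₁ φ) (hk : ∀ p ∈ closedQuadrant, ∀ᵐ e : ℝ × ℝ × ℝ, 0 < e.2.2 →
      limitKernel α β γ p e = (limitRect ρ ρ' ε (Ioc 0 p.1) (Ioc 0 p.2) e).toReal)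
    {ι : Type*} [Fintype ι] (θ : ι → ℝ) (r : ι → ℝ × ℝ) (hr : ∀ i, r i ∈ closedQuadrant) :
    Tendsto (fun n => energy α (latticeControl φ) (fun e => ∑ i, θ i * (lam n ^ (-H) *
      ∑ t ∈ Finset.Icc 1 ⌊lam n * (r i).1⌋, ∑ s ∈ Finset.Icc 1 ⌊lam n ^ γ * (r i).2⌋,
        aggregatedKernel (t, s) e))) atTop
      (𝓝 (energy α (limitControl β φ₁) (fun e => ∑ i, θ i * limitKernel α β γ (r i) e))) := by
  simp only [R.energy_eq hα hφ.measurable θ, energy_sum_limitKernel hk θ r hr]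
  exact (R.tendsto_lintegral_sum hα hγ hφ.measurable hφ.coeff_pos hφ.beta_pos hφ.bdd hφ.asymp θ
    (fun i => (r i).1) (fun i => (r i).2) (fun i => (hr i).1) fun i => (hr i).2).1

lemma limitRegime (R : ScalingRegime α β γ H ρ ρ' ε p q lam N L c) (hα : 1 < α) (hγ : 0 < γ)
    (hφ : IsMixingDensity β φ₁ φ) (hk : ∀ p ∈ closedQuadrant, ∀ᵐ e : ℝ × ℝ × ℝ, 0 < e.2.2 →
      limitKernel α β γ p e = (limitRect ρ ρ' ε (Ioc 0 p.1) (Ioc 0 p.2) e).toReal) :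
    LimitRegime α β φ₁ γ ρ ρ' ε where
  eps := R.eps
  kernel_eq := hk
  ne_top r hr := R.ae_limitRect_ne_top hr.1 hr.2
  memLp r hr := by
    have h1 := (R.tendsto_lintegral_sum hα hγ hφ.measurable hφ.coeff_pos hφ.beta_pos hφ.bdd hφ.asymp
      (fun _ : Unit => 1) (fun _ => r.1) (fun _ => r.2) (fun _ => hr.1) fun _ => hr.2).2
    have h2 := energy_sum_limitKernel (φ₁ := φ₁) hk (fun _ : Unit => 1) (fun _ => r) (fun _ => hr)
    rw [← h2] at h1
    simp only [Finset.univ_unique, Finset.sum_singleton, one_mul] at h1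
    refine memLp_of_energy_ne_top (by linarith) ?_ h1
    exact (measurable_limitRect_toReal ρ ρ' ε _ _ _ _).aestronglyMeasurable.congr
      ((ae_limitControl_of_ae (hk r hr)).mono fun e he => he.symm)

end ScalingRegime

/-- The four scaling regimes. -/
lemma exists_scalingRegime (hα : 1 < α) (hβ : 0 < β) (hβ' : β < α - 1) (hβne : β ≠ (α - 1) / 2)
    (hγ : 0 < γ) : ∃ ρ ρ' ε : ℝ, ((γ = 1 / 2 ∧ ρ = 1 ∧ ρ' = 1 ∧ ε = 1) ∨
      (1 / 2 < γ ∧ ρ = 1 ∧ ρ' = 0 ∧ ε = 1) ∨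
      (γ < 1 / 2 ∧ (α - 1) / 2 < β ∧ ρ = 0 ∧ ρ' = 1 ∧ ε = 1) ∨
      (γ < 1 / 2 ∧ β < (α - 1) / 2 ∧ ρ = 1 ∧ ρ' = 1 ∧ ε = 0)) ∧
    (∀ p ∈ closedQuadrant, ∀ᵐ e : ℝ × ℝ × ℝ, 0 < e.2.2 →
      limitKernel α β γ p e = (limitRect ρ ρ' ε (Ioc 0 p.1) (Ioc 0 p.2) e).toReal) ∧
    ∀ lam : ℕ → ℝ, (∀ n, 0 < lam n) → Tendsto lam atTop atTop → ∃ (p q : ℝ) (N L c : ℕ → ℝ),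
      ScalingRegime α β γ (scalingExponent α β γ) ρ ρ' ε p q lam N L c := by
  rcases lt_trichotomy γ (1 / 2) with h | rfl | h
  · rcases hβne.lt_or_gt with hb | hb
    · refine ⟨1, 1, 0, by simp only [h, hb]; simp, fun p hp => ?_, fun lam hpos hlam => ⟨_, _, _, _, _,
        scalingRegime_of_beta_lt hα hβ hb hγ h hpos hlam⟩⟩
      exact Eventually.of_forall fun e _ => limitKernel_eq_of_beta_lt h hb hp
    · refine ⟨0, 1, 1, by simp only [h, hb]; simp, fun p hp => ?_, fun lam hpos hlam => ⟨_, _, _, _, _,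
        scalingRegime_of_lt_beta hα hb hβ' hγ h hpos hlam⟩⟩
      filter_upwards [ae_fst_ne p.1] with e he hz
      exact limitKernel_eq_of_lt_beta h hb hp hz he
  · refine ⟨1, 1, 1, by simp, fun p hp => ?_, fun lam hpos hlam => ⟨_, _, _, _, _,
      scalingRegime_of_half_le hα hβ hβ' le_rfl (Or.inl ⟨rfl, rfl⟩) hpos hlam⟩⟩
    exact Eventually.of_forall fun e hz => limitKernel_eq_half hp hz
  · refine ⟨1, 0, 1, by simp only [h]; simp, fun p hp => ?_, fun lam hpos hlam => ⟨_, _, _, _, _,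
      scalingRegime_of_half_le hα hβ hβ' h.le (Or.inr ⟨h, rfl⟩) hpos hlam⟩⟩
    filter_upwards [ae_snd_fst_ne p.2] with e he hz
    exact limitKernel_eq_of_half_lt h hp hz he

lemma tendsto_natCast_add_one : Tendsto (fun n : ℕ => (n : ℝ) + 1) atTop atTop :=
  tendsto_atTop_add_const_right _ _ tendsto_natCast_atTop_atTop

lemma tendsto_energy_partialSum (hα : 1 < α) (hβ' : β < α - 1) (hβne : β ≠ (α - 1) / 2)
    (hγ : 0 < γ) (hφ : IsMixingDensity β φ₁ φ) (hpos : ∀ n, 0 < lam n)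
    (hlam : Tendsto lam atTop atTop) {ι : Type*} [Fintype ι] (θ : ι → ℝ) (r : ι → ℝ × ℝ)
    (hr : ∀ i, r i ∈ closedQuadrant) :
    Tendsto (fun n => energy α (latticeControl φ) (fun e => ∑ i, θ i *
      (lam n ^ (-scalingExponent α β γ) * ∑ t ∈ Finset.Icc 1 ⌊lam n * (r i).1⌋,
        ∑ s ∈ Finset.Icc 1 ⌊lam n ^ γ * (r i).2⌋, aggregatedKernel (t, s) e))) atTop
      (𝓝 (energy α (limitControl β φ₁) (fun e => ∑ i, θ i * limitKernel α β γ (r i) e))) := by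
  obtain ⟨ρ, ρ', ε, -, hk, hR⟩ := exists_scalingRegime hα hφ.beta_pos hβ' hβne hγ
  obtain ⟨p, q, N, L, c, R⟩ := hR lam hpos hlam
  exact R.tendsto_energy hα hγ hφ hk θ r hr

/-- The scaling property of the limit kernels, as the uniqueness of the limit of the energies along
the scales `n` and `k n`. -/
lemma energy_limitKernel_scaling (hα : 1 < α) (hβ' : β < α - 1) (hβne : β ≠ (α - 1) / 2)
    (hγ : 0 < γ) (hφ : IsMixingDensity β φ₁ φ) {k : ℝ} (hk : 0 < k) {ι : Type*} [Fintype ι]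
    (θ : ι → ℝ) (r : ι → ℝ × ℝ) (hr : ∀ i, r i ∈ closedQuadrant) :
    energy α (limitControl β φ₁)
        (fun e => ∑ i, θ i * limitKernel α β γ (k * (r i).1, k ^ γ * (r i).2) e) =
      energy α (limitControl β φ₁)
        (fun e => ∑ i, θ i * (k ^ scalingExponent α β γ * limitKernel α β γ (r i) e)) := by
  have hn : ∀ n : ℕ, (0 : ℝ) < n + 1 := fun n => by positivity
  have h1 := tendsto_energy_partialSum hα hβ' hβne hγ hφ hn tendsto_natCast_add_one θ
    (fun i => (k * (r i).1, k ^ γ * (r i).2)) fun i => ⟨mul_nonneg hk.le (hr i).1,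
      mul_nonneg (Real.rpow_nonneg hk.le _) (hr i).2⟩
  have h2 := tendsto_energy_partialSum hα hβ' hβne hγ hφ (fun n => mul_pos hk (hn n))
    (tendsto_natCast_add_one.const_mul_atTop hk) (fun i => θ i * k ^ scalingExponent α β γ) r hr
  simp only [mul_assoc] at h2
  refine tendsto_nhds_unique h1 (h2.congr fun n => ?_)
  have e1 : ∀ H : ℝ, k ^ H * (k * ((n : ℝ) + 1)) ^ (-H) = ((n : ℝ) + 1) ^ (-H) := by
    intro H
    rw [Real.mul_rpow hk.le (hn n).le, ← mul_assoc, ← Real.rpow_add hk, add_neg_cancel,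
      Real.rpow_zero, one_mul]
  refine congrArg _ (funext fun e => Finset.sum_congr rfl fun i _ => ?_)
  have e2 : k * (((n : ℝ) + 1) * (r i).1) = ((n : ℝ) + 1) * (k * (r i).1) := by ring
  have e3 : (k * ((n : ℝ) + 1)) ^ γ * (r i).2 = ((n : ℝ) + 1) ^ γ * (k ^ γ * (r i).2) := by
    rw [Real.mul_rpow hk.le (hn n).le]; ring
  rw [← mul_assoc (k ^ _), e1, e2, e3]

end ScalingLimit

section Fields

variable {Ω : Type*} [MeasurableSpace Ω] {P : Measure Ω} [IsProbabilityMeasure P]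
variable {Ω' : Type*} [MeasurableSpace Ω'] {P' : Measure Ω'} [IsProbabilityMeasure P']
variable {α β γ φ₁ ρ ρ' ε : ℝ} {φ : ℝ → ℝ}
variable {M : Set ((ℤ × ℤ) × ℝ) → Ω → ℝ} {𝓜 : Set (ℝ × ℝ × ℝ) → Ω' → ℝ}

lemma isStableIntegral_aggregated3N (hM : IsStableRandomMeasure α (latticeControl φ) P M)
    (hα : 1 < α) (hφ : IsMixingDensity β φ₁ φ) (p : ℤ × ℤ) :
    IsStableIntegral α (latticeControl φ) P M (aggregatedKernel p) (aggregated3N P α φ M p) := by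
  obtain ⟨C, -, hC⟩ := exists_density_le hφ.beta_pos hφ.bdd hφ.asymp
  exact isStableIntegral_stableIntegral hM hα.le
    (memLp_aggregatedKernel hα hφ.beta_pos hφ.measurable hC p)

lemma isStableIntegral_limitField (h𝓜 : IsStableRandomMeasure α (limitControl β φ₁) P' 𝓜)
    (hα : 1 < α) (R : LimitRegime α β φ₁ γ ρ ρ' ε) {p : ℝ × ℝ} (hp : p ∈ closedQuadrant) :
    IsStableIntegral α (limitControl β φ₁) P' 𝓜 (limitKernel α β γ p)
      (limitField P' α β φ₁ γ 𝓜 p) :=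
  isStableIntegral_stableIntegral h𝓜 hα.le (R.memLp p hp)

lemma isStationaryField_aggregated3N (hM : IsStableRandomMeasure α (latticeControl φ) P M)
    (hα : 1 < α) (hφ : IsMixingDensity β φ₁ φ) :
    IsStationaryField P (aggregated3N P α φ M) := by
  intro h k p _
  refine identDistrib_of_energy_eq hM hM hα.le
    (fun i => isStableIntegral_aggregated3N hM hα hφ (p i + h))
    (fun i => isStableIntegral_aggregated3N hM hα hφ (p i)) fun θ => ?_
  have key : ∀ q : Fin k → ℤ × ℤ, energy α (latticeControl φ)
      (fun e => ∑ i, θ i * aggregatedKernel (q i) e) = ∑' j, ∑' l, ∫⁻ a in Ico (0 : ℝ) 1,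
        ENNReal.ofReal (φ a) *
          ‖∑ i, θ i * (greenE ((q i).1 - j) ((q i).2 - l) a).toReal‖ₑ ^ α := by
    intro q
    rw [← lintegral_latticeControl hφ.measurable (G := fun e =>
      ‖∑ i, θ i * (greenE ((q i).1 - e.1.1) ((q i).2 - e.1.2) e.2).toReal‖ₑ ^ α)]
    · refine lintegral_congr_ae ?_
      filter_upwards [ae_latticeControl_mem φ] with e he
      simp only [aggregatedKernel_eq _ he]
    · exact (Finset.measurable_sum _ fun i _ =>
        (measurable_greenE_sub (q i)).ennreal_toReal.const_mul _).enorm.pow_const _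
  rw [key, key]
  refine ((Equiv.addRight h.1).tsum_eq _).symm.trans (tsum_congr fun j => ?_)
  refine ((Equiv.addRight h.2).tsum_eq _).symm.trans (tsum_congr fun l => ?_)
  simp only [Prod.fst_add, Prod.snd_add, Equiv.coe_addRight, add_sub_add_right_eq_sub]

lemma isOperatorScaling_limitField (h𝓜 : IsStableRandomMeasure α (limitControl β φ₁) P' 𝓜)
    (hα : 1 < α) (hβ' : β < α - 1) (hβne : β ≠ (α - 1) / 2) (hγ : 0 < γ)
    (hφ : IsMixingDensity β φ₁ φ) (R : LimitRegime α β φ₁ γ ρ ρ' ε) :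
    IsOperatorScaling P' (limitField P' α β φ₁ γ 𝓜) (scalingExponent α β γ) γ := by
  intro c hc k p hp
  refine identDistrib_of_energy_eq h𝓜 h𝓜 hα.le
    (fun i => isStableIntegral_limitField h𝓜 hα R (p := (c * (p i).1, c ^ γ * (p i).2))
      ⟨mul_nonneg hc.le (hp i).1, mul_nonneg (Real.rpow_nonneg hc.le _) (hp i).2⟩)
    (fun i => (isStableIntegral_limitField h𝓜 hα R (hp i)).const_mul h𝓜 hα.le
      (c ^ scalingExponent α β γ)) fun θ => ?_
  exact energy_limitKernel_scaling hα hβ' hβne hγ hφ hc θ p hp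

lemma fddTendsto_normalizedSum (hM : IsStableRandomMeasure α (latticeControl φ) P M)
    (h𝓜 : IsStableRandomMeasure α (limitControl β φ₁) P' 𝓜) (hα : 1 < α) (hβ' : β < α - 1)
    (hβne : β ≠ (α - 1) / 2) (hγ : 0 < γ) (hφ : IsMixingDensity β φ₁ φ)
    (R : LimitRegime α β φ₁ γ ρ ρ' ε) : FddTendsto P P' openQuadrant
      (normalizedSum (aggregated3N P α φ M) (scalingExponent α β γ) γ)
      (limitField P' α β φ₁ γ 𝓜) := by
  intro k p hp
  have hp' : ∀ i, p i ∈ closedQuadrant := fun i => ⟨(hp i).1.le, (hp i).2.le⟩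
  refine tendstoInDistribution_of_tendsto_energy hM h𝓜 hα.le (fun n i =>
    (IsStableIntegral.sum hM hα.le _ fun t _ => IsStableIntegral.sum hM hα.le _ fun s _ =>
      isStableIntegral_aggregated3N hM hα hφ (t, s)).const_mul hM hα.le _)
    (fun i => isStableIntegral_limitField h𝓜 hα R (hp' i)) fun θ => ?_
  rw [← tendsto_add_atTop_iff_nat 1]
  have h := tendsto_energy_partialSum hα hβ' hβne hγ hφ (lam := fun n : ℕ => (n : ℝ) + 1)
    (fun n => by positivity) tendsto_natCast_add_one θ p hp'
  refine h.congr fun n => ?_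
  simp only [Nat.cast_add, Nat.cast_one]

/-- The rectangular increments of the limit field are integrals of the functions `limitRect`. -/
lemma isStableIntegral_rectIncrement (h𝓜 : IsStableRandomMeasure α (limitControl β φ₁) P' 𝓜)
    (hα : 1 < α) (R : LimitRegime α β φ₁ γ ρ ρ' ε) {p q : ℝ × ℝ} (hp : p ∈ closedQuadrant)
    (h1 : p.1 ≤ q.1) (h2 : p.2 ≤ q.2) :
    IsStableIntegral α (limitControl β φ₁) P' 𝓜
      (fun e => (limitRect ρ ρ' ε (Ioc p.1 q.1) (Ioc p.2 q.2) e).toReal)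
      (rectIncrement (limitField P' α β φ₁ γ 𝓜) p q) := by
  have m1 : (q.1, q.2) ∈ closedQuadrant := ⟨hp.1.trans h1, hp.2.trans h2⟩
  have m2 : (p.1, q.2) ∈ closedQuadrant := ⟨hp.1, hp.2.trans h2⟩
  have m3 : (q.1, p.2) ∈ closedQuadrant := ⟨hp.1.trans h1, hp.2⟩
  have m4 : (p.1, p.2) ∈ closedQuadrant := hp
  have hI := (((isStableIntegral_limitField h𝓜 hα R m1).sub h𝓜 hα.le
    (isStableIntegral_limitField h𝓜 hα R m2)).sub h𝓜 hα.le
    (isStableIntegral_limitField h𝓜 hα R m3)).add h𝓜 hα.le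
    (isStableIntegral_limitField h𝓜 hα R m4)
  refine hI.congr_ae ?_
  filter_upwards [ae_limitControl_of_ae (R.kernel_eq _ m1), ae_limitControl_of_ae (R.kernel_eq _ m2),
    ae_limitControl_of_ae (R.kernel_eq _ m3), ae_limitControl_of_ae (R.kernel_eq _ m4),
    ae_limitControl_of_ae (R.ne_top _ m1)] with e k1 k2 k3 k4 hfin
  rw [k1, k2, k3, k4, limitRect_rectIncrement hp h1 h2 hfin]

lemma hasStationaryRectIncrements_limitField
    (h𝓜 : IsStableRandomMeasure α (limitControl β φ₁) P' 𝓜) (hα : 1 < α)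
    (R : LimitRegime α β φ₁ γ ρ ρ' ε) :
    HasStationaryRectIncrements P' (limitField P' α β φ₁ γ 𝓜) := by
  intro p hp k q hq
  refine identDistrib_of_energy_eq h𝓜 h𝓜 hα.le
    (fun i => isStableIntegral_rectIncrement h𝓜 hα R ⟨hp.1.le, hp.2.le⟩ (hq i).1 (hq i).2)
    (fun i => isStableIntegral_rectIncrement h𝓜 hα R (p := (0, 0)) (q := q i - p)
      ⟨le_rfl, le_rfl⟩ (sub_nonneg.2 (hq i).1) (sub_nonneg.2 (hq i).2)) fun θ => ?_
  have hm : Measurable fun e : ℝ × ℝ × ℝ => ∑ i, θ i * (limitRect ρ ρ' ε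
      (Ioc ((0, 0) : ℝ × ℝ).1 (q i - p).1) (Ioc ((0, 0) : ℝ × ℝ).2 (q i - p).2) e).toReal :=
    Finset.measurable_sum _ fun i _ => (measurable_limitRect_toReal _ _ _ _ _ _ _).const_mul _
  rw [← energy_limitControl_sub hm p.1 (ε * p.2)]
  congr 1
  funext e
  refine Finset.sum_congr rfl fun i _ => ?_
  rw [limitRect_shift R.eps p (q i) p, sub_self, sub_self]
  rfl

lemma vanishesOnAxes_limitField (h𝓜 : IsStableRandomMeasure α (limitControl β φ₁) P' 𝓜)
    (hα : 1 < α) (R : LimitRegime α β φ₁ γ ρ ρ' ε) :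
    VanishesOnAxes P' (limitField P' α β φ₁ γ 𝓜) := by
  have key : ∀ p ∈ closedQuadrant, (p.1 = 0 ∨ p.2 = 0) →
      limitField P' α β φ₁ γ 𝓜 p =ᵐ[P'] 0 := by
    intro p hp h0
    refine (isStableIntegral_limitField h𝓜 hα R hp).ae_eq_of_ae_eq h𝓜 hα.le
      isStableIntegral_zero ?_
    filter_upwards [ae_limitControl_of_ae (R.kernel_eq p hp)] with e he
    rw [he]
    rcases h0 with h | h
    · simp [h, limitRect]
    · simp [h, limitRect, limitLevel]
  exact ⟨fun x hx => key (x, 0) ⟨hx, le_rfl⟩ (Or.inr rfl),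
    fun y hy => key (0, y) ⟨le_rfl, hy⟩ (Or.inl rfl)⟩

end Fields

/-! ### Dependence of the rectangular increments of the limit fields -/

section Positivity

variable {ρ ρ' ε : ℝ}

lemma limitRect_eq_setLIntegral {I J : Set ℝ} (hI : MeasurableSet I) (e : ℝ × ℝ × ℝ) :
    limitRect ρ ρ' ε I J e =
      ∫⁻ w in {w | 0 < w ∧ ρ * w + e.1 ∈ I}, limitLevel ρ' ε J w e.2.1 e.2.2 := by
  have hm : MeasurableSet {w : ℝ | 0 < w ∧ ρ * w + e.1 ∈ I} :=
    measurableSet_Ioi.inter ((by fun_prop : Measurable fun w : ℝ => ρ * w + e.1) hI)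
  rw [← lintegral_indicator hm, limitRect]
  refine lintegral_congr fun w => ?_
  rcases le_or_gt w 0 with hw | hw
  · rw [limitLevel_of_nonpos hw, mul_zero, indicator_of_notMem (fun h => hw.not_gt h.1)]
  by_cases h : ρ * w + e.1 ∈ I
  · rw [indicator_of_mem h, indicator_of_mem (s := {w | 0 < w ∧ ρ * w + e.1 ∈ I}) ⟨hw, h⟩,
      Pi.one_apply, one_mul]
  · rw [indicator_of_notMem h, indicator_of_notMem (fun h' => h h'.2), zero_mul]

lemma limitLevel_pos {J : Set ℝ} (hJ : MeasurableSet J) {w v z : ℝ} (hw : 0 < w) (hz : 0 < z)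
    (hs : volume {s | ρ' * s + ε * v ∈ J} ≠ 0) : 0 < limitLevel ρ' ε J w v z := by
  have hm : MeasurableSet {s : ℝ | ρ' * s + ε * v ∈ J} :=
    (by fun_prop : Measurable fun s : ℝ => ρ' * s + ε * v) hJ
  have hg : Measurable fun s => ENNReal.ofReal (h3 w (ε * s + (1 - ε) * v) z) :=
    (measurable_h3_right w z).comp (by fun_prop)
  have h := setLIntegral_strict_mono (f := fun _ => 0) hm hs hg (by simp)
    (Eventually.of_forall fun s _ => ENNReal.ofReal_pos.2 (h3_pos hw hz _))
  rw [lintegral_zero, ← lintegral_indicator hm] at h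
  refine h.trans_le (lintegral_mono fun s => ?_)
  by_cases h : ρ' * s + ε * v ∈ J
  · rw [indicator_of_mem h, indicator_of_mem (s := {s | ρ' * s + ε * v ∈ J}) h, Pi.one_apply,
      one_mul]
  · rw [indicator_of_notMem (s := {s | ρ' * s + ε * v ∈ J}) h]; exact zero_le

lemma limitRect_ne_zero {I J : Set ℝ} (hI : MeasurableSet I) (hJ : MeasurableSet J)
    {e : ℝ × ℝ × ℝ} (hz : 0 < e.2.2) (hw : volume {w | 0 < w ∧ ρ * w + e.1 ∈ I} ≠ 0)
    (hs : volume {s | ρ' * s + ε * e.2.1 ∈ J} ≠ 0) : limitRect ρ ρ' ε I J e ≠ 0 := by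
  have hm : MeasurableSet {w : ℝ | 0 < w ∧ ρ * w + e.1 ∈ I} :=
    measurableSet_Ioi.inter ((by fun_prop : Measurable fun w : ℝ => ρ * w + e.1) hI)
  have hg : Measurable fun w => limitLevel ρ' ε J w e.2.1 e.2.2 :=
    (measurable_limitLevel hJ ρ' ε).comp (by fun_prop : Measurable fun w : ℝ => (w, e.2.1, e.2.2))
  rw [limitRect_eq_setLIntegral hI]
  have h := setLIntegral_strict_mono (f := fun _ => 0) hm hw hg (by simp)
    (Eventually.of_forall fun w hw => limitLevel_pos hJ hw.1 hz hs)
  rw [lintegral_zero] at h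
  exact h.ne'

lemma volume_one_mul_add_ne_zero {a b u : ℝ} (hab : a < b) (hu : u < b) :
    volume {w | 0 < w ∧ 1 * w + u ∈ Ioc a b} ≠ 0 := by
  have hsub : Ioo (max 0 (a - u)) (b - u) ⊆ {w | 0 < w ∧ 1 * w + u ∈ Ioc a b} := by
    intro w hw
    have h1 := max_lt_iff.1 hw.1
    have h2 := hw.2
    rw [mem_ofPred_eq, one_mul]
    exact ⟨h1.1, by linarith, by linarith⟩
  refine fun h => ?_
  have h1 := measure_mono_null hsub h
  rw [Real.volume_Ioo, ENNReal.ofReal_eq_zero] at h1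
  have : max 0 (a - u) < b - u := max_lt (by linarith) (by linarith)
  linarith

lemma volume_zero_mul_add_ne_zero {a b u : ℝ} (hu : u ∈ Ioc a b) :
    volume {w | 0 < w ∧ 0 * w + u ∈ Ioc a b} ≠ 0 := by
  have : {w : ℝ | 0 < w ∧ 0 * w + u ∈ Ioc a b} = Ioi 0 := by
    ext w; simp only [zero_mul, zero_add, hu, and_true]; rfl
  rw [this, Real.volume_Ioi]
  exact ENNReal.top_ne_zero

lemma volume_level_one_ne_zero {a b : ℝ} (hab : a < b) (r : ℝ) :
    volume {s | 1 * s + r ∈ Ioc a b} ≠ 0 := by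
  have : {s : ℝ | 1 * s + r ∈ Ioc a b} = Ioc (a - r) (b - r) := by
    ext s
    simp only [one_mul, mem_ofPred_eq, mem_Ioc, sub_lt_iff_lt_add, le_sub_iff_add_le]
  rw [this, Real.volume_Ioc, ne_eq, ENNReal.ofReal_eq_zero]
  linarith

lemma volume_level_zero_ne_zero {J : Set ℝ} {v : ℝ} (hv : v ∈ J) :
    volume {s : ℝ | 0 * s + 1 * v ∈ J} ≠ 0 := by
  have : {s : ℝ | 0 * s + 1 * v ∈ J} = univ := by
    ext s; simp only [zero_mul, zero_add, one_mul, mem_ofPred_eq, hv, mem_univ]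
  rw [this, Real.volume_univ]
  exact ENNReal.top_ne_zero

lemma limitRect_one_eq_zero {a b : ℝ} {J : Set ℝ} {e : ℝ × ℝ × ℝ} (hu : b ≤ e.1) :
    limitRect 1 ρ' ε (Ioc a b) J e = 0 := by
  rw [limitRect_eq_setLIntegral measurableSet_Ioc]
  have : {w : ℝ | 0 < w ∧ 1 * w + e.1 ∈ Ioc a b} = ∅ := by
    ext w
    simp only [one_mul, mem_ofPred_eq, mem_Ioc, mem_empty_iff_false, iff_false]
    intro h
    linarith [h.2.2, h.1]
  rw [this, Measure.restrict_empty, lintegral_zero_measure]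

lemma limitRect_zero_eq_zero {I J : Set ℝ} {e : ℝ × ℝ × ℝ} (hu : e.1 ∉ I) :
    limitRect 0 ρ' ε I J e = 0 := by
  simp [limitRect, indicator_of_notMem hu]

lemma limitRect_level_zero_eq_zero {I J : Set ℝ} {e : ℝ × ℝ × ℝ} (hv : e.2.1 ∉ J) :
    limitRect ρ 0 1 I J e = 0 := by
  simp [limitRect, limitLevel_one, indicator_of_notMem hv]

/-- The heat kernel decreases away from the axis. -/
lemma h3_lt_h3 {w z s δ : ℝ} (hw : 0 < w) (hz : 0 < z) (hδ : 0 < δ) (hs : s + δ ≤ 0) :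
    h3 w s z < h3 w (s + δ) z := by
  have hπ := Real.pi_pos
  rw [h3, h3, if_pos ⟨hw, hz⟩, if_pos ⟨hw, hz⟩]
  refine mul_lt_mul_of_pos_left (Real.exp_lt_exp.2 ?_) (by positivity)
  have : (s + δ) ^ 2 / (4 * w) < s ^ 2 / (4 * w) := by
    refine div_lt_div_of_pos_right ?_ (by positivity)
    nlinarith
  linarith

lemma limitLevel_lt {a b δ w v z : ℝ} (hab : a < b) (hδ : 0 < δ) (hw : 0 < w) (hz : 0 < z)
    (hv : b + δ ≤ v) :
    limitLevel 1 1 (Ioc a b) w v z < limitLevel 1 1 (Ioc (a + δ) (b + δ)) w v z := by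
  have key : ∀ v', limitLevel 1 1 (Ioc a b) w v' z =
      ∫⁻ r in Ioc a b, ENNReal.ofReal (h3 w (r - v') z) := by
    intro v'
    rw [limitLevel_one, ← lintegral_sub_right_eq_self _ v', ← lintegral_indicator measurableSet_Ioc]
    refine lintegral_congr fun r => ?_
    rw [one_mul, sub_add_cancel]
    by_cases h : r ∈ Ioc a b
    · rw [indicator_of_mem h, indicator_of_mem h, Pi.one_apply, one_mul]
    · rw [indicator_of_notMem h, indicator_of_notMem h, zero_mul]
  have hfin := limitLevel_one_ne_top 1 (Ioc a b) w v hz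
  rw [limitLevel_shift (Or.inl rfl) (a + δ) (b + δ) δ, add_sub_cancel_right, add_sub_cancel_right,
    one_mul]
  rw [key] at hfin
  rw [key, key]
  refine setLIntegral_strict_mono measurableSet_Ioc ?_
    ((measurable_h3_right w z).comp (by fun_prop : Measurable fun r : ℝ => r - (v - δ))) hfin
    (Eventually.of_forall fun r hr => ?_)
  · rw [Real.volume_Ioc, ne_eq, ENNReal.ofReal_eq_zero]; linarith
  · rw [ENNReal.ofReal_lt_ofReal_iff (h3_pos hw hz _), sub_sub_eq_add_sub, add_sub_right_comm]
    exact h3_lt_h3 hw hz hδ (by linarith [hr.2])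

/-- Rectangles below the starting height of the walk contribute less the farther they are. -/
lemma limitRect_lt {I : Set ℝ} (hI : MeasurableSet I) {a b δ : ℝ} (hab : a < b) (hδ : 0 < δ)
    {e : ℝ × ℝ × ℝ} (hz : 0 < e.2.2) (hv : b + δ ≤ e.2.1)
    (hw : volume {w | 0 < w ∧ ρ * w + e.1 ∈ I} ≠ 0)
    (hfin : limitRect ρ 1 1 I (Ioc a b) e ≠ ∞) :
    limitRect ρ 1 1 I (Ioc a b) e < limitRect ρ 1 1 I (Ioc (a + δ) (b + δ)) e := by
  have hm : MeasurableSet {w : ℝ | 0 < w ∧ ρ * w + e.1 ∈ I} :=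
    measurableSet_Ioi.inter ((by fun_prop : Measurable fun w : ℝ => ρ * w + e.1) hI)
  have hg : Measurable fun w => limitLevel 1 1 (Ioc (a + δ) (b + δ)) w e.2.1 e.2.2 :=
    (measurable_limitLevel measurableSet_Ioc 1 1).comp
      (by fun_prop : Measurable fun w : ℝ => (w, e.2.1, e.2.2))
  rw [limitRect_eq_setLIntegral hI] at hfin ⊢
  rw [limitRect_eq_setLIntegral hI]
  exact setLIntegral_strict_mono hm hw hg hfin
    (Eventually.of_forall fun w hw => limitLevel_lt hab hδ hw.1 hz hv)

end Positivity

section Directions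

variable {Ω' : Type*} [MeasurableSpace Ω'] {P' : Measure Ω'} [IsProbabilityMeasure P']
variable {α β γ φ₁ ρ ρ' ε : ℝ} {𝓜 : Set (ℝ × ℝ × ℝ) → Ω' → ℝ}

lemma PlaneRect.lo_mem (K : PlaneRect) (h : K.toSet ⊆ openQuadrant) : K.lo ∈ closedQuadrant := by
  constructor
  · by_contra hneg
    have hmem : (min K.hi.1 0, K.hi.2) ∈ K.toSet :=
      ⟨lt_min K.lt_fst (not_le.1 hneg), min_le_left _ _, K.lt_snd, le_rfl⟩
    exact absurd (h hmem).1 (not_lt.2 (min_le_right _ _))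
  · by_contra hneg
    have hmem : (K.hi.1, min K.hi.2 0) ∈ K.toSet :=
      ⟨K.lt_fst, le_rfl, lt_min K.lt_snd (not_le.1 hneg), min_le_left _ _⟩
    exact absurd (h hmem).2 (not_lt.2 (min_le_right _ _))

lemma PlaneRect.toSet_subset {K : PlaneRect} (h : K.lo ∈ closedQuadrant) :
    K.toSet ⊆ openQuadrant := fun _ hp => ⟨h.1.trans_lt hp.1, h.2.trans_lt hp.2.2.1⟩

/-- The kernel of the increment over the rectangle `K`, with values in `[0, ∞]`. -/
def PlaneRect.kernel (ρ ρ' ε : ℝ) (K : PlaneRect) : ℝ × ℝ × ℝ → ℝ≥0∞ :=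
  limitRect ρ ρ' ε (Ioc K.lo.1 K.hi.1) (Ioc K.lo.2 K.hi.2)

lemma isStableIntegral_increment (h𝓜 : IsStableRandomMeasure α (limitControl β φ₁) P' 𝓜)
    (hα : 1 < α) (R : LimitRegime α β φ₁ γ ρ ρ' ε) {K : PlaneRect} (hK : K.lo ∈ closedQuadrant) :
    IsStableIntegral α (limitControl β φ₁) P' 𝓜 (fun e => (K.kernel ρ ρ' ε e).toReal)
      (K.increment (limitField P' α β φ₁ γ 𝓜)) :=
  isStableIntegral_rectIncrement h𝓜 hα R hK K.lt_fst.le K.lt_snd.le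

lemma ae_kernel_ne_top (R : LimitRegime α β φ₁ γ ρ ρ' ε) {K : PlaneRect}
    (hK : K.lo ∈ closedQuadrant) : ∀ᵐ e ∂(limitControl β φ₁), K.kernel ρ ρ' ε e ≠ ∞ := by
  refine ae_limitControl_of_ae ?_
  filter_upwards [R.ne_top K.hi ⟨hK.1.trans K.lt_fst.le, hK.2.trans K.lt_snd.le⟩] with e he hz
  exact limitRect_ne_top_of_subset (Ioc_subset_Ioc_left hK.1) (Ioc_subset_Ioc_left hK.2) (he hz)

lemma limitControl_box_ne_zero (hφ₁ : 0 < φ₁) {a b c d : ℝ} (hab : a < b) (hcd : c < d) :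
    limitControl β φ₁ (Ioo a b ×ˢ Ioo c d ×ˢ Ioi 0) ≠ 0 := by
  refine limitControl_pos hφ₁ (measurableSet_Ioo.prod (measurableSet_Ioo.prod measurableSet_Ioi))
    (fun e he => he.2.2) ?_
  rw [Measure.volume_eq_prod, Measure.prod_prod, Measure.volume_eq_prod, Measure.prod_prod,
    Real.volume_Ioo, Real.volume_Ioo, Real.volume_Ioi]
  refine mul_ne_zero ?_ (mul_ne_zero ?_ ENNReal.top_ne_zero)
  · rw [ne_eq, ENNReal.ofReal_eq_zero]; linarith
  · rw [ne_eq, ENNReal.ofReal_eq_zero]; linarith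

lemma not_indepIncrementsDir (h𝓜 : IsStableRandomMeasure α (limitControl β φ₁) P' 𝓜)
    (hα : 1 < α) (hφ₁ : 0 < φ₁) (R : LimitRegime α β φ₁ γ ρ ρ' ε) {l l' : PlaneLine}
    (hl : l'.Perp l) {K K' : PlaneRect} (hK : K.lo ∈ closedQuadrant)
    (hK' : K'.lo ∈ closedQuadrant) (hsep : l'.Separates K.toSet K'.toSet) {a b c d : ℝ}
    (hab : a < b) (hcd : c < d) (hpos : ∀ e ∈ Ioo a b ×ˢ Ioo c d ×ˢ Ioi (0 : ℝ),
      K.kernel ρ ρ' ε e ≠ 0 ∧ K'.kernel ρ ρ' ε e ≠ 0) :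
    ¬ IndepIncrementsDir P' (limitField P' α β φ₁ γ 𝓜) l := by
  intro h
  have hind := h l' hl K K' (K.toSet_subset hK) (K'.toSet_subset hK') hsep
  refine IsStableIntegral.not_indepFun h𝓜 hα (isStableIntegral_increment h𝓜 hα R hK)
    (isStableIntegral_increment h𝓜 hα R hK') (Eventually.of_forall fun _ => ENNReal.toReal_nonneg)
    (Eventually.of_forall fun _ => ENNReal.toReal_nonneg)
    (S := {e | 0 < (K.kernel ρ ρ' ε e).toReal ∧ 0 < (K'.kernel ρ ρ' ε e).toReal}) ?_
    (fun _ he => he) hind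
  intro h0
  refine limitControl_box_ne_zero (β := β) hφ₁ hab hcd (measure_eq_zero_iff_ae_notMem.2 ?_)
  filter_upwards [measure_eq_zero_iff_ae_notMem.1 h0, ae_kernel_ne_top R hK,
    ae_kernel_ne_top R hK'] with e he h1 h2 hmem
  exact he ⟨ENNReal.toReal_pos (hpos e hmem).1 h1, ENNReal.toReal_pos (hpos e hmem).2 h2⟩

lemma not_invariantIncrementsDir (h𝓜 : IsStableRandomMeasure α (limitControl β φ₁) P' 𝓜)
    (hα : 1 < α) (hφ₁ : 0 < φ₁) (R : LimitRegime α β φ₁ γ ρ ρ' ε) {l : PlaneLine}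
    {K K' : PlaneRect} (hK : K.lo ∈ closedQuadrant) (hK' : K'.lo ∈ closedQuadrant)
    {w : ℝ × ℝ} (hw : w ∈ l.toSet) (hlo : K'.lo = w + K.lo) (hhi : K'.hi = w + K.hi)
    {a b c d : ℝ} (hab : a < b) (hcd : c < d)
    (hne : ∀ e ∈ Ioo a b ×ˢ Ioo c d ×ˢ Ioi (0 : ℝ), K.kernel ρ ρ' ε e ≠ ∞ →
      K.kernel ρ ρ' ε e ≠ K'.kernel ρ ρ' ε e) :
    ¬ InvariantIncrementsDir P' (limitField P' α β φ₁ γ 𝓜) l := by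
  intro h
  have hinv := h K K' (K.toSet_subset hK) (K'.toSet_subset hK') ⟨w, hw, hlo, hhi⟩
  have hae := (isStableIntegral_increment h𝓜 hα R hK).ae_eq_integrand h𝓜 hα.le
    (isStableIntegral_increment h𝓜 hα R hK') hinv
  refine limitControl_box_ne_zero (β := β) hφ₁ hab hcd (measure_eq_zero_iff_ae_notMem.2 ?_)
  filter_upwards [hae, ae_kernel_ne_top R hK, ae_kernel_ne_top R hK'] with e he h1 h2 hmem
  exact hne e hmem h1 ((ENNReal.toReal_eq_toReal_iff' h1 h2).1 he)

/-- The rectangle `(a, b] × (c, d]`. -/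
def planeRect {a b c d : ℝ} (hab : a < b) (hcd : c < d) : PlaneRect := ⟨(a, c), (b, d), hab, hcd⟩

/-- Non-invariance under translations to the right, when the noise at a point acts on the part of
the plane to its right only. -/
lemma not_invariantIncrementsDir_of_right
    (h𝓜 : IsStableRandomMeasure α (limitControl β φ₁) P' 𝓜) (hα : 1 < α) (hφ₁ : 0 < φ₁)
    (R : LimitRegime α β φ₁ γ 1 ρ' ε) {l : PlaneLine} {w : ℝ × ℝ} (hw : w ∈ l.toSet)
    (hw1 : 0 < w.1) {c d c' d' : ℝ} (hc : 0 ≤ c) (hc' : 0 ≤ w.2 + c) (hcd : c < d)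
    (hcd' : c' < d')
    (hs : ∀ v ∈ Ioo c' d', volume {s | ρ' * s + ε * v ∈ Ioc (w.2 + c) (w.2 + d)} ≠ 0) :
    ¬ InvariantIncrementsDir P' (limitField P' α β φ₁ γ 𝓜) l := by
  refine not_invariantIncrementsDir h𝓜 hα hφ₁ R
    (K := planeRect (a := 1) (b := 2) one_lt_two hcd)
    (K' := planeRect (a := w.1 + 1) (b := w.1 + 2) (c := w.2 + c) (d := w.2 + d) (by linarith)
      (by linarith)) (w := w) ⟨zero_le_one, hc⟩ ⟨add_nonneg hw1.le zero_le_one, hc'⟩ hw rfl rfl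
    (a := 2) (b := w.1 + 2) (by linarith) hcd' fun e he _ => ?_
  rw [PlaneRect.kernel, planeRect, limitRect_one_eq_zero he.1.1.le]
  refine (limitRect_ne_zero measurableSet_Ioc measurableSet_Ioc he.2.2
    (volume_one_mul_add_ne_zero ?_ he.1.2) (hs _ he.2.1)).symm
  exact (by linarith : w.1 + 1 < w.1 + 2)

/-- Non-invariance under upward translations, when the noise at a point spreads vertically. -/
lemma not_invariantIncrementsDir_of_up
    (h𝓜 : IsStableRandomMeasure α (limitControl β φ₁) P' 𝓜) (hα : 1 < α) (hφ₁ : 0 < φ₁)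
    (R : LimitRegime α β φ₁ γ ρ 1 1) {l : PlaneLine} {δ : ℝ} (hδ : 0 < δ)
    (hw : ((0 : ℝ), δ) ∈ l.toSet)
    {a b : ℝ} (hab : a < b)
    (hu : ∀ u ∈ Ioo a b, volume {w : ℝ | 0 < w ∧ ρ * w + u ∈ Ioc 1 2} ≠ 0) :
    ¬ InvariantIncrementsDir P' (limitField P' α β φ₁ γ 𝓜) l := by
  refine not_invariantIncrementsDir h𝓜 hα hφ₁ R
    (K := planeRect (a := 1) (b := 2) (c := 1) (d := 2) one_lt_two one_lt_two)
    (K' := planeRect (a := 1) (b := 2) (c := 1 + δ) (d := 2 + δ) one_lt_two (by linarith))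
    (w := (0, δ)) ⟨zero_le_one, zero_le_one⟩ ⟨zero_le_one, add_nonneg zero_le_one hδ.le⟩ hw
    (by simp [planeRect, add_comm]) (by simp [planeRect, add_comm])
    (c := 2 + δ) (d := 3 + δ) hab (by linarith) fun e he hfin => ?_
  exact (limitRect_lt measurableSet_Ioc one_lt_two hδ he.2.2 he.2.1.1.le (hu _ he.1) hfin).ne

/-- For `γ = 1/2` the noise at a point acts on the whole half-plane to its right. -/
lemma dependentIncrements_half (h𝓜 : IsStableRandomMeasure α (limitControl β φ₁) P' 𝓜)
    (hα : 1 < α) (hφ₁ : 0 < φ₁) (R : LimitRegime α β φ₁ γ 1 1 1) :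
    DependentIncrements P' (limitField P' α β φ₁ γ 𝓜) := by
  intro l hl0
  have hpos : ∀ {a b c d : ℝ} (hab : a < b) (hcd : c < d), 1 ≤ a → ∀ e ∈ Ioo (0 : ℝ) 1 ×ˢ
      Ioo (0 : ℝ) 1 ×ˢ Ioi (0 : ℝ), (planeRect hab hcd).kernel 1 1 1 e ≠ 0 := by
    intro a b c d hab hcd ha e he
    exact limitRect_ne_zero measurableSet_Ioc measurableSet_Ioc he.2.2
      (volume_one_mul_add_ne_zero hab (he.1.2.trans (ha.trans_lt hab)))
      (volume_level_one_ne_zero hcd _)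
  have h12 : (1 : ℝ) < 2 := one_lt_two
  have h23 : (2 : ℝ) < 3 := by norm_num
  constructor
  · -- a normal `(m, k)` of the separating line with `m ≥ 0`
    obtain ⟨m, k, hm, hmk, hperp⟩ : ∃ m k : ℝ, 0 ≤ m ∧ (m ≠ 0 ∨ k ≠ 0) ∧ m * l.a + k * l.b = 0 := by
      rcases le_total l.b 0 with hb | hb
      · exact ⟨-l.b, l.a, by linarith, l.ne_zero.symm.imp neg_ne_zero.2 id, by ring⟩
      · exact ⟨l.b, -l.a, hb, l.ne_zero.symm.imp id neg_ne_zero.2, by ring⟩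
    rcases le_total 0 k with hk | hk
    · refine not_indepIncrementsDir h𝓜 hα hφ₁ R (l' := ⟨m, k, 2 * m + 2 * k, hmk⟩)
        (K := planeRect h12 h12) (K' := planeRect h23 h23) hperp ⟨zero_le_one, zero_le_one⟩
        ⟨zero_le_two, zero_le_two⟩ (Or.inl ⟨fun p hp => ?_, fun p hp => ?_⟩) zero_lt_one
        zero_lt_one fun e he => ⟨hpos h12 h12 le_rfl e he, hpos h23 h23 h12.le e he⟩
      · have h1 : p.1 ≤ 2 := hp.2.1
        have h2 : p.2 ≤ 2 := hp.2.2.2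
        dsimp only
        nlinarith
      · have h1 : 2 < p.1 := hp.1
        have h2 : 2 < p.2 := hp.2.2.1
        dsimp only
        nlinarith
    · refine not_indepIncrementsDir h𝓜 hα hφ₁ R (l' := ⟨m, k, 2 * m + 2 * k, hmk⟩)
        (K := planeRect h12 h23) (K' := planeRect h23 h12) hperp ⟨zero_le_one, zero_le_two⟩
        ⟨zero_le_two, zero_le_one⟩ (Or.inl ⟨fun p hp => ?_, fun p hp => ?_⟩) zero_lt_one
        zero_lt_one fun e he => ⟨hpos h12 h23 le_rfl e he, hpos h23 h12 h12.le e he⟩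
      · have h1 : p.1 ≤ 2 := hp.2.1
        have h2 : 2 < p.2 := hp.2.2.1
        dsimp only
        nlinarith
      · have h1 : 2 < p.1 := hp.1
        have h2 : p.2 ≤ 2 := hp.2.2.2
        dsimp only
        nlinarith
  · have hc : l.c = 0 := by
      have : l.a * 0 + l.b * 0 = l.c := hl0
      linarith
    by_cases hb : l.b = 0
    · refine not_invariantIncrementsDir_of_up h𝓜 hα hφ₁ R one_pos (a := 0) (b := 1) ?_ one_pos
        fun u hu => volume_one_mul_add_ne_zero h12 (hu.2.trans h12)
      simp [PlaneLine.toSet, hb, hc]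
    · -- a direction vector of the line, pointing to the right
      have hw : ((1 : ℝ), -(l.a / l.b)) ∈ l.toSet := by
        simp only [PlaneLine.toSet, mem_ofPred_eq, hc]
        field_simp
        ring
      have habs := neg_abs_le (-(l.a / l.b))
      refine not_invariantIncrementsDir_of_right h𝓜 hα hφ₁ R hw one_pos
        (c := |-(l.a / l.b)|) (d := |-(l.a / l.b)| + 1) (c' := 0) (d' := 1) (abs_nonneg _)
        (by dsimp only; linarith) (by linarith) one_pos fun v _ => ?_
      exact volume_level_one_ne_zero (by linarith) _

/-- The horizontal axis. -/
def horizontalAxis : PlaneLine := ⟨0, 1, 0, Or.inr one_ne_zero⟩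

/-- The vertical axis. -/
def verticalAxis : PlaneLine := ⟨1, 0, 0, Or.inl one_ne_zero⟩

/-- When the noise at a point acts on the part of the plane to its right only, the increments are
dependent in the horizontal direction. -/
lemma dependentIncrementsDir_horizontal (h𝓜 : IsStableRandomMeasure α (limitControl β φ₁) P' 𝓜)
    (hα : 1 < α) (hφ₁ : 0 < φ₁) (R : LimitRegime α β φ₁ γ 1 ρ' ε)
    (hs : ∀ v ∈ Ioo (1 : ℝ) 2, volume {s | ρ' * s + ε * v ∈ Ioc 1 2} ≠ 0) :
    DependentIncrementsDir P' (limitField P' α β φ₁ γ 𝓜) horizontalAxis := by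
  have h12 : (1 : ℝ) < 2 := one_lt_two
  have h23 : (2 : ℝ) < 3 := by norm_num
  constructor
  · refine not_indepIncrementsDir h𝓜 hα hφ₁ R (l' := ⟨1, 0, 2, Or.inl one_ne_zero⟩)
      (K := planeRect h12 h12) (K' := planeRect h23 h12) (by simp [PlaneLine.Perp, horizontalAxis])
      ⟨zero_le_one, zero_le_one⟩ ⟨zero_le_two, zero_le_one⟩
      (Or.inl ⟨fun p hp => ?_, fun p hp => ?_⟩) (a := 0) (b := 1) zero_lt_one h12
      fun e he => ⟨?_, ?_⟩
    · have h1 : p.1 ≤ 2 := hp.2.1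
      simpa using h1
    · have h1 : 2 < p.1 := hp.1
      simpa using h1.le
    · exact limitRect_ne_zero measurableSet_Ioc measurableSet_Ioc he.2.2
        (volume_one_mul_add_ne_zero h12 (he.1.2.trans h12)) (hs _ he.2.1)
    · exact limitRect_ne_zero measurableSet_Ioc measurableSet_Ioc he.2.2
        (volume_one_mul_add_ne_zero h23 ((he.1.2.trans h12).trans h23)) (hs _ he.2.1)
  · refine not_invariantIncrementsDir_of_right h𝓜 hα hφ₁ R (w := (1, 0)) ?_ one_pos
      (c := 1) (d := 2) zero_le_one (by simp) h12 h12 fun v hv => ?_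
    · simp [PlaneLine.toSet, horizontalAxis]
    · simpa using hs v hv

/-- When the noise at a point acts on the vertical line through it, the increments are dependent in
the vertical direction. -/
lemma dependentIncrementsDir_vertical (h𝓜 : IsStableRandomMeasure α (limitControl β φ₁) P' 𝓜)
    (hα : 1 < α) (hφ₁ : 0 < φ₁) (R : LimitRegime α β φ₁ γ 0 1 1) :
    DependentIncrementsDir P' (limitField P' α β φ₁ γ 𝓜) verticalAxis := by
  have h12 : (1 : ℝ) < 2 := one_lt_two
  have h23 : (2 : ℝ) < 3 := by norm_num
  have hmem : ∀ u ∈ Ioo (1 : ℝ) 2, volume {w : ℝ | 0 < w ∧ 0 * w + u ∈ Ioc 1 2} ≠ 0 :=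
    fun u hu => volume_zero_mul_add_ne_zero ⟨hu.1, hu.2.le⟩
  constructor
  · refine not_indepIncrementsDir h𝓜 hα hφ₁ R (l' := ⟨0, 1, 2, Or.inr one_ne_zero⟩)
      (K := planeRect h12 h12) (K' := planeRect h12 h23) (by simp [PlaneLine.Perp, verticalAxis])
      ⟨zero_le_one, zero_le_one⟩ ⟨zero_le_one, zero_le_two⟩
      (Or.inl ⟨fun p hp => ?_, fun p hp => ?_⟩) h12 (c := 0) (d := 1) zero_lt_one
      fun e he => ⟨?_, ?_⟩
    · have h1 : p.2 ≤ 2 := hp.2.2.2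
      simpa using h1
    · have h1 : 2 < p.2 := hp.2.2.1
      simpa using h1.le
    · exact limitRect_ne_zero measurableSet_Ioc measurableSet_Ioc he.2.2 (hmem _ he.1)
        (volume_level_one_ne_zero h12 _)
    · exact limitRect_ne_zero measurableSet_Ioc measurableSet_Ioc he.2.2 (hmem _ he.1)
        (volume_level_one_ne_zero h23 _)
  · refine not_invariantIncrementsDir_of_up h𝓜 hα hφ₁ R one_pos ?_ h12 hmem
    simp [PlaneLine.toSet, verticalAxis]

/-- Rectangles separated by a vertical line have disjoint projections to the first axis. -/
lemma PlaneRect.fst_disjoint {l : PlaneLine} (hb : l.b = 0) {K K' : PlaneRect}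
    (hsep : l.Separates K.toSet K'.toSet) {u : ℝ} (hu : u ∈ Ioc K.lo.1 K.hi.1)
    (hu' : u ∈ Ioc K'.lo.1 K'.hi.1) : False := by
  have ha : l.a ≠ 0 := l.ne_zero.resolve_right (not_not.2 hb)
  -- two points of either rectangle, with the common first coordinates `u` and less than `u`
  set r := max ((K.lo.1 + u) / 2) ((K'.lo.1 + u) / 2) with hr
  have hru : r < u := max_lt (by linarith [hu.1]) (by linarith [hu'.1])
  have hr1 : K.lo.1 < r := lt_of_lt_of_le (by linarith [hu.1]) (le_max_left _ _)
  have hr2 : K'.lo.1 < r := lt_of_lt_of_le (by linarith [hu'.1]) (le_max_right _ _)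
  have m1 : (u, K.hi.2) ∈ K.toSet := ⟨hu.1, hu.2, K.lt_snd, le_rfl⟩
  have m2 : (r, K.hi.2) ∈ K.toSet := ⟨hr1, hru.le.trans hu.2, K.lt_snd, le_rfl⟩
  have m3 : (u, K'.hi.2) ∈ K'.toSet := ⟨hu'.1, hu'.2, K'.lt_snd, le_rfl⟩
  have m4 : (r, K'.hi.2) ∈ K'.toSet := ⟨hr2, hru.le.trans hu'.2, K'.lt_snd, le_rfl⟩
  refine hru.ne (mul_left_cancel₀ ha ?_)
  rcases hsep with ⟨h1, h2⟩ | ⟨h1, h2⟩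
  · have a1 := h1 _ m1; have a2 := h1 _ m2; have a3 := h2 _ m3; have a4 := h2 _ m4
    simp only [hb, zero_mul, add_zero] at a1 a2 a3 a4
    linarith
  · have a1 := h2 _ m1; have a2 := h2 _ m2; have a3 := h1 _ m3; have a4 := h1 _ m4
    simp only [hb, zero_mul, add_zero] at a1 a2 a3 a4
    linarith

/-- Rectangles separated by a horizontal line have disjoint projections to the second axis. -/
lemma PlaneRect.snd_disjoint {l : PlaneLine} (ha : l.a = 0) {K K' : PlaneRect}
    (hsep : l.Separates K.toSet K'.toSet) {v : ℝ} (hv : v ∈ Ioc K.lo.2 K.hi.2)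
    (hv' : v ∈ Ioc K'.lo.2 K'.hi.2) : False := by
  have hsep' : (⟨l.b, l.a, l.c, l.ne_zero.symm⟩ : PlaneLine).Separates
      (PlaneRect.mk K.lo.swap K.hi.swap K.lt_snd K.lt_fst).toSet
      (PlaneRect.mk K'.lo.swap K'.hi.swap K'.lt_snd K'.lt_fst).toSet := by
    refine hsep.imp ?_ ?_ <;>
    · rintro ⟨h1, h2⟩
      refine ⟨fun p hp => ?_, fun p hp => ?_⟩
      · have := h1 p.swap ⟨hp.2.2.1, hp.2.2.2, hp.1, hp.2.1⟩
        simp only [Prod.fst_swap, Prod.snd_swap] at this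
        dsimp only
        linarith
      · have := h2 p.swap ⟨hp.2.2.1, hp.2.2.2, hp.1, hp.2.1⟩
        simp only [Prod.fst_swap, Prod.snd_swap] at this
        dsimp only
        linarith
  exact PlaneRect.fst_disjoint (l := ⟨l.b, l.a, l.c, l.ne_zero.symm⟩) ha hsep' hv hv'

lemma indepIncrementsDir_horizontal (h𝓜 : IsStableRandomMeasure α (limitControl β φ₁) P' 𝓜)
    (hα : 1 < α) (R : LimitRegime α β φ₁ γ 0 ρ' ε) :
    IndepIncrementsDir P' (limitField P' α β φ₁ γ 𝓜) horizontalAxis := by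
  intro l' hl' K K' hK hK' hsep
  have hb : l'.b = 0 := by simpa [PlaneLine.Perp, horizontalAxis] using hl'
  refine (isStableIntegral_increment h𝓜 hα R (K.lo_mem hK)).indepFun_of_mul_eq_zero h𝓜 hα.le
    (isStableIntegral_increment h𝓜 hα R (K'.lo_mem hK')) (Eventually.of_forall fun e => ?_)
  by_cases hu : e.1 ∈ Ioc K.lo.1 K.hi.1
  · right
    rw [PlaneRect.kernel, limitRect_zero_eq_zero fun hu' => K.fst_disjoint hb hsep hu hu',
      ENNReal.toReal_zero]
  · left
    rw [PlaneRect.kernel, limitRect_zero_eq_zero hu, ENNReal.toReal_zero]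

lemma indepIncrementsDir_vertical (h𝓜 : IsStableRandomMeasure α (limitControl β φ₁) P' 𝓜)
    (hα : 1 < α) (R : LimitRegime α β φ₁ γ ρ 0 1) :
    IndepIncrementsDir P' (limitField P' α β φ₁ γ 𝓜) verticalAxis := by
  intro l' hl' K K' hK hK' hsep
  have ha : l'.a = 0 := by simpa [PlaneLine.Perp, verticalAxis] using hl'
  refine (isStableIntegral_increment h𝓜 hα R (K.lo_mem hK)).indepFun_of_mul_eq_zero h𝓜 hα.le
    (isStableIntegral_increment h𝓜 hα R (K'.lo_mem hK')) (Eventually.of_forall fun e => ?_)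
  by_cases hv : e.2.1 ∈ Ioc K.lo.2 K.hi.2
  · right
    rw [PlaneRect.kernel, limitRect_level_zero_eq_zero fun hv' => K.snd_disjoint ha hsep hv hv',
      ENNReal.toReal_zero]
  · left
    rw [PlaneRect.kernel, limitRect_level_zero_eq_zero hv, ENNReal.toReal_zero]

lemma invariantIncrementsDir_vertical (h𝓜 : IsStableRandomMeasure α (limitControl β φ₁) P' 𝓜)
    (hα : 1 < α) (R : LimitRegime α β φ₁ γ ρ 1 0) :
    InvariantIncrementsDir P' (limitField P' α β φ₁ γ 𝓜) verticalAxis := by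
  rintro K K' hK hK' ⟨w, hw, hlo, hhi⟩
  have hw0 : w.1 = 0 := by simpa [PlaneLine.toSet, verticalAxis] using hw
  refine (isStableIntegral_increment h𝓜 hα R (K.lo_mem hK)).ae_eq_of_ae_eq h𝓜 hα.le
    (isStableIntegral_increment h𝓜 hα R (K'.lo_mem hK')) (Eventually.of_forall fun e => ?_)
  simp only [PlaneRect.kernel, limitRect, limitLevel_zero measurableSet_Ioc, Real.volume_Ioc, hlo,
    hhi, Prod.fst_add, Prod.snd_add, hw0, zero_add, add_sub_add_left_eq_sub]

end Directions

/-! ### Type I long-range dependence -/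

section TypeI

variable {α β γ φ₁ : ℝ} {φ : ℝ → ℝ}

lemma scalingExponent_pos (hα : 1 < α) (hβ : β < α - 1) (hγ : 0 < γ) :
    0 < scalingExponent α β γ := by
  have h1 : 0 < γ * (α - β) := mul_pos hγ (by linarith)
  have h2 : 0 < α * γ := by positivity
  unfold scalingExponent
  split_ifs
  · exact div_pos (by linarith) (by linarith)
  · exact div_pos (by nlinarith) (by linarith)
  · exact div_pos (by linarith) (by linarith)

variable {Ω' : Type*} [MeasurableSpace Ω'] {P' : Measure Ω'} [IsProbabilityMeasure P']
variable {𝓜 : Set (ℝ × ℝ × ℝ) → Ω' → ℝ}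

/-- Every `γ > 0` falls into one of the regimes; the regime decides between dependent and
semi-dependent increments of the limit field. -/
lemma exists_limitRegime (h𝓜 : IsStableRandomMeasure α (limitControl β φ₁) P' 𝓜) (hα : 1 < α)
    (hβ' : β < α - 1) (hβne : β ≠ (α - 1) / 2) (hγ : 0 < γ) (hφ : IsMixingDensity β φ₁ φ) :
    ∃ ρ ρ' ε : ℝ, LimitRegime α β φ₁ γ ρ ρ' ε ∧
      (γ = 1 / 2 → DependentIncrements P' (limitField P' α β φ₁ γ 𝓜)) ∧
      (γ ≠ 1 / 2 → SemiDependentIncrements P' (limitField P' α β φ₁ γ 𝓜)) := by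
  obtain ⟨ρ, ρ', ε, hcases, hk, hR⟩ := exists_scalingRegime hα hφ.beta_pos hβ' hβne hγ
  obtain ⟨p, q, N, L, c, R⟩ := hR (fun n : ℕ => (n : ℝ) + 1) (fun n => by positivity)
    tendsto_natCast_add_one
  have R' : LimitRegime α β φ₁ γ ρ ρ' ε := R.limitRegime hα hγ hφ hk
  have h0 : ((0 : ℝ), (0 : ℝ)) ∈ horizontalAxis.toSet := by
    simp [PlaneLine.toSet, horizontalAxis]
  have h0' : ((0 : ℝ), (0 : ℝ)) ∈ verticalAxis.toSet := by
    simp [PlaneLine.toSet, verticalAxis]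
  refine ⟨ρ, ρ', ε, R', ?_⟩
  rcases hcases with ⟨h, rfl, rfl, rfl⟩ | ⟨h, rfl, rfl, rfl⟩ | ⟨h, -, rfl, rfl, rfl⟩ |
    ⟨h, -, rfl, rfl, rfl⟩
  · exact ⟨fun _ => dependentIncrements_half h𝓜 hα hφ.coeff_pos R', fun h' => absurd h h'⟩
  · exact ⟨fun h' => absurd h' h.ne', fun _ => ⟨_, _, h0, h0',
      dependentIncrementsDir_horizontal h𝓜 hα hφ.coeff_pos R'
        fun v hv => volume_level_zero_ne_zero ⟨hv.1, hv.2.le⟩,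
      Or.inl (indepIncrementsDir_vertical h𝓜 hα R')⟩⟩
  · exact ⟨fun h' => absurd h' h.ne, fun _ => ⟨_, _, h0', h0,
      dependentIncrementsDir_vertical h𝓜 hα hφ.coeff_pos R',
      Or.inl (indepIncrementsDir_horizontal h𝓜 hα R')⟩⟩
  · exact ⟨fun h' => absurd h' h.ne, fun _ => ⟨_, _, h0, h0',
      dependentIncrementsDir_horizontal h𝓜 hα hφ.coeff_pos R'
        fun v _ => volume_level_one_ne_zero one_lt_two _,
      Or.inr (invariantIncrementsDir_vertical h𝓜 hα R')⟩⟩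

end TypeI

end StableLRD

end

theorem mainTheorem1
    {Ω : Type u} [MeasurableSpace Ω] (P : Measure Ω) [IsProbabilityMeasure P]
    {Ω' : Type v} [MeasurableSpace Ω'] (P' : Measure Ω') [IsProbabilityMeasure P']
    (α β φ₁ : ℝ) (φ : ℝ → ℝ)
    (hα₁ : 1 < α) (hα₂ : α ≤ 2)
    (hβ₁ : 0 < β) (hβ₂ : β < α - 1) (hβ₃ : β ≠ (α - 1) / 2)
    -- `φ` is a bounded probability density on `[0,1)` with `φ(a) ~ φ₁ (1 - a)^β` as `a ↗ 1`
    (hφ_meas : Measurable φ)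
    (hφ_nonneg : ∀ a ∈ Ico (0 : ℝ) 1, 0 ≤ φ a)
    (hφ_int : ∫ a in Ico (0 : ℝ) 1, φ a = 1)
    (hφ_bdd : ∃ C : ℝ, ∀ a ∈ Ico (0 : ℝ) 1, φ a ≤ C)
    (hφ₁ : 0 < φ₁)
    (hφ_asymp : Asymptotics.IsEquivalent (𝓝[<] (1 : ℝ)) φ (fun a => φ₁ * (1 - a) ^ β))
    -- the random measure on `ℤ² × [0,1)` that drives the aggregated field
    (M : Set ((ℤ × ℤ) × ℝ) → Ω → ℝ)
    (hM : IsStableRandomMeasure α (latticeControl φ) P M)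
    -- the random measure on `ℝ² × (0,∞)` that drives the limit fields
    (𝓜 : Set (ℝ × ℝ × ℝ) → Ω' → ℝ)
    (h𝓜 : IsStableRandomMeasure α (limitControl β φ₁) P' 𝓜) :
    -- the stochastic integral that defines the aggregated field exists
    (∀ p : ℤ × ℤ, IsStableIntegral α (latticeControl φ) P M (aggregatedKernel p)
      (aggregated3N P α φ M p)) ∧
    (∀ γ : ℝ, 0 < γ →
      -- the stochastic integral that defines the limit field exists, and the limit field is
      -- operator scaling
      (∀ p ∈ closedQuadrant, IsStableIntegral α (limitControl β φ₁) P' 𝓜 (limitKernel α β γ p)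
        (limitField P' α β φ₁ γ 𝓜 p)) ∧
      IsOperatorScaling P' (limitField P' α β φ₁ γ 𝓜) (scalingExponent α β γ) γ ∧
      -- convergence of the normalized partial sums
      FddTendsto P P' openQuadrant
        (normalizedSum (aggregated3N P α φ M) (scalingExponent α β γ) γ)
        (limitField P' α β φ₁ γ 𝓜)) ∧
    HasTypeIAnisotropicLRD.{u, v} P (aggregated3N P α φ M) (1 / 2) := by
  have hφ : IsMixingDensity β φ₁ φ := ⟨hφ_meas, hφ_bdd, hβ₁, hφ₁, hφ_asymp⟩
  refine ⟨isStableIntegral_aggregated3N hM hα₁ hφ, fun γ hγ => ?_,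
    ⟨isStationaryField_aggregated3N hM hα₁ hφ, by norm_num, fun γ hγ => ?_⟩, by norm_num⟩
  · obtain ⟨ρ, ρ', ε, R, -, -⟩ := exists_limitRegime h𝓜 hα₁ hβ₂ hβ₃ hγ hφ
    exact ⟨fun p hp => isStableIntegral_limitField h𝓜 hα₁ R hp,
      isOperatorScaling_limitField h𝓜 hα₁ hβ₂ hβ₃ hγ hφ R,
      fddTendsto_normalizedSum hM h𝓜 hα₁ hβ₂ hβ₃ hγ hφ R⟩
  · obtain ⟨ρ, ρ', ε, R, hdep, hsemi⟩ := exists_limitRegime h𝓜 hα₁ hβ₂ hβ₃ hγ hφ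
    exact ⟨scalingExponent α β γ, scalingExponent_pos hα₁ hβ₂ hγ, Ω', _, P', ‹_›,
      limitField P' α β φ₁ γ 𝓜, fddTendsto_normalizedSum hM h𝓜 hα₁ hβ₂ hβ₃ hγ hφ R,
      hasStationaryRectIncrements_limitField h𝓜 hα₁ R, vanishesOnAxes_limitField h𝓜 hα₁ R,
      hdep, hsemi⟩
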